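/- Let $p>2$ be a prime and $L$ a finite extension of $\mathbb{Q}_p$. Let $\mathcal{R}_L$ be the Robba ring with coefficients in $L$, i.e. the ring of Laurent series $f=\sum_{k\in\mathbb{Z}}a_kT^k$ with $a_k\in L$ that converge on some annulus $r\le |T|<1$ (with $r<1$ depending on $f$). Let $\Gamma=\mathrm{Gal}(\mathbb{Q}_p(\mu_{p^\infty})/\mathbb{Q}_p)$, identified with $\mathbb{Z}_p^\times$ by the cyclotomic character $\chi$, and let $\varphi$ and $\Gamma$ act $L$-linearly on $\mathcal{R}_L$ by $\varphi(f(T))=f((1+T)^p-1)$ and $\gamma(f(T))=f((1+T)^{\chi(\gamma)}-1)$. Put $\partial=(1+T)\frac{d}{dT}$. For a continuous character $\delta:\mathbb{Q}_p^\times\to L^\times$ let $\mathcal{R}(\delta)=\mathcal{R}_L v$ be the rank one $(\varphi,\Gamma)$-module with $\varphi(fv)=\delta(p)\varphi(f)v$ and $\gamma(fv)=\delta(\chi(\gamma))\gamma(f)v$; elements $fv$ are denoted by $f$. Let $\gamma$ be a topological generator of $\Gamma$, and let $$H^2(\delta)=\mathcal{R}(\delta)\big/\big((\varphi-1)\mathcal{R}(\delta)+(\gamma-1)\mathcal{R}(\delta)\big)$$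 be the second cohomology of the complex $\mathcal{R}(\delta)\xrightarrow{x\mapsto((\gamma-1)x,\,(\varphi-1)x)}\mathcal{R}(\delta)\oplus\mathcal{R}(\delta)\xrightarrow{(x,y)\mapsto(\varphi-1)x-(\gamma-1)y}\mathcal{R}(\delta)$. Let $x:\mathbb{Q}_p^\times\to L^\times$ be the character given by the inclusion $\mathbb{Q}_p\subset L$, let $|x|$ be the character $y\mapsto p^{-v_p(y)}$, and let $\omega=x|x|$. If $\delta=\omega x^k$ for some integer $k\ge 0$, then $H^2(\delta)$ is a one-dimensional $L$-vector space, generated by the class of $\partial^k(1/T)$. If $\delta$ is not of this form, then $H^2(\delta)=0$. -/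

import Mathlib

open Filter Topology

noncomputable section

namespace PhiGamma

/-! ## The Robba ring -/

/-- The underlying `L`-vector space of the Robba ring `𝓡_L` over a finite extension `L` of `ℚ_p`:
Laurent series `∑_{k ∈ ℤ} a_k T^k` (given by their coefficients `k ↦ a_k ∈ L`) that converge on
some annulus `r ≤ |T| < 1`, that is, `|a_k| ρ^k → 0` as `k → ±∞` for every `ρ` in `[r, 1)`. -/
def RobbaRing (L : Type*) [NormedField L] : Submodule L (ℤ → L) where
  carrier := {a | ∃ r : ℝ, 0 < r ∧ r < 1 ∧ ∀ ρ : ℝ, r ≤ ρ → ρ < 1 →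
    Tendsto (fun k : ℤ => ‖a k‖ * ρ ^ k) cofinite (𝓝 0)}
  zero_mem' := ⟨1 / 2, by norm_num, by norm_num, fun ρ _ _ => by simp⟩
  add_mem' := by
    rintro a b ⟨r, hr0, hr1, hr⟩ ⟨s, hs0, hs1, hs⟩
    refine ⟨max r s, lt_max_of_lt_left hr0, max_lt hr1 hs1, fun ρ h1 h2 => ?_⟩
    have hρ : 0 < ρ := hr0.trans_le ((le_max_left _ _).trans h1)
    have h := (hr ρ ((le_max_left _ _).trans h1) h2).add (hs ρ ((le_max_right _ _).trans h1) h2)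
    rw [add_zero] at h
    refine squeeze_zero (fun k => by positivity) (fun k => ?_) h
    rw [← add_mul]
    exact mul_le_mul_of_nonneg_right (norm_add_le _ _) (by positivity)
  smul_mem' := by
    rintro c a ⟨r, hr0, hr1, hr⟩
    refine ⟨r, hr0, hr1, fun ρ h1 h2 => ?_⟩
    have h := (hr ρ h1 h2).const_mul ‖c‖
    rw [mul_zero] at h
    refine h.congr fun k => ?_
    simp [mul_assoc]

section Substitution

/-! ### Substitution into Laurent series

Both `φ` and the elements of `Γ` act by substitution, `∑ a_k T^k ↦ ∑ a_k S^k` where `S` is the image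
of `T`. If `c k n` is the coefficient of `T^n` in the Laurent expansion of `S^k`, then the
coefficient of `T^n` in the image is `∑_k a_k c_{k,n}`. -/

variable {L : Type*} [NormedField L]

/-- The Laurent series `∑_k a_k S^k`, where `c k n` is the coefficient of `T^n` in `S^k`. -/
def subst (c : ℤ → ℤ → L) (a : ℤ → L) (n : ℤ) : L := ∑' k : ℤ, a k * c k n

/-- A bound on the coefficients of the powers of `S` under which substitution of `S` converges and
preserves the Robba ring. -/
def Substitutable (c : ℤ → ℤ → L) : Prop :=
  ∀ a ∈ RobbaRing L, ∃ r : ℝ, 0 < r ∧ r < 1 ∧ ∀ ρ : ℝ, r ≤ ρ → ρ < 1 →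
    ∃ z : ℤ × ℤ → ℝ, Tendsto z cofinite (𝓝 0) ∧ ∀ k n, ‖a k * c k n‖ * ρ ^ n ≤ z (k, n)

theorem Substitutable.subst_mem [IsUltrametricDist L] {c : ℤ → ℤ → L} (hc : Substitutable c)
    {a : ℤ → L} (ha : a ∈ RobbaRing L) : subst c a ∈ RobbaRing L := by
  obtain ⟨r, hr0, hr1, hr⟩ := hc a ha
  refine ⟨r, hr0, hr1, fun ρ h1 h2 => ?_⟩
  have hρ : 0 < ρ := hr0.trans_le h1
  obtain ⟨z, hz, h⟩ := hr ρ h1 h2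
  rw [Metric.tendsto_nhds]
  intro ε hε
  have h2 := hz.eventually (gt_mem_nhds (half_pos hε))
  rw [Filter.eventually_cofinite] at h2 ⊢
  refine (h2.image Prod.snd).subset fun n hn => ?_
  by_contra hcon
  apply hn
  have hk : ∀ k, ‖a k * c k n‖ ≤ (ε / 2) / ρ ^ n := by
    intro k
    rw [le_div_iff₀ (by positivity)]
    refine (h k n).trans ?_
    by_contra hlt
    exact hcon ⟨(k, n), fun hh => hlt hh.le, rfl⟩
  have hsum : ‖subst c a n‖ ≤ (ε / 2) / ρ ^ n :=
    IsUltrametricDist.norm_tsum_le_of_forall_le_of_nonneg (by positivity) hk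
  rw [le_div_iff₀ (by positivity)] at hsum
  rw [Real.dist_0_eq_abs, abs_of_nonneg (by positivity)]
  linarith

theorem Substitutable.summable [IsUltrametricDist L] [CompleteSpace L] {c : ℤ → ℤ → L}
    (hc : Substitutable c) {a : ℤ → L} (ha : a ∈ RobbaRing L) (n : ℤ) :
    Summable fun k => a k * c k n := by
  obtain ⟨r, hr0, hr1, hr⟩ := hc a ha
  obtain ⟨z, hz, h⟩ := hr r le_rfl hr1
  apply NonarchimedeanAddGroup.summable_of_tendsto_cofinite_zero
  rw [tendsto_zero_iff_norm_tendsto_zero]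
  have hi : Function.Injective fun k : ℤ => (k, n) := fun k l hkl => (Prod.mk.inj hkl).1
  have h2 := (hz.comp hi.tendsto_cofinite).div_const (r ^ n)
  rw [zero_div] at h2
  refine squeeze_zero (fun k => norm_nonneg _) (fun k => ?_) h2
  rw [le_div_iff₀ (by positivity)]
  exact h k n

theorem subst_smul (c : ℤ → ℤ → L) (z : L) (a : ℤ → L) :
    subst c (z • a) = z • subst c a := by
  funext n
  simp only [subst, Pi.smul_apply, smul_eq_mul, mul_assoc]
  exact tsum_mul_left

theorem Substitutable.subst_add [IsUltrametricDist L] [CompleteSpace L] {c : ℤ → ℤ → L}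
    (hc : Substitutable c) {a b : ℤ → L} (ha : a ∈ RobbaRing L) (hb : b ∈ RobbaRing L) :
    subst c (a + b) = subst c a + subst c b := by
  funext n
  simp only [subst, Pi.add_apply, add_mul]
  exact (hc.summable ha n).tsum_add (hc.summable hb n)

/-- The bound that is used for `φ` and for `Γ`. -/
theorem tendsto_bound {x y : ℤ → ℝ} {s : ℤ → ℤ → ℤ}
    (hs : Function.Injective fun q : ℤ × ℤ => (q.1, s q.1 q.2))
    (hx : Tendsto x cofinite (𝓝 0)) (hy : Tendsto y cofinite (𝓝 0)) :
    Tendsto (fun q : ℤ × ℤ => x q.1 * y (s q.1 q.2)) cofinite (𝓝 0) :=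
  (tendsto_mul_cofinite_nhds_zero hx hy).comp hs.tendsto_cofinite

/-- Power series whose `n`-th coefficient is at most `r ^ n` for all `n`. -/
def Small (r : ℝ) (u : PowerSeries L) : Prop := ∀ n, ‖PowerSeries.coeff n u‖ ≤ r ^ n

theorem Small.one {r : ℝ} (hr : 0 ≤ r) : Small r (1 : PowerSeries L) := by
  intro n
  rw [PowerSeries.coeff_one]
  split_ifs with h
  · simp [h]
  · simpa using pow_nonneg hr n

theorem Small.mul [IsUltrametricDist L] {r : ℝ} (hr : 0 ≤ r) {u v : PowerSeries L} (hu : Small r u) (hv : Small r v) :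
    Small r (u * v) := by
  intro n
  rw [PowerSeries.coeff_mul]
  refine IsUltrametricDist.norm_sum_le_of_forall_le_of_nonneg (pow_nonneg hr n) fun q hq => ?_
  rw [norm_mul, ← Finset.HasAntidiagonal.mem_antidiagonal.mp hq, pow_add]
  exact mul_le_mul (hu _) (hv _) (norm_nonneg _) (pow_nonneg hr _)

theorem Small.pow [IsUltrametricDist L] {r : ℝ} (hr : 0 ≤ r) {u : PowerSeries L} (hu : Small r u) (m : ℕ) :
    Small r (u ^ m) := by
  induction m with
  | zero => simpa using Small.one hr
  | succ m ih => rw [pow_succ]; exact ih.mul hr hu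

theorem Small.inv [IsUltrametricDist L] {r : ℝ} (hr : 0 ≤ r) {u : PowerSeries L} (hu : Small r u)
    (h0 : ‖PowerSeries.constantCoeff u‖ = 1) : Small r u⁻¹ := by
  intro n
  induction n using Nat.strong_induction_on with
  | _ n ih =>
    rw [PowerSeries.coeff_inv]
    split_ifs with hn
    · simp [hn, h0]
    · rw [norm_mul, norm_neg, norm_inv, h0, inv_one, one_mul]
      refine IsUltrametricDist.norm_sum_le_of_forall_le_of_nonneg (pow_nonneg hr n) fun q hq => ?_
      split_ifs with hlt
      · rw [norm_mul, ← Finset.HasAntidiagonal.mem_antidiagonal.mp hq, pow_add]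
        exact mul_le_mul (hu _) (ih _ hlt) (norm_nonneg _) (pow_nonneg hr _)
      · simpa using pow_nonneg hr n

/-- Bound for the coefficients of the powers of `T ^ m * u(T)`, `u` a small unit. -/
theorem norm_coeff_zpow_le [IsUltrametricDist L] {r : ℝ} (hr : 0 ≤ r) {u : PowerSeries L} (hu : Small r u)
    (h0 : ‖PowerSeries.constantCoeff u‖ = 1) (m k i : ℤ) :
    ‖((HahnSeries.single m 1 * HahnSeries.ofPowerSeries ℤ L u : LaurentSeries L) ^ k).coeff i‖ ≤
      if m * k ≤ i then r ^ (i - m * k).toNat else 0 := by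
  have hne : PowerSeries.constantCoeff u ≠ 0 := by
    intro h; simp [h] at h0
  obtain ⟨v, hv, hk⟩ : ∃ v : PowerSeries L, Small r v ∧
      (HahnSeries.ofPowerSeries ℤ L u : LaurentSeries L) ^ k = HahnSeries.ofPowerSeries ℤ L v := by
    obtain ⟨j, rfl | rfl⟩ := k.eq_nat_or_neg
    · exact ⟨u ^ j, hu.pow hr j, by simp⟩
    · refine ⟨u⁻¹ ^ j, (hu.inv hr h0).pow hr j, ?_⟩
      have h1 : (HahnSeries.ofPowerSeries ℤ L u⁻¹ : LaurentSeries L) =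
          (HahnSeries.ofPowerSeries ℤ L u)⁻¹ := by
        refine eq_inv_of_mul_eq_one_left ?_
        rw [← map_mul, PowerSeries.inv_mul_cancel u hne, map_one]
      rw [zpow_neg, zpow_natCast, map_pow, h1, inv_pow]
  have hs : (HahnSeries.single m 1 : LaurentSeries L) ^ k = HahnSeries.single (m * k) 1 := by
    obtain ⟨j, rfl | rfl⟩ := k.eq_nat_or_neg
    · simp [HahnSeries.single_pow, mul_comm]
    · rw [zpow_neg, zpow_natCast, HahnSeries.single_pow, one_pow]
      refine inv_eq_of_mul_eq_one_right ?_
      rw [HahnSeries.single_mul_single]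
      simp [mul_comm]
  rw [mul_zpow, hk, hs, HahnSeries.coeff_single_mul, one_mul, PowerSeries.coeff_coe]
  split_ifs with h1 h2 h2
  · omega
  · simp
  · have : (i - m * k).natAbs = (i - m * k).toNat := by omega
    rw [this]
    exact hv _
  · omega

theorem tendsto_geom {q : ℝ} (h0 : 0 ≤ q) (h1 : q < 1) :
    Tendsto (fun j : ℤ => if 0 ≤ j then q ^ j.toNat else 0) cofinite (𝓝 0) := by
  rw [Int.cofinite_eq, tendsto_sup]
  constructor
  · refine tendsto_const_nhds.congr' ?_
    filter_upwards [eventually_lt_atBot 0] with j hj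
    rw [if_neg (by omega)]
  · have : Tendsto Int.toNat atTop atTop := by
      rw [tendsto_atTop]
      intro b
      filter_upwards [eventually_ge_atTop (b : ℤ)] with j hj
      omega
    refine ((tendsto_pow_atTop_nhds_zero_of_lt_one h0 h1).comp this).congr' ?_
    filter_upwards [eventually_ge_atTop 0] with j hj
    rw [if_pos hj]; rfl

end Substitution

section Operators

variable (p : ℕ) [Fact p.Prime] (L : Type*) [NormedField L]
  [NormedAlgebra ℚ_[p] L]

theorem ultrametric (p : ℕ) [Fact p.Prime] (L : Type*) [NormedField L] [NormedAlgebra ℚ_[p] L] :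
    IsUltrametricDist L := IsUltrametricDist.of_normedAlgebra ℚ_[p]

/-! ### The Frobenius `φ`, `φ(T) = (1 + T) ^ p - 1` -/

/-- `φ(T) = (1 + T) ^ p - 1` as a Laurent polynomial in `X = T⁻¹`, in the field `L((T⁻¹))`. -/
def phiT : LaurentSeries L := (1 + HahnSeries.single (-1) 1) ^ p - 1

/-- The coefficient of `T ^ n` in `φ(T) ^ k`, `k ∈ ℤ`. Since
`φ(T) = T ^ p (1 + p T⁻¹ + ⋯ + p T ^ (1 - p))`, with the sum in parentheses of the form
`1 +` (terms of absolute value `< 1`) for `|T|` close to `1`, the expansion of `φ(T) ^ k` near the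
boundary of the unit disk is the one in powers of `X = T⁻¹`, in which `T ^ n` is `X ^ (-n)`. -/
def phiCoeff (k n : ℤ) : L := (phiT p L ^ k).coeff (-n)

/-! ### The action of `Γ ≅ ℤ_pˣ`, `γ(T) = (1 + T) ^ χ(γ) - 1` -/

variable {p} in
/-- `(1 + T) ^ g - 1`, for `g ∈ ℤ_pˣ`, with `(1 + T) ^ g = ∑ (g choose n) T ^ n`. -/
def gammaT (g : ℤ_[p]ˣ) : LaurentSeries L :=
  HahnSeries.ofPowerSeries ℤ L
    (PowerSeries.mk fun n => algebraMap ℚ_[p] L ((Ring.choose (g : ℤ_[p]) n : ℤ_[p]) : ℚ_[p])) - 1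

variable {p} in
/-- The coefficient of `T ^ n` in `γ(T) ^ k`, `k ∈ ℤ`. As `γ(T)` is `χ(γ) T` times a power series
with coefficients in `ℤ_p` and constant term `1`, the expansion is the one in `L((T))`. -/
def gammaCoeff (g : ℤ_[p]ˣ) (k n : ℤ) : L := (gammaT L g ^ k).coeff n

theorem phiT_eq : phiT p L = HahnSeries.single (-p : ℤ) 1 *
    HahnSeries.ofPowerSeries ℤ L ((1 + PowerSeries.X) ^ p - PowerSeries.X ^ p) := by
  have h1 : ∀ m : ℕ, (HahnSeries.single (-m : ℤ) 1 : LaurentSeries L) =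
      HahnSeries.single (-1 : ℤ) 1 ^ m := by
    intro m; simp [HahnSeries.single_pow]
  have h2 : (HahnSeries.single (-1 : ℤ) 1 : LaurentSeries L) * HahnSeries.single 1 1 = 1 := by
    rw [HahnSeries.single_mul_single]; simp [HahnSeries.single_zero_one]
  rw [h1, map_sub, map_pow, map_pow, map_add, map_one (HahnSeries.ofPowerSeries ℤ L),
    HahnSeries.ofPowerSeries_X, mul_sub,
    ← mul_pow, ← mul_pow, mul_add, h2, one_pow, mul_one, phiT, add_comm]

/-- A radius outside of which `φ(T) ^ k` expands in powers of `T⁻¹`. -/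
def phiRadius : ℝ := (p : ℝ)⁻¹ ^ (p : ℝ)⁻¹

theorem phiRadius_pow : phiRadius p ^ p = (p : ℝ)⁻¹ :=
  Real.rpow_inv_natCast_pow (by positivity) (Fact.out (p := p.Prime)).ne_zero

theorem phiRadius_pos : 0 < phiRadius p := by
  have := (Fact.out (p := p.Prime)).pos
  unfold phiRadius; positivity

theorem phiRadius_lt_one : phiRadius p < 1 := by
  have h1 : (1 : ℝ) < p := by exact_mod_cast (Fact.out (p := p.Prime)).one_lt
  exact Real.rpow_lt_one (by positivity) (inv_lt_one_of_one_lt₀ h1) (by positivity)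

theorem phi_coeff_series (n : ℕ) :
    PowerSeries.coeff n ((1 + PowerSeries.X) ^ p - PowerSeries.X ^ p : PowerSeries L) =
      if n < p then ((p.choose n : ℕ) : L) else 0 := by
  have h : ((1 + PowerSeries.X) ^ p : PowerSeries L) =
      (((1 + Polynomial.X) ^ p : Polynomial L) : PowerSeries L) := by simp
  rw [map_sub, h, Polynomial.coeff_coe, Polynomial.coeff_one_add_X_pow, PowerSeries.coeff_X_pow]
  rcases lt_trichotomy n p with h | h | h
  · simp [h, h.ne]
  · simp [h]
  · simp [h.not_gt, h.ne', Nat.choose_eq_zero_of_lt h]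

theorem phi_small :
    Small (phiRadius p) ((1 + PowerSeries.X) ^ p - PowerSeries.X ^ p : PowerSeries L) := by
  intro n
  rw [phi_coeff_series]
  split_ifs with hn
  · rcases Nat.eq_zero_or_pos n with h0 | h0
    · simp [h0]
    · obtain ⟨m, hm⟩ := (Fact.out (p := p.Prime)).dvd_choose_self h0.ne' hn
      have hp : ‖((p : ℕ) : L)‖ = (p : ℝ)⁻¹ := by
        rw [← map_natCast (algebraMap ℚ_[p] L) p, norm_algebraMap', Padic.norm_p]
      rw [hm, Nat.cast_mul, norm_mul, hp, ← phiRadius_pow]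
      calc phiRadius p ^ p * ‖(m : L)‖ ≤ phiRadius p ^ p * 1 := by
            have := ultrametric p L
            have := IsUltrametricDist.norm_natCast_le_one L m
            have := (phiRadius_pos p).le
            gcongr
        _ ≤ phiRadius p ^ n := by
            rw [mul_one]
            exact pow_le_pow_of_le_one (phiRadius_pos p).le (phiRadius_lt_one p).le hn.le
  · have := (phiRadius_pos p).le
    simpa using pow_nonneg this n

theorem norm_phiCoeff_le (k n : ℤ) :
    ‖phiCoeff p L k n‖ ≤ if 0 ≤ p * k - n then phiRadius p ^ (p * k - n).toNat else 0 := by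
  have := ultrametric p L
  have h0 : ‖PowerSeries.constantCoeff ((1 + PowerSeries.X) ^ p - PowerSeries.X ^ p :
      PowerSeries L)‖ = 1 := by
    rw [← PowerSeries.coeff_zero_eq_constantCoeff_apply, phi_coeff_series]
    simp [(Fact.out (p := p.Prime)).pos]
  have h := norm_coeff_zpow_le (phiRadius_pos p).le (phi_small p L) h0 (-p) k (-n)
  rw [← phiT_eq] at h
  have e : -n - -(p : ℤ) * k = p * k - n := by ring
  have e2 : -(p : ℤ) * k ≤ -n ↔ 0 ≤ p * k - n := by
    constructor <;> intro h <;> linarith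
  rw [e] at h
  simpa only [e2, phiCoeff] using h

variable {p} in
theorem norm_gammaCoeff_le (g : ℤ_[p]ˣ) (k n : ℤ) :
    ‖gammaCoeff L g k n‖ ≤ if 0 ≤ n - k then 1 else 0 := by
  have := ultrametric p L
  set u : PowerSeries L := PowerSeries.mk fun n =>
    algebraMap ℚ_[p] L ((Ring.choose (g : ℤ_[p]) (n + 1) : ℤ_[p]) : ℚ_[p]) with hu
  have hT : gammaT L g = HahnSeries.single 1 1 * HahnSeries.ofPowerSeries ℤ L u := by
    rw [gammaT, ← HahnSeries.ofPowerSeries_X, ← map_mul, ← map_one (HahnSeries.ofPowerSeries ℤ L),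
      ← map_sub]
    congr 1
    ext n
    cases n with
    | zero => simp
    | succ n =>
      rw [mul_comm, PowerSeries.coeff_succ_mul_X]
      simp [hu, PowerSeries.coeff_one]
  have hs : Small 1 u := by
    intro n
    rw [hu, PowerSeries.coeff_mk, norm_algebraMap', one_pow]
    exact PadicInt.norm_le_one _
  have h0 : ‖PowerSeries.constantCoeff u‖ = 1 := by
    rw [← PowerSeries.coeff_zero_eq_constantCoeff_apply, hu, PowerSeries.coeff_mk,
      norm_algebraMap']
    simpa using PadicInt.norm_units g
  have h := norm_coeff_zpow_le zero_le_one hs h0 1 k n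
  rw [← hT] at h
  simpa [gammaCoeff] using h

theorem substitutable_phi : Substitutable (phiCoeff p L) := by
  rintro a ⟨r, hr0, hr1, hr⟩
  have hp0 := (Fact.out (p := p.Prime)).ne_zero
  have hR0 := phiRadius_pos p
  have hR1 := phiRadius_lt_one p
  set s : ℝ := r ^ (p : ℝ)⁻¹ with hs
  have hsp : s ^ p = r := Real.rpow_inv_natCast_pow hr0.le hp0
  have hs0 : 0 < s := by positivity
  have hs1 : s < 1 := Real.rpow_lt_one hr0.le hr1 (by positivity)
  refine ⟨max s ((1 + phiRadius p) / 2), lt_max_of_lt_left hs0, max_lt hs1 (by linarith),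
    fun ρ h1 h2 => ?_⟩
  have hρs : s ≤ ρ := (le_max_left _ _).trans h1
  have hρR : phiRadius p < ρ := by
    have := (le_max_right _ _).trans h1
    linarith
  have hρ : 0 < ρ := hs0.trans_le hρs
  have hρp : r ≤ ρ ^ p := by rw [← hsp]; gcongr
  have hρp1 : ρ ^ p < 1 := pow_lt_one₀ hρ.le h2 hp0
  refine ⟨_, tendsto_bound (x := fun k => ‖a k‖ * (ρ ^ p) ^ k)
    (y := fun j => if 0 ≤ j then (phiRadius p / ρ) ^ j.toNat else 0)
    (s := fun k n => p * k - n) ?_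
    (hr _ hρp hρp1) (tendsto_geom (by positivity) ((div_lt_one hρ).mpr hρR)), ?_⟩
  · rintro ⟨k, n⟩ ⟨k', n'⟩ h
    simp only [Prod.mk.injEq] at h ⊢
    obtain ⟨rfl, h⟩ := h
    exact ⟨rfl, by linarith⟩
  · intro k n
    have hc := norm_phiCoeff_le p L k n
    rw [norm_mul]
    split_ifs with hj
    · rw [if_pos hj] at hc
      obtain ⟨j, hj'⟩ := Int.eq_ofNat_of_zero_le hj
      have hn : n = p * k - j := by linarith
      rw [hj', Int.toNat_natCast] at hc
      have e : (ρ ^ p) ^ k * (phiRadius p / ρ) ^ (p * k - n).toNat =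
          phiRadius p ^ j * ρ ^ n := by
        rw [hj', Int.toNat_natCast, hn, div_pow, zpow_sub₀ hρ.ne', zpow_mul, zpow_natCast,
          zpow_natCast]
        ring
      rw [mul_assoc, mul_assoc, e]
      gcongr
    · rw [if_neg hj] at hc
      rw [le_antisymm hc (norm_nonneg _)]
      simp

variable {p} in
theorem substitutable_gamma (g : ℤ_[p]ˣ) : Substitutable (gammaCoeff L g) := by
  rintro a ⟨r, hr0, hr1, hr⟩
  refine ⟨r, hr0, hr1, fun ρ h1 h2 => ?_⟩
  have hρ : 0 < ρ := hr0.trans_le h1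
  refine ⟨_, tendsto_bound (x := fun k => ‖a k‖ * ρ ^ k)
    (y := fun j => if 0 ≤ j then ρ ^ j.toNat else 0) (s := fun k n => n - k) ?_
    (hr ρ h1 h2) (tendsto_geom hρ.le h2), ?_⟩
  · rintro ⟨k, n⟩ ⟨k', n'⟩ h
    simp only [Prod.mk.injEq] at h ⊢
    obtain ⟨rfl, h⟩ := h
    exact ⟨rfl, by linarith⟩
  · intro k n
    have hc := norm_gammaCoeff_le L g k n
    rw [norm_mul]
    split_ifs with hj
    · rw [if_pos hj] at hc
      obtain ⟨j, hj'⟩ := Int.eq_ofNat_of_zero_le hj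
      have hn : n = k + j := by linarith
      rw [hj', Int.toNat_natCast, hn, zpow_add₀ hρ.ne', zpow_natCast, ← mul_assoc]
      rw [hn] at hc
      gcongr
      exact mul_le_of_le_one_right (norm_nonneg _) hc
    · rw [if_neg hj] at hc
      rw [le_antisymm hc (norm_nonneg _)]
      simp

variable [FiniteDimensional ℚ_[p] L]

/-- The `L`-linear Frobenius `φ : 𝓡_L → 𝓡_L`, `φ(f(T)) = f((1 + T) ^ p - 1)`. -/
def phi : RobbaRing L →ₗ[L] RobbaRing L where
  toFun a := ⟨subst (phiCoeff p L) a,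
    have := ultrametric p L
    (substitutable_phi p L).subst_mem a.2⟩
  map_add' a b := by
    have := ultrametric p L
    have := FiniteDimensional.complete ℚ_[p] L
    exact Subtype.ext ((substitutable_phi p L).subst_add a.2 b.2)
  map_smul' z a := Subtype.ext (subst_smul _ z a.1)

variable {p} in
/-- The `L`-linear action of `γ ∈ Γ` on `𝓡_L`, `γ(f(T)) = f((1 + T) ^ χ(γ) - 1)`. Here and below
`Γ` is identified with `ℤ_pˣ` by the cyclotomic character `χ`. -/
def gamma (g : ℤ_[p]ˣ) : RobbaRing L →ₗ[L] RobbaRing L where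
  toFun a := ⟨subst (gammaCoeff L g) a,
    have := ultrametric p L
    (substitutable_gamma L g).subst_mem a.2⟩
  map_add' a b := by
    have := ultrametric p L
    have := FiniteDimensional.complete ℚ_[p] L
    exact Subtype.ext ((substitutable_gamma L g).subst_add a.2 b.2)
  map_smul' z a := Subtype.ext (subst_smul _ z a.1)

/-- The derivation `∂ = (1 + T) d/dT` of `𝓡_L`. -/
def partialD : RobbaRing L →ₗ[L] RobbaRing L where
  toFun a := ⟨fun n => n * (a : ℤ → L) n + (n + 1 : ℤ) * (a : ℤ → L) (n + 1), by
    obtain ⟨a, r, hr0, hr1, hr⟩ := a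
    refine ⟨r, hr0, hr1, fun ρ h1 h2 => ?_⟩
    have hρ : 0 < ρ := hr0.trans_le h1
    have := ultrametric p L
    have hshift := (hr ρ h1 h2).comp (add_left_injective (1 : ℤ)).tendsto_cofinite
    have h := (hr ρ h1 h2).add (hshift.const_mul ρ⁻¹)
    rw [mul_zero, add_zero] at h
    refine squeeze_zero (fun n => by positivity) (fun n => ?_) h
    have e : ρ⁻¹ * (‖a (n + 1)‖ * ρ ^ (n + 1)) = ‖a (n + 1)‖ * ρ ^ n := by
      rw [zpow_add_one₀ hρ.ne']; field_simp
    simp only [Function.comp]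
    rw [e, ← add_mul]
    refine mul_le_mul_of_nonneg_right ((norm_add_le _ _).trans (add_le_add ?_ ?_)) (by positivity)
    · rw [norm_mul]
      exact mul_le_of_le_one_left (norm_nonneg _) (IsUltrametricDist.norm_intCast_le_one L n)
    · rw [norm_mul]
      exact mul_le_of_le_one_left (norm_nonneg _) (IsUltrametricDist.norm_intCast_le_one L _)⟩
  map_add' a b := by
    refine Subtype.ext (funext fun n => ?_)
    simp only [Submodule.coe_add, Pi.add_apply]
    ring
  map_smul' z a := by
    refine Subtype.ext (funext fun n => ?_)
    simp only [Submodule.coe_smul, Pi.smul_apply, smul_eq_mul, RingHom.id_apply]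
    ring

end Operators

/-- The element `1 / T` of `𝓡_L`. -/
def invT (L : Type*) [NormedField L] : RobbaRing L :=
  ⟨Pi.single (-1) 1, 1 / 2, by norm_num, by norm_num, fun ρ _ _ => by
    refine tendsto_nhds_of_eventually_eq ?_
    rw [eventually_cofinite]
    refine (Set.finite_singleton (-1 : ℤ)).subset fun k hk => ?_
    by_contra hne
    exact hk (by simp [Pi.single_eq_of_ne hne])⟩

/-! ## Characters of `ℚ_pˣ` and the rank one `(φ, Γ)`-modules `𝓡(δ)` -/

section Characters

variable (p : ℕ) [Fact p.Prime] (L : Type*) [NormedField L] [NormedAlgebra ℚ_[p] L]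

/-- The character `x : ℚ_pˣ → Lˣ` induced by the inclusion of `ℚ_p` in `L`. -/
def charX : ℚ_[p]ˣ →* Lˣ := Units.map (algebraMap ℚ_[p] L).toMonoidHom

/-- The element `p` of `ℚ_pˣ`. -/
def pUnit : ℚ_[p]ˣ := Units.mk0 (p : ℚ_[p]) (by exact_mod_cast (Fact.out (p := p.Prime)).ne_zero)

/-- The character `|x| : ℚ_pˣ → Lˣ`, `y ↦ p ^ (-v_p(y))`. -/
def charAbs : ℚ_[p]ˣ →* Lˣ where
  toFun y := charX p L (pUnit p) ^ (-(y : ℚ_[p]).valuation)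
  map_one' := by simp
  map_mul' y z := by
    rw [Units.val_mul, Padic.valuation_mul y.ne_zero z.ne_zero, neg_add, zpow_add]

/-- The character `ω = x|x|`. -/
def omega : ℚ_[p]ˣ →* Lˣ := charX p L * charAbs p L

variable {p L}

/-- The inclusion `ℤ_pˣ → ℚ_pˣ`. -/
def unitIncl : ℤ_[p]ˣ →* ℚ_[p]ˣ := Units.map PadicInt.Coe.ringHom.toMonoidHom

variable [FiniteDimensional ℚ_[p] L]

/-- The Frobenius of `𝓡(δ) = 𝓡_L v`: `φ(x v) = δ(p) φ(x) v`. As an `L`-vector space `𝓡(δ)` is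
identified with `𝓡_L` through its basis `v`. -/
def phiTwist (δ : ℚ_[p]ˣ →* Lˣ) : RobbaRing L →ₗ[L] RobbaRing L :=
  (δ (pUnit p) : L) • phi p L

/-- The action of `γ ∈ Γ` on `𝓡(δ) = 𝓡_L v`: `γ(x v) = δ(χ(γ)) γ(x) v`. -/
def gammaTwist (δ : ℚ_[p]ˣ →* Lˣ) (g : ℤ_[p]ˣ) : RobbaRing L →ₗ[L] RobbaRing L :=
  (δ (unitIncl g) : L) • gamma L g

/-- The second differential of the complex `0 → D → D ⊕ D → D → 0` for `D = 𝓡(δ)`,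
`(x, y) ↦ (φ - 1) x - (γ - 1) y`. -/
def d₂ (δ : ℚ_[p]ˣ →* Lˣ) (g : ℤ_[p]ˣ) : RobbaRing L × RobbaRing L →ₗ[L] RobbaRing L :=
  (phiTwist δ - LinearMap.id).coprod (-(gammaTwist δ g - LinearMap.id))

/-- `H²(δ) = H²(𝓡(δ)) = 𝓡(δ) / ((φ - 1) 𝓡(δ) + (γ - 1) 𝓡(δ))`, the cokernel of the second
differential, to be used for a topological generator `g = χ(γ)` of `Γ ≅ ℤ_pˣ`, which is procyclic
for `p > 2` (so that no torsion subgroup of `Γ` has to be divided out). -/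
abbrev H2 (δ : ℚ_[p]ˣ →* Lˣ) (g : ℤ_[p]ˣ) : Type _ :=
  RobbaRing L ⧸ LinearMap.range (d₂ δ g)

/-- The class in `H²(δ)` of an element of `𝓡(δ)`. -/
abbrev H2.cls (δ : ℚ_[p]ˣ →* Lˣ) (g : ℤ_[p]ˣ) : RobbaRing L →ₗ[L] H2 δ g :=
  (LinearMap.range (d₂ δ g)).mkQ

end Characters

end PhiGamma

end

open Filter Topology

noncomputable section

namespace PhiGamma

section

variable {p : ℕ} [Fact p.Prime] {L : Type*} [NormedField L] [NormedAlgebra ℚ_[p] L]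

/-! ## Binomial functions and binomial series with coefficients in `L` -/

/-! Write d = δ(p), c = δ(χ(γ)), and R⁺ for the series without negative powers of T (`posPart L 0`).
The pairing f ↦ (x ↦ res(f (1+T)^(x-1) dT)), called `amiceFun`, has kernel R⁺ and identifies R/R⁺
with the locally analytic functions on ℤ_p, which are taken here to be the functions with
geometrically decaying Mahler coefficients. On functions, φ becomes extension by zero along x ↦ px,
γ becomes F(x) ↦ χ(γ)⁻¹ F(χ(γ)⁻¹ x), ∂ becomes multiplication by -x, and 1/T becomes the constant 1.
So ∂^i(1/T) is the function (-x)^i, and the question is about functions once R⁺ has been dealt with.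

R⁺ consists of coboundaries (`posPart_le_coboundaries`). On T^N R⁺ with |d p^N| < 1 the operator 1 -
dφ can be inverted. To come down from N to 0, each m needs a coboundary in T^m R⁺ whose
T^m-coefficient is nonzero. If d p^m ≠ 1 or c χ(γ)^m ≠ 1, the image of T^m under dφ - 1 or cγ - 1
will do. Otherwise one takes a lift of the function x^(-m-1) on ℤ_pˣ, which cγ - 1 sends into R⁺.
Applying ∂^m reduces the claim to m = 0, where it is a computation modulo p based on 1/x ≡ x^(p-2)
(`coeff_gamma_sub_ne_zero`); this is where p ≠ 2 enters.

On functions supported on ℤ_pˣ the operator cγ - 1 is surjective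
(`LocAnalytic.exists_mul_comp_sub`): after passing to a power of γ close to 1, it is on each small
ball a perturbation of the difference operator A(z+1) - A(z). Hence modulo coboundaries F is d⁻¹
F(px) (`sub_smul_mem`). Iterating makes the Mahler coefficients as small as p^(-k), and then G - d⁻¹
G(px) = F is solvable up to a polynomial, because x ↦ px contracts the high Mahler coefficients. So
the classes of ∂^i(1/T) span H². The operators dφ - 1 and cγ - 1 kill each such class unless d = p^i
and c = χ(γ)^(i+1), that is, unless δ = ω x^i, by continuity of δ.

For δ = ω x^k the class survives (`partialD_pow_invT_notMem`): an expression of (-x)^k as a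
coboundary on pℤ_p can be divided by x repeatedly, and for k = 0 its value at x = 0 reads 1 = 0. -/

variable (p L) in
/-- The inclusion `ℤ_p → L`. -/
def intIncl : ℤ_[p] →+* L := (algebraMap ℚ_[p] L).comp PadicInt.Coe.ringHom

theorem intIncl_apply (x : ℤ_[p]) : intIncl p L x = algebraMap ℚ_[p] L (x : ℚ_[p]) := rfl

theorem norm_intIncl (x : ℤ_[p]) : ‖intIncl p L x‖ = ‖x‖ := by
  rw [intIncl_apply, norm_algebraMap', PadicInt.norm_def]

theorem norm_intIncl_le_one (x : ℤ_[p]) : ‖intIncl p L x‖ ≤ 1 := by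
  rw [norm_intIncl]; exact PadicInt.norm_le_one x

theorem intIncl_injective : Function.Injective (intIncl p L) :=
  (algebraMap ℚ_[p] L).injective.comp Subtype.val_injective

theorem continuous_intIncl : Continuous (intIncl p L) :=
  (AddMonoidHomClass.isometry_of_norm (intIncl p L) norm_intIncl).continuous

variable (L) in
/-- The binomial coefficient `x choose n`, as an element of `L`. -/
def bin (x : ℤ_[p]) (n : ℕ) : L := intIncl p L (Ring.choose x n)

theorem norm_bin_le_one (x : ℤ_[p]) (n : ℕ) : ‖bin L x n‖ ≤ 1 := norm_intIncl_le_one _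

@[simp] theorem bin_zero_right (x : ℤ_[p]) : bin L x 0 = 1 := by simp [bin]

@[simp] theorem bin_one_right (x : ℤ_[p]) : bin L x 1 = intIncl p L x := by simp [bin]

theorem bin_natCast (k n : ℕ) : bin L (k : ℤ_[p]) n = (k.choose n : ℕ) := by
  rw [bin, Ring.choose_natCast, map_natCast]

theorem continuous_bin (n : ℕ) : Continuous fun x : ℤ_[p] => bin L x n :=
  continuous_intIncl.comp (PadicInt.continuous_choose n)

theorem bin_succ_succ (x : ℤ_[p]) (n : ℕ) : bin L (x + 1) (n + 1) = bin L x n + bin L x (n + 1) := by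
  rw [bin, Ring.choose_succ_succ, map_add]; rfl

/-- Identities in a p-adic variable are reduced by this to natural numbers, where the binomial sums
become finite. -/
theorem eq_of_eq_natCast {E : Type*} [TopologicalSpace E] [T2Space E] {f g : ℤ_[p] → E}
    (hf : Continuous f) (hg : Continuous g) (h : ∀ n : ℕ, f n = g n) (x : ℤ_[p]) : f x = g x :=
  congrFun ((PadicInt.denseRange_natCast (p := p)).equalizer hf hg (funext h)) x

theorem succ_mul_bin_succ (x : ℤ_[p]) (n : ℕ) :
    ((n : L) + 1) * bin L x (n + 1) = (intIncl p L x - n) * bin L x n := by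
  have h1 := continuous_bin (p := p) (L := L) (n + 1)
  have h2 := continuous_bin (p := p) (L := L) n
  have h3 := continuous_intIncl (p := p) (L := L)
  refine eq_of_eq_natCast (f := fun x : ℤ_[p] => ((n : L) + 1) * bin L x (n + 1))
    (g := fun x : ℤ_[p] => (intIncl p L x - n) * bin L x n) (by fun_prop) (by fun_prop)
    (fun k => ?_) x
  simp only [bin_natCast, map_natCast]
  rcases lt_or_ge k n with hk | hk
  · simp [Nat.choose_eq_zero_of_lt hk, Nat.choose_eq_zero_of_lt (hk.trans (Nat.lt_succ_self n))]
  · have := Nat.choose_succ_right_eq k n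
    rw [← Nat.cast_sub hk]
    exact_mod_cast (by rw [mul_comm, this, mul_comm])

theorem bin_succ_eq (x : ℤ_[p]) (n : ℕ) :
    ((n : L) + 1) * bin L x (n + 1) = intIncl p L x * bin L (x - 1) n := by
  obtain ⟨y, rfl⟩ : ∃ y, x = y + 1 := ⟨x - 1, by ring⟩
  rw [mul_comm, bin_succ_succ, add_mul, mul_comm (bin L y (n + 1)), succ_mul_bin_succ,
    add_sub_cancel_right, map_add, map_one]
  ring

variable (L) in
/-- The power series `(1 + T) ^ s`. -/
def onePow (s : ℤ_[p]) : PowerSeries L :=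
  PowerSeries.map (intIncl p L) (PowerSeries.binomialSeries ℤ_[p] s)

@[simp] theorem coeff_onePow (s : ℤ_[p]) (n : ℕ) : PowerSeries.coeff n (onePow L s) = bin L s n := by
  simp [onePow, bin]

theorem onePow_add (s t : ℤ_[p]) : onePow L (s + t) = onePow L s * onePow L t := by
  simp [onePow]

theorem onePow_natCast (n : ℕ) : onePow L (n : ℤ_[p]) = (1 + PowerSeries.X) ^ n := by
  simp [onePow]

@[simp] theorem onePow_zero : onePow L (0 : ℤ_[p]) = 1 := by simp [onePow]

@[simp] theorem onePow_one : onePow L (1 : ℤ_[p]) = 1 + PowerSeries.X := by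
  simpa using onePow_natCast (p := p) (L := L) 1

theorem onePow_mul_natCast (s : ℤ_[p]) (n : ℕ) :
    onePow L (s * (n : ℤ_[p])) = onePow L s ^ n := by
  induction n with
  | zero => simp
  | succ n ih => rw [pow_succ, ← ih, ← onePow_add]; congr 1; push_cast; ring

/-- The power series `(1 + T) ^ s - 1` starts with `s T`. -/
theorem onePow_sub_one (s : ℤ_[p]) :
    onePow L s - 1 = PowerSeries.X * PowerSeries.mk fun n => bin L s (n + 1) := by
  ext n
  cases n with
  | zero => rw [map_sub, coeff_onePow]; simp
  | succ n => rw [mul_comm, PowerSeries.coeff_succ_mul_X]; simp [PowerSeries.coeff_one]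

variable (L) in
/-- The coefficients of `z ↦ (s z + t choose m)` in the basis `z ↦ (z choose k)`. -/
def affCoeff (s t : ℤ_[p]) (m k : ℕ) : L :=
  PowerSeries.coeff m (onePow L t * (onePow L s - 1) ^ k)

theorem affCoeff_eq_zero (s t : ℤ_[p]) {m k : ℕ} (h : m < k) : affCoeff L s t m k = 0 := by
  rw [affCoeff, onePow_sub_one, mul_pow, mul_left_comm, PowerSeries.coeff_X_pow_mul', if_neg (by omega)]

/-- For natural z = n, compare coefficients of T^m in (1+T)^(sn+t) = (1+T)^t (1 + ((1+T)^s - 1))^n;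
the general case follows by density. -/
theorem bin_affine (s t z : ℤ_[p]) (m : ℕ) :
    bin L (s * z + t) m = ∑ k ∈ Finset.range (m + 1), bin L z k * affCoeff L s t m k := by
  refine eq_of_eq_natCast (f := fun z => bin L (s * z + t) m)
    (g := fun z => ∑ k ∈ Finset.range (m + 1), bin L z k * affCoeff L s t m k)
    ((continuous_bin m).comp ((continuous_const.mul continuous_id).add continuous_const))
    (continuous_finsetSum _ fun k _ => (continuous_bin k).mul_const _) (fun n => ?_) z
  simp only [bin_natCast]
  have h1 : onePow L (s * (n : ℤ_[p]) + t) = ∑ k ∈ Finset.range (n + 1),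
      PowerSeries.C ((n.choose k : ℕ) : L) * (onePow L t * (onePow L s - 1) ^ k) := by
    rw [onePow_add, onePow_mul_natCast, mul_comm]
    conv_lhs => rw [← sub_add_cancel (onePow L s) 1, add_pow]
    rw [Finset.mul_sum]
    refine Finset.sum_congr rfl fun k _ => ?_
    simp only [one_pow, mul_one, map_natCast]
    ring
  rw [← coeff_onePow, h1, map_sum]
  have h2 : ∀ k, PowerSeries.coeff m (PowerSeries.C ((n.choose k : ℕ) : L) *
      (onePow L t * (onePow L s - 1) ^ k)) = ((n.choose k : ℕ) : L) * affCoeff L s t m k :=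
    fun k => PowerSeries.coeff_C_mul _ _ _
  simp only [h2]
  -- The ranges n + 1 and m + 1 may be exchanged: terms with k > m vanish through `affCoeff`, terms
  -- with k > n through the binomial coefficient.
  rcases le_total m n with h | h
  · refine (Finset.sum_subset (Finset.range_mono (by omega)) fun k _ hk => ?_).symm
    rw [affCoeff_eq_zero _ _ (by simpa using hk), mul_zero]
  · refine (Finset.sum_subset (Finset.range_mono (by omega)) fun k _ hk => ?_)
    rw [Nat.choose_eq_zero_of_lt (by simpa using hk), Nat.cast_zero, zero_mul]

/-! ## Gauss norms of power series -/

/-- The Gauss norm of the power series `u` for the radius `ρ` is at most `C`. -/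
def GaussLE (ρ C : ℝ) (u : PowerSeries L) : Prop := ∀ n, ‖PowerSeries.coeff n u‖ * ρ ^ n ≤ C

theorem GaussLE.mono {ρ C C' : ℝ} {u : PowerSeries L} (h : GaussLE ρ C u) (hC : C ≤ C') :
    GaussLE ρ C' u := fun n => (h n).trans hC

theorem GaussLE.nonneg {ρ C : ℝ} {u : PowerSeries L} (h : GaussLE ρ C u) : 0 ≤ C := by
  have := h 0
  rw [pow_zero, mul_one] at this
  exact (norm_nonneg _).trans this

theorem GaussLE.one {ρ : ℝ} : GaussLE ρ 1 (1 : PowerSeries L) := by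
  intro n
  rw [PowerSeries.coeff_one]
  split_ifs with h <;> simp [h]

theorem GaussLE.X {ρ : ℝ} (hρ : 0 ≤ ρ) : GaussLE ρ ρ (PowerSeries.X : PowerSeries L) := by
  intro n
  rw [PowerSeries.coeff_X]
  split_ifs with h <;> simp [h, hρ]

theorem gaussLE_onePow {ρ : ℝ} (h0 : 0 ≤ ρ) (h1 : ρ ≤ 1) (s : ℤ_[p]) :
    GaussLE ρ 1 (onePow L s) := fun n => by
  rw [coeff_onePow]
  exact mul_le_one₀ (norm_bin_le_one _ _) (by positivity) (pow_le_one₀ h0 h1)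

section

variable [IsUltrametricDist L]

theorem GaussLE.add {ρ C : ℝ} (hρ : 0 ≤ ρ) {u v : PowerSeries L} (hu : GaussLE ρ C u)
    (hv : GaussLE ρ C v) : GaussLE ρ C (u + v) := by
  intro n
  rw [map_add]
  rcases le_total ‖PowerSeries.coeff n u‖ ‖PowerSeries.coeff n v‖ with h | h
  · exact (mul_le_mul_of_nonneg_right ((IsUltrametricDist.norm_add_le_max _ _).trans
      (max_le h le_rfl)) (by positivity)).trans (hv n)
  · exact (mul_le_mul_of_nonneg_right ((IsUltrametricDist.norm_add_le_max _ _).trans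
      (max_le le_rfl h)) (by positivity)).trans (hu n)

theorem GaussLE.mul {ρ C C' : ℝ} (hρ : 0 < ρ) {u v : PowerSeries L} (hu : GaussLE ρ C u)
    (hv : GaussLE ρ C' v) : GaussLE ρ (C * C') (u * v) := by
  intro n
  rw [← le_div_iff₀ (by positivity), PowerSeries.coeff_mul]
  refine IsUltrametricDist.norm_sum_le_of_forall_le_of_nonneg
    (div_nonneg (mul_nonneg hu.nonneg hv.nonneg) (by positivity)) fun q hq => ?_
  rw [le_div_iff₀ (by positivity), norm_mul, ← Finset.HasAntidiagonal.mem_antidiagonal.mp hq, pow_add,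
    mul_mul_mul_comm]
  exact mul_le_mul (hu _) (hv _) (by positivity) hu.nonneg

theorem GaussLE.pow {ρ C : ℝ} (hρ : 0 < ρ) {u : PowerSeries L} (hu : GaussLE ρ C u) (k : ℕ) :
    GaussLE ρ (C ^ k) (u ^ k) := by
  induction k with
  | zero => simpa using GaussLE.one
  | succ k ih => rw [pow_succ, pow_succ]; exact ih.mul hρ hu

/-- Powers of a perturbation of `T`. -/
theorem GaussLE.pow_sub_X_pow {ρ η : ℝ} (hρ : 0 < ρ) (hη : η ≤ 1) {e : PowerSeries L}
    (he : GaussLE ρ η e) (k : ℕ) :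
    GaussLE ρ (ρ ^ k * η) ((PowerSeries.X * (1 + e)) ^ k - PowerSeries.X ^ k) := by
  have h : GaussLE ρ η ((1 + e) ^ k - 1) := by
    induction k with
    | zero =>
      intro n
      simpa using he.nonneg
    | succ k ih =>
      have e1 : (1 + e) ^ (k + 1) - 1 = ((1 + e) ^ k - 1) * (1 + e) + e := by ring
      rw [e1]
      have h1 : GaussLE ρ 1 (1 + e) := GaussLE.add hρ.le GaussLE.one (he.mono hη)
      have h2 := ih.mul hρ h1
      rw [mul_one] at h2
      exact h2.add hρ.le he
  have e2 : (PowerSeries.X * (1 + e)) ^ k - PowerSeries.X ^ k =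
      PowerSeries.X ^ k * ((1 + e) ^ k - 1) := by rw [mul_pow]; ring
  rw [e2]
  exact ((GaussLE.X hρ.le).pow hρ k).mul hρ h

variable (p) in
/-- The Gauss norm of `φ(T)`. -/
theorem gaussLE_frobenius {ρ : ℝ} (hρ : 0 < ρ) (h1 : ρ ≤ 1) :
    GaussLE ρ (max (ρ ^ p) (ρ / p)) ((1 + PowerSeries.X) ^ p - 1 : PowerSeries L) := by
  have hp := Fact.out (p := p.Prime)
  intro n
  have h : ((1 + PowerSeries.X) ^ p : PowerSeries L) =
      (((1 + Polynomial.X) ^ p : Polynomial L) : PowerSeries L) := by simp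
  rw [map_sub, h, Polynomial.coeff_coe, Polynomial.coeff_one_add_X_pow, PowerSeries.coeff_one]
  have hp0 : (0 : ℝ) < p := by exact_mod_cast hp.pos
  have hmax : 0 ≤ max (ρ ^ p) (ρ / p) := le_max_of_le_left (by positivity)
  rcases Nat.eq_zero_or_pos n with rfl | hn
  · simpa using hmax
  rw [if_neg hn.ne', sub_zero]
  rcases lt_trichotomy n p with h | rfl | h
  · obtain ⟨m, hm⟩ := hp.dvd_choose_self hn.ne' h
    have hpn : ‖((p : ℕ) : L)‖ = (p : ℝ)⁻¹ := by
      rw [← map_natCast (algebraMap ℚ_[p] L) p, norm_algebraMap', Padic.norm_p]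
    refine le_max_of_le_right ?_
    rw [hm, Nat.cast_mul, norm_mul, hpn, div_eq_inv_mul]
    have h2 := IsUltrametricDist.norm_natCast_le_one L m
    have h3 : ρ ^ n ≤ ρ := by simpa using pow_le_pow_of_le_one hρ.le h1 hn
    calc (p : ℝ)⁻¹ * ‖(m : L)‖ * ρ ^ n ≤ (p : ℝ)⁻¹ * 1 * ρ := by gcongr
      _ = _ := by ring
  · simp
  · simpa [Nat.choose_eq_zero_of_lt h] using hmax

theorem norm_affCoeff_le_one (s t : ℤ_[p]) (m k : ℕ) : ‖affCoeff L s t m k‖ ≤ 1 := by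
  have h : GaussLE 1 (1 * 1 ^ k) (onePow L t * (onePow L s - 1) ^ k) := by
    refine (gaussLE_onePow zero_le_one le_rfl t).mul one_pos (GaussLE.pow one_pos ?_ k)
    intro n
    rw [onePow_sub_one, one_pow, mul_one, mul_comm]
    cases n with
    | zero => simp
    | succ n => rw [PowerSeries.coeff_succ_mul_X, PowerSeries.coeff_mk]; exact norm_bin_le_one _ _
  simpa [affCoeff] using h m

end

end

section

/-! ## Locally analytic functions on `ℤ_p` -/

theorem charZero (p : ℕ) [Fact p.Prime] (L : Type*) [NormedField L] [NormedAlgebra ℚ_[p] L] : CharZero L :=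
  charZero_of_injective_algebraMap (algebraMap ℚ_[p] L).injective

theorem norm_prime (p : ℕ) [Fact p.Prime] (L : Type*) [NormedField L] [NormedAlgebra ℚ_[p] L] : ‖(p : L)‖ = (p : ℝ)⁻¹ := by
  rw [← map_natCast (algebraMap ℚ_[p] L) p, norm_algebraMap', Padic.norm_p]

theorem one_le_mul_norm_natCast (p : ℕ) [Fact p.Prime] (L : Type*) [NormedField L] [NormedAlgebra ℚ_[p] L]
    {n : ℕ} (hn : n ≠ 0) : 1 ≤ (n : ℝ) * ‖(n : L)‖ := by
  have hp := Fact.out (p := p.Prime)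
  obtain ⟨v, m, hm, rfl⟩ := Nat.exists_eq_pow_mul_and_not_dvd hn p hp.ne_one
  have h1 : ‖(m : L)‖ = 1 := by
    rw [← map_natCast (algebraMap ℚ_[p] L) m, norm_algebraMap', Padic.norm_natCast_eq_one_iff]
    exact (hp.coprime_iff_not_dvd).mpr hm
  have hp0 : (0 : ℝ) < p := by exact_mod_cast hp.pos
  have hm1 : (1 : ℝ) ≤ m := by
    exact_mod_cast Nat.one_le_iff_ne_zero.mpr fun h => hm (by rw [h]; exact dvd_zero p)
  rw [Nat.cast_mul, Nat.cast_mul, norm_mul, h1, Nat.cast_pow, Nat.cast_pow, norm_pow,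
    norm_prime p L, mul_one, inv_pow, mul_right_comm, mul_inv_cancel₀ (by positivity), one_mul]
  exact hm1

variable {p : ℕ} [Fact p.Prime] {L : Type*} [NormedField L] [NormedAlgebra ℚ_[p] L]

/-- `F : ℤ_p → L` has an expansion in binomial functions with coefficients `O(ρ ^ j)`. For `ρ < 1`
such a function is locally analytic. -/
def MahlerDecay (ρ : ℝ) (F : ℤ_[p] → L) : Prop :=
  ∃ (C : ℝ) (a : ℕ → L), (∀ j, ‖a j‖ ≤ C * ρ ^ j) ∧ ∀ x, F x = ∑' j, a j * bin L x j

/-- Locally analytic functions, by their characterization due to Amice. -/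
def LocAnalytic (F : ℤ_[p] → L) : Prop := ∃ ρ : ℝ, 0 < ρ ∧ ρ < 1 ∧ MahlerDecay ρ F

theorem norm_mul_bin_le {a : L} {C : ℝ} (h : ‖a‖ ≤ C) (x : ℤ_[p]) (j : ℕ) : ‖a * bin L x j‖ ≤ C := by
  rw [norm_mul]
  exact (mul_le_of_le_one_right (norm_nonneg _) (norm_bin_le_one x j)).trans h

theorem nonneg_of_norm_le_geom {a : ℕ → L} {C ρ : ℝ} (h : ∀ j, ‖a j‖ ≤ C * ρ ^ j) : 0 ≤ C := by
  have := h 0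
  rw [pow_zero, mul_one] at this
  exact (norm_nonneg _).trans this

theorem MahlerDecay.mono {ρ σ : ℝ} (h0 : 0 ≤ ρ) (h : ρ ≤ σ) {F : ℤ_[p] → L}
    (hF : MahlerDecay ρ F) : MahlerDecay σ F := by
  obtain ⟨C, a, ha, hs⟩ := hF
  have := nonneg_of_norm_le_geom ha
  exact ⟨C, a, fun j => (ha j).trans (by gcongr), hs⟩

variable [CompleteSpace L]

theorem summable_mul_bin {a : ℕ → L} {C ρ : ℝ} (h0 : 0 ≤ ρ) (h1 : ρ < 1)
    (h : ∀ j, ‖a j‖ ≤ C * ρ ^ j) (x : ℤ_[p]) : Summable fun j => a j * bin L x j :=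
  Summable.of_norm_bounded ((summable_geometric_of_lt_one h0 h1).mul_left C)
    fun j => norm_mul_bin_le (h j) x j

theorem MahlerDecay.add {ρ : ℝ} (h0 : 0 ≤ ρ) (h1 : ρ < 1) {F G : ℤ_[p] → L}
    (hF : MahlerDecay ρ F) (hG : MahlerDecay ρ G) : MahlerDecay ρ (fun x => F x + G x) := by
  obtain ⟨C, a, ha, hs⟩ := hF
  obtain ⟨D, b, hb, ht⟩ := hG
  refine ⟨C + D, fun j => a j + b j, fun j => (norm_add_le _ _).trans ?_, fun x => ?_⟩
  · rw [add_mul]; exact add_le_add (ha j) (hb j)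
  · simp only [add_mul, hs, ht]
    exact ((summable_mul_bin h0 h1 ha x).tsum_add (summable_mul_bin h0 h1 hb x)).symm

omit [CompleteSpace L] in
theorem MahlerDecay.smul {ρ : ℝ} {F : ℤ_[p] → L} (c : L) (hF : MahlerDecay ρ F) :
    MahlerDecay ρ (fun x => c * F x) := by
  obtain ⟨C, a, ha, hs⟩ := hF
  refine ⟨‖c‖ * C, fun j => c * a j, fun j => ?_, fun x => ?_⟩
  · rw [norm_mul, mul_assoc]; gcongr; exact ha j
  · simp only [hs, mul_assoc, tsum_mul_left]

theorem MahlerDecay.continuous {ρ : ℝ} (h0 : 0 ≤ ρ) (h1 : ρ < 1) {F : ℤ_[p] → L}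
    (hF : MahlerDecay ρ F) : Continuous F := by
  obtain ⟨C, a, ha, hs⟩ := hF
  rw [funext hs]
  exact continuous_tsum (fun j => (continuous_bin j).const_mul _)
    ((summable_geometric_of_lt_one h0 h1).mul_left C) fun j x => norm_mul_bin_le (ha j) x j

theorem LocAnalytic.add {F G : ℤ_[p] → L} (hF : LocAnalytic F) (hG : LocAnalytic G) :
    LocAnalytic (fun x => F x + G x) := by
  obtain ⟨ρ, h0, h1, hF⟩ := hF
  obtain ⟨σ, h0', h1', hG⟩ := hG
  have h : 0 < max ρ σ := lt_max_of_lt_left h0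
  exact ⟨max ρ σ, h, max_lt h1 h1', (hF.mono h0.le (le_max_left _ _)).add h.le (max_lt h1 h1')
    (hG.mono h0'.le (le_max_right _ _))⟩

omit [CompleteSpace L] in
theorem LocAnalytic.smul {F : ℤ_[p] → L} (c : L) (hF : LocAnalytic F) :
    LocAnalytic (fun x => c * F x) := by
  obtain ⟨ρ, h0, h1, hF⟩ := hF
  exact ⟨ρ, h0, h1, hF.smul c⟩

theorem LocAnalytic.sub {F G : ℤ_[p] → L} (hF : LocAnalytic F) (hG : LocAnalytic G) :
    LocAnalytic (fun x => F x - G x) := by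
  convert hF.add (hG.smul (-1)) using 2
  ring

omit [CompleteSpace L] in
theorem locAnalytic_zero : LocAnalytic (fun _ : ℤ_[p] => (0 : L)) :=
  ⟨1 / 2, by norm_num, by norm_num, 0, 0, by simp, by simp⟩

theorem LocAnalytic.sum {ι : Type*} (s : Finset ι) {F : ι → ℤ_[p] → L}
    (hF : ∀ i ∈ s, LocAnalytic (F i)) : LocAnalytic (fun x => ∑ i ∈ s, F i x) := by
  classical
  induction s using Finset.induction_on with
  | empty => simpa using locAnalytic_zero
  | insert i s hi ih =>
    simp only [Finset.sum_insert hi]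
    exact (hF i (by simp)).add (ih fun j hj => hF j (by simp [hj]))

theorem LocAnalytic.continuous {F : ℤ_[p] → L} (hF : LocAnalytic F) : Continuous F := by
  obtain ⟨ρ, h0, h1, hF⟩ := hF
  exact hF.continuous h0.le h1

omit [CompleteSpace L] in
theorem locAnalytic_const (c : L) : LocAnalytic (fun _ : ℤ_[p] => c) := by
  refine ⟨1 / 2, by norm_num, by norm_num, ‖c‖, Pi.single 0 c, fun j => ?_, fun x => ?_⟩
  · rcases eq_or_ne j 0 with rfl | hj
    · simp
    · rw [Pi.single_eq_of_ne hj, norm_zero]; positivity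
  · rw [tsum_eq_single 0 fun j hj => by simp [Pi.single_eq_of_ne hj]]
    simp

/-! ### Composition of locally analytic functions with affine maps, and division by x -/

variable [IsUltrametricDist L]

-- Since only k ≤ m contributes, the decay ρ^m can be shared between both indices; this makes the
-- double series in `tsum_bin_affine` summable.
omit [CompleteSpace L] in
theorem norm_mul_affCoeff_le {a : ℕ → L} {C ρ : ℝ} (h0 : 0 ≤ ρ) (h1 : ρ ≤ 1)
    (ha : ∀ j, ‖a j‖ ≤ C * ρ ^ j) (s t : ℤ_[p]) (m k : ℕ) :
    ‖a m * affCoeff L s t m k‖ ≤ C * (√ρ ^ m * √ρ ^ k) := by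
  have hC := nonneg_of_norm_le_geom ha
  rcases lt_or_ge m k with h | h
  · rw [affCoeff_eq_zero _ _ h, mul_zero, norm_zero]; positivity
  · rw [norm_mul]
    refine (mul_le_of_le_one_right (norm_nonneg _) (norm_affCoeff_le_one _ _ _ _)).trans
      ((ha m).trans (mul_le_mul_of_nonneg_left ?_ hC))
    have e : ρ ^ m = √ρ ^ m * √ρ ^ m := by rw [← mul_pow, Real.mul_self_sqrt h0]
    rw [e]
    exact mul_le_mul_of_nonneg_left (pow_le_pow_of_le_one (Real.sqrt_nonneg _)
      (Real.sqrt_le_one.mpr h1) h) (by positivity)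

theorem tsum_bin_affine {a : ℕ → L} {C ρ : ℝ} (h0 : 0 ≤ ρ) (h1 : ρ < 1)
    (ha : ∀ j, ‖a j‖ ≤ C * ρ ^ j) (s t z : ℤ_[p]) :
    ∑' m, a m * bin L (s * z + t) m = ∑' k, (∑' m, a m * affCoeff L s t m k) * bin L z k := by
  have hr0 := Real.sqrt_nonneg ρ
  have hr1 : √ρ < 1 := by rw [Real.sqrt_lt' one_pos]; simpa using h1
  have hg := summable_geometric_of_lt_one hr0 hr1
  have hsum : Summable (Function.uncurry fun m k => a m * affCoeff L s t m k * bin L z k) := by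
    refine Summable.of_norm_bounded ((hg.mul_of_nonneg hg (fun _ => by positivity)
      (fun _ => by positivity)).mul_left C) fun q => ?_
    exact norm_mul_bin_le (norm_mul_affCoeff_le h0 h1.le ha s t _ _) _ _
  calc ∑' m, a m * bin L (s * z + t) m
      = ∑' m, ∑' k, a m * affCoeff L s t m k * bin L z k := by
        refine tsum_congr fun m => ?_
        rw [bin_affine, tsum_eq_sum (s := Finset.range (m + 1)), Finset.mul_sum]
        · exact Finset.sum_congr rfl fun k _ => by ring
        · intro k hk
          rw [affCoeff_eq_zero _ _ (by simpa using hk), mul_zero, zero_mul]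
    _ = ∑' k, ∑' m, a m * affCoeff L s t m k * bin L z k := hsum.tsum_comm.symm
    _ = _ := tsum_congr fun k => tsum_mul_right

omit [CompleteSpace L] in
theorem norm_tsum_mul_affCoeff_le {ρ σ : ℝ} (hσ : 0 ≤ σ) {s t : ℤ_[p]}
    (h : ∀ m k, ‖affCoeff L s t m k‖ * ρ ^ m ≤ σ ^ k) {C : ℝ} {a : ℕ → L}
    (ha : ∀ j, ‖a j‖ ≤ C * ρ ^ j) (k : ℕ) : ‖∑' m, a m * affCoeff L s t m k‖ ≤ C * σ ^ k := by
  have hC := nonneg_of_norm_le_geom ha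
  refine IsUltrametricDist.norm_tsum_le_of_forall_le_of_nonneg (by positivity) fun m => ?_
  rw [norm_mul]
  calc ‖a m‖ * ‖affCoeff L s t m k‖ ≤ C * ρ ^ m * ‖affCoeff L s t m k‖ := by
        gcongr; exact ha m
    _ = C * (‖affCoeff L s t m k‖ * ρ ^ m) := by ring
    _ ≤ C * σ ^ k := by gcongr; exact h m k

omit [CompleteSpace L] in
theorem norm_affCoeff_mul_pow_le {ρ : ℝ} (h0 : 0 ≤ ρ) (h1 : ρ ≤ 1) (s t : ℤ_[p]) (m k : ℕ) :
    ‖affCoeff L s t m k‖ * ρ ^ m ≤ ρ ^ k := by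
  rcases lt_or_ge m k with h | h
  · rw [affCoeff_eq_zero _ _ h, norm_zero, zero_mul]; positivity
  · exact (mul_le_of_le_one_left (by positivity) (norm_affCoeff_le_one _ _ _ _)).trans
      (pow_le_pow_of_le_one h0 h1 h)

theorem MahlerDecay.comp_affine_of_le {ρ σ : ℝ} (h0 : 0 ≤ ρ) (h1 : ρ < 1) (hσ : 0 ≤ σ)
    {s t : ℤ_[p]} (h : ∀ m k, ‖affCoeff L s t m k‖ * ρ ^ m ≤ σ ^ k)
    {F : ℤ_[p] → L} (hF : MahlerDecay ρ F) : MahlerDecay σ (fun z => F (s * z + t)) := by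
  obtain ⟨C, a, ha, hs⟩ := hF
  exact ⟨C, fun k => ∑' m, a m * affCoeff L s t m k,
    fun k => norm_tsum_mul_affCoeff_le hσ h ha k,
    fun z => (hs _).trans (tsum_bin_affine h0 h1 ha s t z)⟩

theorem MahlerDecay.comp_affine {ρ : ℝ} (h0 : 0 ≤ ρ) (h1 : ρ < 1) (s t : ℤ_[p])
    {F : ℤ_[p] → L} (hF : MahlerDecay ρ F) : MahlerDecay ρ (fun z => F (s * z + t)) :=
  hF.comp_affine_of_le h0 h1 h0 (norm_affCoeff_mul_pow_le h0 h1.le s t)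

theorem LocAnalytic.comp_affine (s t : ℤ_[p]) {F : ℤ_[p] → L} (hF : LocAnalytic F) :
    LocAnalytic (fun z => F (s * z + t)) := by
  obtain ⟨ρ, h0, h1, hF⟩ := hF
  exact ⟨ρ, h0, h1, hF.comp_affine h0.le h1 s t⟩

theorem LocAnalytic.comp_mul (s : ℤ_[p]) {F : ℤ_[p] → L} (hF : LocAnalytic F) :
    LocAnalytic (fun z => F (s * z)) := by
  simpa using hF.comp_affine s 0

omit [CompleteSpace L] in
theorem norm_affCoeff_prime_le {ρ : ℝ} (h0 : 0 < ρ) (h1 : ρ ≤ 1) (m k : ℕ) :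
    ‖affCoeff L (p : ℤ_[p]) 0 m k‖ * ρ ^ m ≤ max (ρ ^ p) (ρ / p) ^ k := by
  rw [affCoeff, onePow_natCast, onePow_zero, one_mul]
  exact (gaussLE_frobenius p h0 h1).pow h0 k m

/-- Dually, z ↦ pz replaces T by φ(T), so the radius ρ shrinks to the Gauss norm of φ(T). -/
theorem MahlerDecay.comp_prime_mul {ρ : ℝ} (h0 : 0 < ρ) (h1 : ρ < 1)
    {F : ℤ_[p] → L} (hF : MahlerDecay ρ F) :
    MahlerDecay (max (ρ ^ p) (ρ / p)) (fun z : ℤ_[p] => F ((p : ℤ_[p]) * z)) := by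
  simpa using hF.comp_affine_of_le h0.le h1 (le_max_of_le_left (by positivity))
    (norm_affCoeff_prime_le h0 h1.le)

/-- On small balls a locally analytic function has a rapidly converging expansion. -/
theorem eventually_mahlerDecay_comp_prime_pow_mul {ρ : ℝ} (h0 : 0 < ρ) (h1 : ρ < 1) :
    ∀ᶠ n : ℕ in atTop, ∀ F : ℤ_[p] → L, MahlerDecay ρ F →
      MahlerDecay (p : ℝ)⁻¹ (fun z : ℤ_[p] => F ((p : ℤ_[p]) ^ n * z)) := by
  have hp1 : (1 : ℝ) < p := by exact_mod_cast (Fact.out (p := p.Prime)).one_lt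
  have hpi : (p : ℝ)⁻¹ < 1 := inv_lt_one_of_one_lt₀ hp1
  have hp0 : 0 < (p : ℝ)⁻¹ := by positivity
  set κ := max ρ (p : ℝ)⁻¹ with hκ
  have hκ0 : 0 < κ := lt_max_of_lt_left h0
  have hκ1 : κ < 1 := max_lt h1 hpi
  -- As 1/p ≤ κ < 1, each multiplication by p improves the radius from κ^(n+1) to at most κ^(n+2).
  -- The exponent does not depend on F, which gives uniformity.
  have key : ∀ F : ℤ_[p] → L, MahlerDecay ρ F → ∀ n : ℕ,
      MahlerDecay (κ ^ (n + 1)) (fun z : ℤ_[p] => F ((p : ℤ_[p]) ^ n * z)) := by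
    intro F hF n
    induction n with
    | zero => simpa using hF.mono h0.le (le_max_left ρ (p : ℝ)⁻¹)
    | succ n ih =>
      have hs0 : 0 < κ ^ (n + 1) := by positivity
      have hs1 : κ ^ (n + 1) < 1 := pow_lt_one₀ hκ0.le hκ1 (by omega)
      have h := ih.comp_prime_mul hs0 hs1
      have e : (fun z : ℤ_[p] => F ((p : ℤ_[p]) ^ (n + 1) * z)) = fun z => F ((p : ℤ_[p]) ^ n * ((p : ℤ_[p]) * z)) := by
        funext z; rw [pow_succ, mul_assoc]
      rw [e]
      refine h.mono (le_max_of_le_left (by positivity)) (max_le ?_ ?_)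
      · calc (κ ^ (n + 1)) ^ p ≤ (κ ^ (n + 1)) ^ 2 :=
              pow_le_pow_of_le_one hs0.le hs1.le (Fact.out (p := p.Prime)).two_le
          _ = κ ^ (n + 1 + (n + 1)) := by rw [sq, ← pow_add]
          _ ≤ κ ^ (n + 1 + 1) := pow_le_pow_of_le_one hκ0.le hκ1.le (by omega)
      · rw [pow_succ κ (n + 1), div_eq_mul_inv]
        gcongr
        exact le_max_right _ _
  have ht := (tendsto_pow_atTop_nhds_zero_of_lt_one hκ0.le hκ1).comp (tendsto_add_atTop_nat 1)
  filter_upwards [ht.eventually (gt_mem_nhds hp0)] with n hn F hF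
  exact (key F hF n).mono (pow_nonneg hκ0.le _) hn.le

/-- A locally analytic function that vanishes at `0` is divisible by `x`. -/
theorem LocAnalytic.exists_eq_mul {F : ℤ_[p] → L} (hF : LocAnalytic F) (hF0 : F 0 = 0) :
    ∃ G : ℤ_[p] → L, LocAnalytic G ∧ ∀ x, F x = intIncl p L x * G x := by
  obtain ⟨ρ, h0, h1, C, a, ha, hs⟩ := hF
  have hL := charZero p L
  have hC := nonneg_of_norm_le_geom ha
  have ha0 : a 0 = 0 := by
    rw [hs, tsum_eq_single 0] at hF0
    · simpa using hF0
    · intro j hj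
      have : bin L (0 : ℤ_[p]) j = 0 := by
        have := bin_natCast (p := p) (L := L) 0 j
        rw [Nat.cast_zero, Nat.choose_eq_zero_of_lt (by omega), Nat.cast_zero] at this
        exact this
      rw [this, mul_zero]
  set σ := (1 + ρ) / 2
  have hσ0 : 0 < σ := by positivity
  have hσ1 : σ < 1 := by simp only [σ]; linarith
  have hρσ : ρ < σ := by simp only [σ]; linarith
  -- The quotient is obtained by dividing the j-th coefficient by j. Since 1/|j| ≤ j, the loss is at
  -- most linear in j and is absorbed by enlarging ρ to σ.
  obtain ⟨K, hK⟩ := (tendsto_self_mul_const_pow_of_lt_one (r := ρ / σ) (by positivity)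
    ((div_lt_one hσ0).mpr hρσ)).bddAbove_range
  have hb : ∀ j, ‖a (j + 1) / ((j : L) + 1)‖ ≤ C * K * σ * σ ^ j := by
    intro j
    have h1 := one_le_mul_norm_natCast p L (Nat.succ_ne_zero j)
    have h2 : ((j : L) + 1) = ((j + 1 : ℕ) : L) := by push_cast; ring
    have h3 : 0 < ‖((j + 1 : ℕ) : L)‖ := norm_pos_iff.mpr (by exact_mod_cast Nat.succ_ne_zero j)
    have h4 : ((j + 1 : ℕ) : ℝ) * (ρ / σ) ^ (j + 1) ≤ K := hK ⟨j + 1, rfl⟩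
    have h5 : ((j + 1 : ℕ) : ℝ) * ρ ^ (j + 1) ≤ K * σ ^ (j + 1) := by
      rw [div_pow, ← mul_div_assoc, div_le_iff₀ (by positivity)] at h4
      exact h4
    rw [h2, norm_div, div_le_iff₀ h3]
    calc ‖a (j + 1)‖ ≤ C * ρ ^ (j + 1) := ha _
      _ ≤ C * ρ ^ (j + 1) * (((j + 1 : ℕ) : ℝ) * ‖((j + 1 : ℕ) : L)‖) :=
        le_mul_of_one_le_right (by positivity) h1
      _ = C * (((j + 1 : ℕ) : ℝ) * ρ ^ (j + 1)) * ‖((j + 1 : ℕ) : L)‖ := by ring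
      _ ≤ C * (K * σ ^ (j + 1)) * ‖((j + 1 : ℕ) : L)‖ := by gcongr
      _ = _ := by ring
  have hG : LocAnalytic fun x : ℤ_[p] => ∑' j, a (j + 1) / ((j : L) + 1) * bin L x j :=
    ⟨σ, hσ0, hσ1, _, _, hb, fun x => rfl⟩
  -- The translation by -1 comes from (j + 1) (x choose j+1) = x (x - 1 choose j).
  refine ⟨_, hG.comp_affine 1 (-1), fun x => ?_⟩
  rw [hs, (summable_mul_bin h0.le h1 ha x).tsum_eq_zero_add, ha0, zero_mul, zero_add,
    ← tsum_mul_left]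
  refine tsum_congr fun j => ?_
  have h := bin_succ_eq (L := L) x j
  have h2 : ((j : L) + 1) ≠ 0 := by exact_mod_cast Nat.succ_ne_zero j
  rw [one_mul, ← sub_eq_add_neg, mul_left_comm, ← h]
  field_simp

end

section

variable {p : ℕ} [Fact p.Prime] {L : Type*} [NormedField L] [NormedAlgebra ℚ_[p] L]

/-! ## The function on `ℤ_p` attached to an element of the Robba ring -/

/-- The function `x ↦ res (f (1 + T) ^ (x - 1) dT)` on `ℤ_p`. -/
def amiceFun (f : RobbaRing L) (x : ℤ_[p]) : L := ∑' j : ℕ, f.1 (-1 - j) * bin L (x - 1) j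

theorem RobbaRing.exists_norm_le {f : ℤ → L} (hf : f ∈ RobbaRing L) :
    ∃ ρ C : ℝ, 0 < ρ ∧ ρ < 1 ∧ ∀ j : ℕ, ‖f (-1 - j)‖ ≤ C * ρ ^ j := by
  obtain ⟨r, h0, h1, hr⟩ := hf
  obtain ⟨C, hC⟩ := (hr r le_rfl h1).bddAbove_range_of_cofinite
  refine ⟨r, C * r, h0, h1, fun j => ?_⟩
  have h : ‖f (-1 - j)‖ * r ^ (-1 - j : ℤ) ≤ C := hC ⟨_, rfl⟩
  have e : r ^ (-1 - j : ℤ) = (r * r ^ j)⁻¹ := by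
    rw [sub_eq_add_neg, zpow_add₀ h0.ne', zpow_neg, zpow_neg, zpow_one, zpow_natCast, mul_inv]
  rw [e, ← div_eq_mul_inv, div_le_iff₀ (by positivity), ← mul_assoc] at h
  exact h

theorem mem_robbaRing_of_norm_le {f : ℤ → L} {ρ C : ℝ} (h0 : 0 < ρ) (h1 : ρ < 1)
    (hneg : ∀ j : ℕ, ‖f (-1 - j)‖ ≤ C * ρ ^ j) (hpos : ∀ n : ℕ, f n = 0) : f ∈ RobbaRing L := by
  refine ⟨(1 + ρ) / 2, by linarith, by linarith, fun σ hσ1 hσ2 => ?_⟩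
  have hσ : ρ < σ := by linarith
  have hσ0 : 0 < σ := h0.trans hσ
  rw [Int.cofinite_eq, tendsto_sup]
  constructor
  · have hg := (tendsto_geom (q := ρ / σ) (by positivity) ((div_lt_one hσ0).mpr hσ)).const_mul (C / σ)
    rw [mul_zero] at hg
    have hinj : Function.Injective fun k : ℤ => -1 - k := fun a b h => by simpa using h
    have hg' := hg.comp hinj.tendsto_cofinite
    rw [Int.cofinite_eq, tendsto_sup] at hg'
    refine squeeze_zero' (Eventually.of_forall fun k => by positivity) ?_ hg'.1
    filter_upwards [eventually_lt_atBot 0] with k hk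
    obtain ⟨j, rfl⟩ : ∃ j : ℕ, k = -1 - j := ⟨(-1 - k).toNat, by omega⟩
    have e : σ ^ (-1 - j : ℤ) = (σ * σ ^ j)⁻¹ := by
      rw [sub_eq_add_neg, zpow_add₀ hσ0.ne', zpow_neg, zpow_neg, zpow_one, zpow_natCast, mul_inv]
    have e2 : (-1 - (-1 - (j : ℤ))) = j := by ring
    simp only [Function.comp, e2]
    rw [if_pos (by positivity), Int.toNat_natCast, e, ← div_eq_mul_inv,
      div_le_iff₀ (by positivity)]
    calc ‖f (-1 - j)‖ ≤ C * ρ ^ j := hneg j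
      _ = _ := by rw [div_pow]; field_simp
  · refine tendsto_const_nhds.congr' ?_
    filter_upwards [eventually_ge_atTop 0] with k hk
    obtain ⟨n, rfl⟩ := Int.eq_ofNat_of_zero_le hk
    simp [hpos]

section

variable [CompleteSpace L]

theorem summable_amiceFun (f : RobbaRing L) (x : ℤ_[p]) :
    Summable fun j : ℕ => f.1 (-1 - j) * bin L (x - 1) j := by
  obtain ⟨ρ, C, h0, h1, h⟩ := RobbaRing.exists_norm_le f.2
  exact summable_mul_bin h0.le h1 h _

theorem amiceFun_add (f g : RobbaRing L) (x : ℤ_[p]) :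
    amiceFun (f + g) x = amiceFun f x + amiceFun g x := by
  simp only [amiceFun, Submodule.coe_add, Pi.add_apply, add_mul]
  exact (summable_amiceFun f x).tsum_add (summable_amiceFun g x)

omit [CompleteSpace L] in
theorem amiceFun_smul (c : L) (f : RobbaRing L) (x : ℤ_[p]) :
    amiceFun (c • f) x = c * amiceFun f x := by
  simp only [amiceFun, Submodule.coe_smul, Pi.smul_apply, smul_eq_mul, mul_assoc, tsum_mul_left]

theorem amiceFun_sub (f g : RobbaRing L) (x : ℤ_[p]) :
    amiceFun (f - g) x = amiceFun f x - amiceFun g x := by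
  rw [show f - g = f + (-1 : L) • g by module, amiceFun_add,
    amiceFun_smul, neg_one_mul, sub_eq_add_neg]

theorem LocAnalytic.amiceFun [IsUltrametricDist L] (f : RobbaRing L) :
    LocAnalytic (p := p) (amiceFun f) := by
  obtain ⟨ρ, C, h0, h1, h⟩ := RobbaRing.exists_norm_le f.2
  have hH : LocAnalytic fun x : ℤ_[p] => ∑' j : ℕ, f.1 (-1 - j) * bin L x j :=
    ⟨ρ, h0, h1, C, _, h, fun x => rfl⟩
  have := hH.comp_affine 1 (-1)
  simp only [one_mul, ← sub_eq_add_neg] at this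
  exact this

/-- Surjectivity of R/R⁺ onto locally analytic functions, with a lift that has only negative powers
of T. The translation by 1 undoes the x - 1 in `amiceFun`. -/
theorem exists_amiceFun_eq [IsUltrametricDist L] {F : ℤ_[p] → L} (hF : LocAnalytic F) :
    ∃ f : RobbaRing L, (∀ x, PhiGamma.amiceFun f x = F x) ∧ ∀ n : ℕ, f.1 n = 0 := by
  obtain ⟨ρ, h0, h1, C, a, ha, hs⟩ := hF.comp_affine 1 1
  have e : ∀ j : ℕ, (-1 - (-1 - (j : ℤ))).toNat = j := fun j => by omega
  refine ⟨⟨fun k => if k < 0 then a (-1 - k).toNat else 0,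
    mem_robbaRing_of_norm_le h0 h1 (C := C) (fun j => ?_) fun n => ?_⟩, fun x => ?_, fun n => ?_⟩
  · rw [if_pos (by omega), e]; exact ha j
  · rw [if_neg (by omega)]
  · have h := hs (x - 1)
    simp only [one_mul, sub_add_cancel] at h
    rw [h]
    refine tsum_congr fun j => ?_
    simp only
    rw [if_pos (by omega), e]
  · simp only
    rw [if_neg (by omega)]

omit [CompleteSpace L] in
theorem amiceFun_natCast_add_one (f : RobbaRing L) (n : ℕ) :
    amiceFun f ((n : ℤ_[p]) + 1) = ∑ j ∈ Finset.range (n + 1), f.1 (-1 - j) * (n.choose j : ℕ) := by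
  rw [amiceFun, tsum_eq_sum (s := Finset.range (n + 1))]
  · simp [bin_natCast]
  · intro j hj
    rw [add_sub_cancel_right, bin_natCast, Nat.choose_eq_zero_of_lt (by simpa using hj)]
    simp

-- The value at n + 1 is the n-th polar coefficient plus an integral combination of the earlier
-- ones, so the coefficients are recovered recursively. With ε = 0 this gives the kernel of
-- `amiceFun`.
omit [CompleteSpace L] in
theorem norm_coeff_le_of_amiceFun [IsUltrametricDist L] {f : RobbaRing L} {ε : ℝ}
    (h : ∀ x : ℤ_[p], ‖amiceFun f x‖ ≤ ε) (j : ℕ) : ‖f.1 (-1 - j)‖ ≤ ε := by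
  have hε : 0 ≤ ε := (norm_nonneg _).trans (h 0)
  induction j using Nat.strong_induction_on with
  | _ n ih =>
    have h1 := amiceFun_natCast_add_one (p := p) f n
    rw [Finset.sum_range_succ, Nat.choose_self, Nat.cast_one, mul_one] at h1
    rw [← sub_eq_iff_eq_add'.mpr h1]
    rw [sub_eq_add_neg]
    refine (IsUltrametricDist.norm_add_le_max _ _).trans (max_le (h _) ((norm_neg _).trans_le
      (IsUltrametricDist.norm_sum_le_of_forall_le_of_nonneg hε fun j hj => ?_)))
    rw [norm_mul]
    exact (mul_le_of_le_one_right (norm_nonneg _) (IsUltrametricDist.norm_natCast_le_one L _)).trans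
      (ih j (by simpa using hj))

variable (L) in
/-- The Laurent series in the Robba ring without terms of degree `< N`. -/
def posPart (N : ℤ) : Submodule L (RobbaRing L) where
  carrier := {f | ∀ n < N, f.1 n = 0}
  zero_mem' := fun _ _ => rfl
  add_mem' := fun {f g} hf hg n hn => by
    simp only [Submodule.coe_add, Pi.add_apply, hf n hn, hg n hn, add_zero]
  smul_mem' := fun c f hf n hn => by
    simp only [Submodule.coe_smul, Pi.smul_apply, hf n hn, smul_zero]

omit [CompleteSpace L] in
theorem mem_posPart_of_amiceFun_eq_zero [IsUltrametricDist L] {f : RobbaRing L}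
    (h : ∀ x : ℤ_[p], amiceFun f x = 0) : f ∈ posPart L 0 := by
  intro n hn
  obtain ⟨j, rfl⟩ : ∃ j : ℕ, n = -1 - j := ⟨(-1 - n).toNat, by omega⟩
  exact norm_le_zero_iff.mp (norm_coeff_le_of_amiceFun (p := p) (fun x => by rw [h, norm_zero]) j)

omit [CompleteSpace L] in
theorem amiceFun_eq_zero_of_mem_posPart {f : RobbaRing L} (h : f ∈ posPart L 0) (x : ℤ_[p]) :
    amiceFun f x = 0 := by
  have h' : ∀ j : ℕ, f.1 (-1 - j) = 0 := fun j => h _ (by omega)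
  simp only [amiceFun, h', zero_mul, tsum_zero]

/-- Integration by parts under the residue: ∂f · (1+T)^(x-1) dT = (1+T)^x df. On coefficients it is
the recursion `succ_mul_bin_succ`. -/
theorem amiceFun_partialD (f : RobbaRing L) (x : ℤ_[p]) :
    amiceFun (partialD p L f) x = -(intIncl p L x * amiceFun f x) := by
  have hs : Summable fun j : ℕ => ((j : L) * f.1 (-j)) * bin L (x - 1) j := by
    obtain ⟨ρ, C, h0, h1, h⟩ := RobbaRing.exists_norm_le f.2
    have := ultrametric p L
    refine (summable_nat_add_iff 1).mp ?_
    refine Summable.of_norm_bounded ((summable_geometric_of_lt_one h0.le h1).mul_left C) fun j => ?_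
    refine norm_mul_bin_le (le_trans ?_ (h j)) _ _
    rw [norm_mul, show (-((j + 1 : ℕ) : ℤ)) = -1 - j by push_cast; ring]
    exact mul_le_of_le_one_left (norm_nonneg _) (IsUltrametricDist.norm_natCast_le_one L _)
  have hs' : Summable fun j : ℕ => ((j : L) + 1) * f.1 (-1 - j) * bin L (x - 1) j := by
    obtain ⟨ρ, C, h0, h1, h⟩ := RobbaRing.exists_norm_le f.2
    have := ultrametric p L
    refine Summable.of_norm_bounded ((summable_geometric_of_lt_one h0.le h1).mul_left C) fun j => ?_
    refine norm_mul_bin_le (le_trans ?_ (h j)) _ _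
    rw [norm_mul]
    refine mul_le_of_le_one_left (norm_nonneg _) ?_
    exact_mod_cast IsUltrametricDist.norm_natCast_le_one L (j + 1)
  have e : ∀ j : ℕ, (partialD p L f).1 (-1 - j) * bin L (x - 1) j =
      -((((j : L) + 1) * f.1 (-1 - j) * bin L (x - 1) j) + ((j : L) * f.1 (-j)) * bin L (x - 1) j) := by
    intro j
    have e1 : (-1 - (j : ℤ)) + 1 = -j := by ring
    simp only [partialD, LinearMap.coe_mk, AddHom.coe_mk, e1]
    push_cast
    ring
  rw [amiceFun, tsum_congr e, tsum_neg, hs'.tsum_add hs, hs.tsum_eq_zero_add, amiceFun, neg_inj]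
  simp only [Nat.cast_zero, zero_mul, zero_add]
  rw [← hs'.tsum_add ((summable_nat_add_iff 1).mpr hs), ← tsum_mul_left]
  refine tsum_congr fun j => ?_
  have h := succ_mul_bin_succ (L := L) (x - 1) j
  rw [map_sub, map_one] at h
  rw [show (-((j + 1 : ℕ) : ℤ)) = -1 - j by push_cast; ring, Nat.cast_succ]
  linear_combination (f.1 (-1 - j)) * h

omit [CompleteSpace L] in
theorem amiceFun_invT (x : ℤ_[p]) : amiceFun (invT L) x = 1 := by
  rw [amiceFun, tsum_eq_single 0]
  · simp [invT]
  · intro j hj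
    have : (-1 - (j : ℤ)) ≠ -1 := by omega
    simp [invT, Pi.single_eq_of_ne this]

theorem amiceFun_partialD_pow_invT (k : ℕ) (x : ℤ_[p]) :
    amiceFun ((partialD p L ^ k) (invT L)) x = (-intIncl p L x) ^ k := by
  induction k with
  | zero => simpa using amiceFun_invT x
  | succ k ih =>
    rw [pow_succ', Module.End.mul_apply, amiceFun_partialD, ih]
    ring

theorem amiceFun_subst [IsUltrametricDist L] {c : ℤ → ℤ → L} (hc : Substitutable c)
    (f : RobbaRing L) (x : ℤ_[p]) :
    amiceFun ⟨subst c f, hc.subst_mem f.2⟩ x =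
      ∑' k : ℤ, f.1 k * ∑' j : ℕ, c k (-1 - j) * bin L (x - 1) j := by
  have hsum : Summable (Function.uncurry fun (k : ℤ) (j : ℕ) =>
      f.1 k * c k (-1 - j) * bin L (x - 1) j) := by
    obtain ⟨r, h0, h1, hr⟩ := hc f.1 f.2
    obtain ⟨z, hz, h⟩ := hr r le_rfl h1
    apply NonarchimedeanAddGroup.summable_of_tendsto_cofinite_zero
    rw [tendsto_zero_iff_norm_tendsto_zero]
    have hinj : Function.Injective fun q : ℤ × ℕ => ((q.1, -1 - (q.2 : ℤ)) : ℤ × ℤ) := by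
      rintro ⟨a, b⟩ ⟨a', b'⟩ h
      simpa using h
    refine squeeze_zero (fun q => norm_nonneg _) (fun q => ?_) (hz.comp hinj.tendsto_cofinite)
    refine (norm_mul_bin_le le_rfl _ _).trans (le_trans ?_ (h q.1 (-1 - q.2)))
    refine le_mul_of_one_le_right (norm_nonneg _) ?_
    rw [show (-1 - (q.2 : ℤ)) = -((q.2 + 1 : ℕ) : ℤ) by push_cast; ring, zpow_neg, zpow_natCast]
    exact (one_le_inv₀ (by positivity)).mpr (pow_le_one₀ h0.le h1.le)
  calc amiceFun ⟨subst c f, hc.subst_mem f.2⟩ x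
      = ∑' (j : ℕ) (k : ℤ), f.1 k * c k (-1 - j) * bin L (x - 1) j :=
        tsum_congr fun j => by simp only [subst, tsum_mul_right]
    _ = ∑' (k : ℤ) (j : ℕ), f.1 k * c k (-1 - j) * bin L (x - 1) j := hsum.tsum_comm
    _ = _ := tsum_congr fun k => by simp only [mul_assoc, tsum_mul_left]

/-- The action on functions of a substitution, when it is known on the functions of the powers
of `T`. -/
theorem amiceFun_subst_of_forall [IsUltrametricDist L] {c : ℤ → ℤ → L} (hc : Substitutable c)
    (f : RobbaRing L) (x y : ℤ_[p]) (b : L)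
    (hpos : ∀ (n j : ℕ), c n (-1 - j) = 0)
    (hneg : ∀ m : ℕ, ∑' j : ℕ, c (-1 - m) (-1 - j) * bin L (x - 1) j = b * bin L (y - 1) m) :
    amiceFun ⟨subst c f, hc.subst_mem f.2⟩ x = b * amiceFun f y := by
  rw [amiceFun_subst hc]
  have hinj : Function.Injective fun m : ℕ => (-1 - m : ℤ) := fun a b h => by simpa using h
  rw [← hinj.tsum_eq]
  · rw [amiceFun, ← tsum_mul_left]
    exact tsum_congr fun m => by rw [hneg]; ring
  · intro k hk
    by_contra hcon
    refine hk ?_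
    obtain ⟨n, rfl⟩ : ∃ n : ℕ, k = n := by
      refine ⟨k.toNat, ?_⟩
      by_contra h
      exact hcon ⟨(-1 - k).toNat, by simp only; omega⟩
    simp only [hpos, zero_mul, tsum_zero, mul_zero]

end

end

section

variable {p : ℕ} [Fact p.Prime] {L : Type*} [NormedField L] [NormedAlgebra ℚ_[p] L]

/-! ## The Frobenius on functions -/

/-- The polynomial `P(T)` as an element of `L((T⁻¹))`. -/
theorem coeff_aeval_single_neg_one {L : Type*} [Field L] (P : Polynomial L) (n : ℤ) :
    (Polynomial.aeval (HahnSeries.single (-1 : ℤ) (1 : L) : LaurentSeries L) P).coeff (-n) =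
      if 0 ≤ n then P.coeff n.toNat else 0 := by
  induction P using Polynomial.induction_on' with
  | add P Q hP hQ =>
    rw [map_add, HahnSeries.coeff_add, hP, hQ, Polynomial.coeff_add]
    split_ifs <;> simp
  | monomial m a =>
    have h : (HahnSeries.single (-1 : ℤ) (1 : L) : LaurentSeries L) ^ m =
        HahnSeries.single (-m : ℤ) 1 := by
      simp [HahnSeries.single_pow]
    rw [Polynomial.aeval_monomial, h, LaurentSeries.algebraMap_apply,
      HahnSeries.C_mul_eq_smul, HahnSeries.coeff_smul,
      HahnSeries.coeff_single, Polynomial.coeff_monomial, smul_eq_mul]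
    split_ifs <;> first | omega | simp

omit [Fact p.Prime] [NormedAlgebra ℚ_[p] L] in
theorem phiT_pow (k : ℕ) : phiT p L ^ k =
    Polynomial.aeval (HahnSeries.single (-1 : ℤ) (1 : L) : LaurentSeries L)
      (((1 + Polynomial.X) ^ p - 1) ^ k : Polynomial L) := by
  simp [phiT]

omit [Fact p.Prime] [NormedAlgebra ℚ_[p] L] in
theorem phiCoeff_natCast_of_neg (k : ℕ) {n : ℤ} (hn : n < 0) : phiCoeff p L k n = 0 := by
  rw [phiCoeff, zpow_natCast, phiT_pow, coeff_aeval_single_neg_one, if_neg (by omega)]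

theorem phiCoeff_natCast (k n : ℕ) : phiCoeff p L k n = affCoeff L (p : ℤ_[p]) 0 n k := by
  rw [phiCoeff, zpow_natCast, phiT_pow, coeff_aeval_single_neg_one, if_pos (by positivity),
    affCoeff, onePow_natCast, onePow_zero, one_mul, Int.toNat_natCast, ← Polynomial.coeff_coe]
  simp

theorem phiCoeff_eq_zero_of_lt {k n : ℤ} (h : p * k < n) : phiCoeff p L k n = 0 := by
  have := norm_phiCoeff_le p L k n
  rw [if_neg (by omega)] at this
  exact norm_le_zero_iff.mp this

theorem phiCoeff_neg_one : phiCoeff p L (-1) (-p) = 1 := by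
  set u : PowerSeries L := (1 + PowerSeries.X) ^ p - PowerSeries.X ^ p with hu
  have hu0 : PowerSeries.constantCoeff u = 1 := by
    rw [← PowerSeries.coeff_zero_eq_constantCoeff_apply, hu, phi_coeff_series p]
    simp [(Fact.out (p := p.Prime)).pos]
  have h : phiT p L ^ (-1 : ℤ) =
      HahnSeries.single (p : ℤ) 1 * HahnSeries.ofPowerSeries ℤ L u⁻¹ := by
    rw [zpow_neg_one]
    refine (eq_inv_of_mul_eq_one_left ?_).symm
    rw [phiT_eq, mul_mul_mul_comm, HahnSeries.single_mul_single, ← map_mul,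
      PowerSeries.inv_mul_cancel _ (by rw [hu0]; exact one_ne_zero)]
    simp
  rw [phiCoeff, neg_neg, h, HahnSeries.coeff_single_mul, sub_self, one_mul]
  have := HahnSeries.ofPowerSeries_apply_coeff (Γ := ℤ) u⁻¹ 0
  rw [Nat.cast_zero] at this
  rw [this, PowerSeries.coeff_zero_eq_constantCoeff_apply, PowerSeries.constantCoeff_inv, hu0,
    inv_one]

/-- The pairing of `φ(T) ^ k` with `(1 + T) ^ s`. -/
theorem sum_phiCoeff_mul_choose (k : ℤ) {s : ℕ} (hs : s < p) :
    ∑ j ∈ Finset.range (s + 1), phiCoeff p L k (-1 - j) * (s.choose j : ℕ) =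
      if k = -1 ∧ s = p - 1 then 1 else 0 := by
  have hp := (Fact.out (p := p.Prime)).pos
  rcases lt_or_ge k 0 with hk | hk
  -- For k < 0 the expansion of φ(T)^k in powers of T⁻¹ begins at T^(pk), and pk ≤ -p; the only
  -- exponent -1-j ≥ -p that it can reach is -p, with k = -1 and j = p - 1.
  · have hz : ∀ j ≤ s, ¬(k = -1 ∧ j = p - 1) → phiCoeff p L k (-1 - j) = 0 := by
      intro j hj h
      refine phiCoeff_eq_zero_of_lt ?_
      rcases eq_or_ne k (-1) with rfl | hk1
      · have : j ≠ p - 1 := fun hh => h ⟨rfl, hh⟩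
        omega
      · have h2 : k ≤ -2 := by omega
        have : (p : ℤ) * k ≤ p * (-2) := by gcongr
        omega
    rw [Finset.sum_range_succ, Finset.sum_eq_zero, zero_add, Nat.choose_self, Nat.cast_one, mul_one]
    · split_ifs with h
      · obtain ⟨rfl, rfl⟩ := h
        rw [← phiCoeff_neg_one (p := p) (L := L)]
        congr 1
        omega
      · exact hz s le_rfl h
    · intro j hj
      have hj' := Finset.mem_range.mp hj
      rw [hz j hj'.le (by omega), zero_mul]
  · obtain ⟨n, rfl⟩ := Int.eq_ofNat_of_zero_le hk
    rw [if_neg (by omega)]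
    refine Finset.sum_eq_zero fun j _ => ?_
    rw [phiCoeff_natCast_of_neg _ (by omega), zero_mul]

omit [Fact p.Prime] [NormedAlgebra ℚ_[p] L] in
theorem coeff_phiT_zpow_mul (k : ℤ) (N : ℕ) :
    (phiT p L ^ k * (1 + HahnSeries.single (-1 : ℤ) 1) ^ N).coeff 1 =
      ∑ j ∈ Finset.range (N + 1), phiCoeff p L k (-1 - j) * (N.choose j : ℕ) := by
  rw [add_comm, add_pow, Finset.mul_sum, HahnSeries.coeff_sum]
  refine Finset.sum_congr rfl fun j _ => ?_
  have h : (HahnSeries.single (-1 : ℤ) (1 : L) : LaurentSeries L) ^ j * 1 ^ (N - j) *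
      ((N.choose j : ℕ) : LaurentSeries L) = HahnSeries.single (-j : ℤ) ((N.choose j : ℕ) : L) := by
    rw [one_pow, mul_one, HahnSeries.single_pow, ← map_natCast HahnSeries.C, HahnSeries.C_apply,
      HahnSeries.single_mul_single]
    simp
  rw [h, HahnSeries.coeff_mul_single, phiCoeff]
  congr 2
  ring

variable [CompleteSpace L] [IsUltrametricDist L]

-- The residue of φ(T)^(-1-m) (1+T)^(py+s) dT. Expanding (1+T)^(py) = (φ(T) + 1)^y leaves residues
-- of φ(T)^(l-1-m) (1+T)^s dT, of which only l = m, s = p - 1 contributes.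
omit [CompleteSpace L] [IsUltrametricDist L] in
theorem tsum_phiCoeff_mul_bin (m y s : ℕ) (hs : s < p) :
    ∑' j : ℕ, phiCoeff p L (-1 - m) (-1 - j) * bin L ((p : ℤ_[p]) * (y : ℤ_[p]) + (s : ℤ_[p])) j =
      (if s = p - 1 then 1 else 0) * (y.choose m : ℕ) := by
  have e : ((p : ℤ_[p]) * (y : ℤ_[p]) + (s : ℤ_[p])) = ((p * y + s : ℕ) : ℤ_[p]) := by push_cast; ring
  rw [e, tsum_eq_sum (s := Finset.range (p * y + s + 1))]
  swap
  · intro j hj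
    rw [bin_natCast, Nat.choose_eq_zero_of_lt (by simpa using hj), Nat.cast_zero, mul_zero]
  simp only [bin_natCast]
  have hne : phiT p L ≠ 0 := by
    intro h
    have := phiCoeff_neg_one (p := p) (L := L)
    rw [phiCoeff, h] at this
    simp at this
  have h1 : (1 + HahnSeries.single (-1 : ℤ) (1 : L) : LaurentSeries L) ^ p = phiT p L + 1 := by
    simp [phiT]
  rw [← coeff_phiT_zpow_mul, pow_add, pow_mul, h1, add_pow, Finset.sum_mul, Finset.mul_sum,
    HahnSeries.coeff_sum]
  have h2 : ∀ l ∈ Finset.range (y + 1), (phiT p L ^ (-1 - m : ℤ) *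
      (phiT p L ^ l * 1 ^ (y - l) * ((y.choose l : ℕ) : LaurentSeries L) *
        (1 + HahnSeries.single (-1 : ℤ) 1) ^ s)).coeff 1 =
      if l = m then (if s = p - 1 then 1 else 0) * ((y.choose l : ℕ) : L) else 0 := by
    intro l _
    have e1 : phiT p L ^ (-1 - m : ℤ) *
      (phiT p L ^ l * 1 ^ (y - l) * ((y.choose l : ℕ) : LaurentSeries L) *
        (1 + HahnSeries.single (-1 : ℤ) 1) ^ s) = HahnSeries.C ((y.choose l : ℕ) : L) *
        (phiT p L ^ (-1 - m + l : ℤ) * (1 + HahnSeries.single (-1 : ℤ) 1) ^ s) := by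
      rw [one_pow, mul_one, zpow_add₀ hne, zpow_natCast, map_natCast]
      ring
    rw [e1, HahnSeries.C_mul_eq_smul, HahnSeries.coeff_smul, coeff_phiT_zpow_mul,
      sum_phiCoeff_mul_choose _ hs, smul_eq_mul]
    by_cases hl : l = m
    · subst hl
      simp [mul_comm]
    · rw [if_neg (by omega), if_neg hl, mul_zero]
  rw [Finset.sum_congr rfl h2, Finset.sum_ite_eq']
  split_ifs with h3 <;> simp_all [Nat.choose_eq_zero_of_lt]

variable [FiniteDimensional ℚ_[p] L]

/-- Together with `amiceFun_phi_of_isUnit` this says that φ is extension by zero along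
multiplication by p: p(n+1) - 1 has last digit p - 1, whereas x - 1 has a smaller one if x is a
unit. -/
theorem amiceFun_phi_mul (f : RobbaRing L) (y : ℤ_[p]) :
    amiceFun (phi p L f) ((p : ℤ_[p]) * y) = amiceFun f y := by
  have hp := (Fact.out (p := p.Prime)).pos
  have h := eq_of_eq_natCast (f := fun y : ℤ_[p] => amiceFun (phi p L f) ((p : ℤ_[p]) * (y + 1)))
    (g := fun y : ℤ_[p] => amiceFun f (y + 1))
    ((LocAnalytic.amiceFun _).continuous.comp (by fun_prop))
    ((LocAnalytic.amiceFun _).continuous.comp (by fun_prop)) (fun n => ?_) (y - 1)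
  · simpa using h
  · have h := amiceFun_subst_of_forall (substitutable_phi p L) f ((p : ℤ_[p]) * ((n : ℤ_[p]) + 1)) ((n : ℤ_[p]) + 1) 1
      (fun n j => phiCoeff_natCast_of_neg _ (by omega)) fun m => ?_
    · rw [one_mul] at h
      exact h
    · have e : (p : ℤ_[p]) * ((n : ℤ_[p]) + 1) - 1 = (p : ℤ_[p]) * (n : ℤ_[p]) + ((p - 1 : ℕ) : ℤ_[p]) := by
        rw [Nat.cast_sub hp]; push_cast; ring
      rw [e, tsum_phiCoeff_mul_bin m n (p - 1) (by omega), if_pos rfl, add_sub_cancel_right,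
        bin_natCast]

theorem amiceFun_phi_of_isUnit (f : RobbaRing L) {x : ℤ_[p]} (hx : IsUnit x) :
    amiceFun (phi p L f) x = 0 := by
  have hp := (Fact.out (p := p.Prime)).pos
  obtain ⟨s, hs, y, hy⟩ : ∃ s : ℕ, s < p ∧ ∃ y : ℤ_[p], x = (p : ℤ_[p]) * y + (s : ℤ_[p]) := by
    obtain ⟨s, hs, h⟩ := PadicInt.exists_mem_range (x := x)
    rw [PadicInt.maximalIdeal_eq_span_p, Ideal.mem_span_singleton'] at h
    obtain ⟨y, hy⟩ := h
    exact ⟨s, hs, y, by rw [mul_comm, hy]; ring⟩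
  have hs0 : s ≠ 0 := by
    rintro rfl
    rw [hy, Nat.cast_zero, add_zero] at hx
    exact PadicInt.irreducible_p.not_isUnit (isUnit_of_mul_isUnit_left hx)
  have h := eq_of_eq_natCast (f := fun y : ℤ_[p] => amiceFun (phi p L f) ((p : ℤ_[p]) * y + (s : ℤ_[p])))
    (g := fun _ : ℤ_[p] => (0 : L))
    ((LocAnalytic.amiceFun _).continuous.comp (by fun_prop)) continuous_const (fun n => ?_) y
  · rw [hy]; exact h
  · have h := amiceFun_subst_of_forall (substitutable_phi p L) f ((p : ℤ_[p]) * (n : ℤ_[p]) + (s : ℤ_[p])) 0 0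
      (fun n j => phiCoeff_natCast_of_neg _ (by omega)) fun m => ?_
    · rw [zero_mul] at h
      exact h
    · have e : (p : ℤ_[p]) * (n : ℤ_[p]) + (s : ℤ_[p]) - 1 = (p : ℤ_[p]) * (n : ℤ_[p]) + ((s - 1 : ℕ) : ℤ_[p]) := by
        rw [Nat.cast_sub (by omega)]; push_cast; ring
      rw [e, tsum_phiCoeff_mul_bin m n (s - 1) (by omega), if_neg (by omega), zero_mul, zero_mul]

end

section

/-! ## The Euler derivation on Laurent series -/

/-- The operator `T d/dT` on `L((T))`. -/
def eulerFun {L : Type*} [Field L] (f : LaurentSeries L) : LaurentSeries L where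
  coeff n := n * f.coeff n
  isPWO_support' := f.isPWO_support.mono fun n hn h => hn (by simp only [h, mul_zero])

theorem eulerFun_mul {L : Type*} [Field L] (f g : LaurentSeries L) :
    eulerFun (f * g) = f * eulerFun g + eulerFun f * g := by
  have hs : ∀ f : LaurentSeries L, (eulerFun f).support ⊆ f.support :=
    fun f n hn h => hn (by simp only [eulerFun, h, mul_zero])
  ext n
  rw [HahnSeries.coeff_add, HahnSeries.coeff_mul_right' g.isPWO_support (hs g),
    HahnSeries.coeff_mul_left' f.isPWO_support (hs f)]
  simp only [eulerFun]
  rw [HahnSeries.coeff_mul, Finset.mul_sum, ← Finset.sum_add_distrib]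
  refine Finset.sum_congr rfl fun ij hij => ?_
  rw [← (Finset.mem_antidiagonal.mp hij).2.2]
  push_cast
  ring

theorem coeff_eulerFun {L : Type*} [Field L] (f : LaurentSeries L) (n : ℤ) :
    (eulerFun f).coeff n = n * f.coeff n := rfl

theorem eulerFun_sub {L : Type*} [Field L] (f g : LaurentSeries L) :
    eulerFun (f - g) = eulerFun f - eulerFun g :=
  HahnSeries.ext (funext fun n => mul_sub (n : L) (f.coeff n) (g.coeff n))

theorem eulerFun_one {L : Type*} [Field L] : eulerFun (1 : LaurentSeries L) = 0 := by
  have h := eulerFun_mul (1 : LaurentSeries L) 1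
  rwa [one_mul, one_mul, mul_one, left_eq_add] at h

theorem eulerFun_zpow {L : Type*} [Field L] {a : LaurentSeries L} (ha : a ≠ 0) (k : ℤ) :
    eulerFun (a ^ k) = k * a ^ (k - 1) * eulerFun a := by
  have key : ∀ k : ℤ, eulerFun (a ^ (k + 1)) = a ^ k * eulerFun a + eulerFun (a ^ k) * a :=
    fun k => by rw [zpow_add_one₀ ha, eulerFun_mul]
  have hz : ∀ k : ℤ, a ^ (k - 1) * a = a ^ k := fun k => by rw [← zpow_add_one₀ ha, sub_add_cancel]
  induction k using Int.induction_on with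
  | zero => simp [eulerFun_one]
  | succ k ih =>
    rw [key, ih, mul_right_comm, mul_assoc ((k : ℤ) : LaurentSeries L), hz, add_sub_cancel_right]
    push_cast
    ring
  | pred k ih =>
    have h := key (-k - 1)
    rw [sub_add_cancel, ih] at h
    refine mul_right_cancel₀ ha ?_
    rw [mul_right_comm, mul_assoc ((-k - 1 : ℤ) : LaurentSeries L), hz]
    push_cast at h ⊢
    linear_combination -h

variable {p : ℕ} [Fact p.Prime] {L : Type*} [NormedField L] [NormedAlgebra ℚ_[p] L]

/-! ## The powers of `γ(T)` -/

local notation "ofPS" => HahnSeries.ofPowerSeries ℤ _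

theorem map_unit_zpow {R K : Type*} [Semiring R] [Field K] (W : R →+* K) (u : Rˣ) (k : ℤ) :
    W ((u ^ k : Rˣ) : R) = W (u : R) ^ k := by
  have h := congrArg Units.val (map_zpow (Units.map W.toMonoidHom) u k)
  rw [Units.val_zpow_eq_zpow_val] at h
  exact h

variable (L) in
theorem intIncl_unit_ne_zero (g : ℤ_[p]ˣ) : intIncl p L g ≠ 0 := by
  rw [← norm_pos_iff, norm_intIncl, PadicInt.norm_units]; exact one_pos

variable (L) in
theorem isUnit_onePowQuot (g : ℤ_[p]ˣ) :
    IsUnit (PowerSeries.mk fun n => bin L (g : ℤ_[p]) (n + 1)) := by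
  rw [PowerSeries.isUnit_iff_constantCoeff, ← PowerSeries.coeff_zero_eq_constantCoeff_apply,
    PowerSeries.coeff_mk, zero_add, bin_one_right]
  exact (intIncl_unit_ne_zero L g).isUnit

variable (L) in
/-- The unit `γ(T) / T` of `L[[T]]`. -/
def gammaUnit (g : ℤ_[p]ˣ) : (PowerSeries L)ˣ := (isUnit_onePowQuot L g).unit

theorem coeff_gammaUnit (g : ℤ_[p]ˣ) (n : ℕ) :
    PowerSeries.coeff n (gammaUnit L g : PowerSeries L) = bin L (g : ℤ_[p]) (n + 1) := by
  rw [gammaUnit, IsUnit.unit_spec, PowerSeries.coeff_mk]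

theorem X_mul_gammaUnit (g : ℤ_[p]ˣ) :
    PowerSeries.X * (gammaUnit L g : PowerSeries L) = onePow L (g : ℤ_[p]) - 1 :=
  (onePow_sub_one _).symm

theorem gammaT_eq_onePow (g : ℤ_[p]ˣ) : gammaT L g = ofPS (onePow L (g : ℤ_[p])) - 1 := by
  rw [gammaT]
  congr 2
  ext n
  rw [PowerSeries.coeff_mk, coeff_onePow]
  rfl

theorem gammaT_eq_single_mul (g : ℤ_[p]ˣ) :
    gammaT L g = HahnSeries.single 1 1 * ofPS (gammaUnit L g : PowerSeries L) := by
  rw [gammaT_eq_onePow, ← HahnSeries.ofPowerSeries_X, ← map_mul, X_mul_gammaUnit, map_sub, map_one]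

theorem gammaT_zpow (g : ℤ_[p]ˣ) (k : ℤ) : gammaT L g ^ k =
    HahnSeries.single k 1 * ofPS ((gammaUnit L g ^ k : (PowerSeries L)ˣ) : PowerSeries L) := by
  rw [gammaT_eq_single_mul, mul_zpow, map_unit_zpow, RatFunc.single_zpow k]

theorem gammaT_ne_zero (g : ℤ_[p]ˣ) : gammaT L g ≠ 0 := by
  rw [gammaT_eq_single_mul]
  refine mul_ne_zero (by simp) ?_
  rw [ne_eq, map_eq_zero_iff _ HahnSeries.ofPowerSeries_injective]
  exact (gammaUnit L g).ne_zero

theorem coeff_single_mul_ofPowerSeries (k : ℤ) (V : PowerSeries L) (n : ℕ) :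
    (HahnSeries.single k 1 * ofPS V).coeff (k + n) = PowerSeries.coeff n V := by
  rw [HahnSeries.coeff_single_mul, one_mul, add_sub_cancel_left,
    HahnSeries.ofPowerSeries_apply_coeff]

theorem gammaCoeff_add (g : ℤ_[p]ˣ) (k : ℤ) (n : ℕ) : gammaCoeff L g k (k + n) =
    PowerSeries.coeff n ((gammaUnit L g ^ k : (PowerSeries L)ˣ) : PowerSeries L) := by
  rw [gammaCoeff, gammaT_zpow, coeff_single_mul_ofPowerSeries]

theorem gammaCoeff_eq_zero_of_lt (g : ℤ_[p]ˣ) {k n : ℤ} (h : n < k) : gammaCoeff L g k n = 0 := by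
  have := norm_gammaCoeff_le L g k n
  rw [if_neg (by omega)] at this
  exact norm_le_zero_iff.mp this

theorem norm_gammaCoeff_le_one (g : ℤ_[p]ˣ) (k n : ℤ) : ‖gammaCoeff L g k n‖ ≤ 1 :=
  (norm_gammaCoeff_le L g k n).trans (by split_ifs <;> norm_num)

theorem gammaCoeff_self (g : ℤ_[p]ˣ) (k : ℤ) : gammaCoeff L g k k = intIncl p L g ^ k := by
  have h := gammaCoeff_add (L := L) g k 0
  rw [Nat.cast_zero, add_zero] at h
  rw [h, PowerSeries.coeff_zero_eq_constantCoeff_apply, map_unit_zpow,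
    ← PowerSeries.coeff_zero_eq_constantCoeff_apply, coeff_gammaUnit, zero_add, bin_one_right]

theorem euler_onePow (s : ℤ_[p]) : eulerFun (ofPS (onePow L s)) =
    HahnSeries.C (intIncl p L s) * (HahnSeries.single 1 1 * ofPS (onePow L (s - 1))) := by
  ext n
  rw [coeff_eulerFun, HahnSeries.C_mul_eq_smul, HahnSeries.coeff_smul, HahnSeries.coeff_single_mul,
    one_mul, PowerSeries.coeff_coe, PowerSeries.coeff_coe, smul_eq_mul]
  rcases lt_trichotomy n 0 with h | rfl | h
  · rw [if_pos h, if_pos (by omega), mul_zero, mul_zero]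
  · simp
  · obtain ⟨m, rfl⟩ : ∃ m : ℕ, n = (m + 1 : ℕ) := ⟨(n - 1).toNat, by omega⟩
    have e : (((m + 1 : ℕ) : ℤ) - 1) = m := by push_cast; ring
    rw [e, if_neg (by omega), if_neg (by omega), Int.natAbs_natCast, Int.natAbs_natCast,
      coeff_onePow, coeff_onePow, ← bin_succ_eq]
    push_cast
    ring

theorem euler_gammaT (g : ℤ_[p]ˣ) : eulerFun (gammaT L g) =
    HahnSeries.C (intIncl p L g) * (HahnSeries.single 1 1 * ofPS (onePow L ((g : ℤ_[p]) - 1))) := by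
  rw [gammaT_eq_onePow, eulerFun_sub, eulerFun_one, sub_zero, euler_onePow]

/-- The residue of `γ(T) ^ k (1 + T) ^ (χ(γ) - 1) dT`. -/
theorem coeff_gammaT_zpow_mul_onePow (g : ℤ_[p]ˣ) (k : ℤ) :
    (gammaT L g ^ k * ofPS (onePow L ((g : ℤ_[p]) - 1))).coeff (-1) =
      if k = -1 then (intIncl p L g)⁻¹ else 0 := by
  have hL := charZero p L
  have hg := intIncl_unit_ne_zero L g
  split_ifs with hk
  · subst hk
    rw [gammaT_zpow, mul_assoc, ← map_mul]
    have h := coeff_single_mul_ofPowerSeries (-1)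
      (((gammaUnit L g ^ (-1 : ℤ) : (PowerSeries L)ˣ) : PowerSeries L) *
        onePow L ((g : ℤ_[p]) - 1)) 0
    rw [Nat.cast_zero, add_zero] at h
    rw [h, PowerSeries.coeff_zero_eq_constantCoeff_apply, map_mul, map_unit_zpow,
      ← PowerSeries.coeff_zero_eq_constantCoeff_apply,
      ← PowerSeries.coeff_zero_eq_constantCoeff_apply, coeff_gammaUnit, coeff_onePow]
    simp
  -- γ(T)^k (1+T)^(χ(γ)-1) dT is exact up to scalars: T d/dT of γ(T)^(k+1) is (k+1) χ(γ) T γ(T)^k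
  -- (1+T)^(χ(γ)-1), and T d/dT kills the coefficient of T^0.
  · have h := congrArg (fun f => HahnSeries.coeff f 0) (eulerFun_zpow (gammaT_ne_zero (L := L) g) (k + 1))
    simp only [coeff_eulerFun, Int.cast_zero, zero_mul, euler_gammaT, add_sub_cancel_right] at h
    have e : ((k + 1 : ℤ) : LaurentSeries L) * gammaT L g ^ k * (HahnSeries.C (intIncl p L g) *
        (HahnSeries.single 1 1 * ofPS (onePow L ((g : ℤ_[p]) - 1)))) =
        HahnSeries.single 1 1 * (HahnSeries.C ((k + 1 : ℤ) * intIncl p L g) *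
          (gammaT L g ^ k * ofPS (onePow L ((g : ℤ_[p]) - 1)))) := by
      rw [map_mul, map_intCast]
      ring
    rw [e, HahnSeries.coeff_single_mul, one_mul, HahnSeries.C_mul_eq_smul, HahnSeries.coeff_smul,
      smul_eq_mul, zero_sub] at h
    refine (mul_eq_zero.mp h.symm).resolve_left (mul_ne_zero ?_ hg)
    exact_mod_cast (by omega : k + 1 ≠ 0)

theorem coeff_gammaT_zpow_mul (g : ℤ_[p]ˣ) (m : ℕ) (s : ℤ_[p]) :
    (gammaT L g ^ (-1 - m : ℤ) * ofPS (onePow L s)).coeff (-1) =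
      ∑' j : ℕ, gammaCoeff L g (-1 - m) (-1 - j) * bin L s j := by
  have h := coeff_single_mul_ofPowerSeries (-1 - m)
    (((gammaUnit L g ^ (-1 - m : ℤ) : (PowerSeries L)ˣ) : PowerSeries L) * onePow L s) m
  rw [sub_add_cancel] at h
  rw [gammaT_zpow, mul_assoc, ← map_mul, h, PowerSeries.coeff_mul,
    Finset.Nat.sum_antidiagonal_eq_sum_range_succ (fun i j => PowerSeries.coeff i
      ((gammaUnit L g ^ (-1 - m : ℤ) : (PowerSeries L)ˣ) : PowerSeries L) *
        PowerSeries.coeff j (onePow L s)),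
    ← Finset.sum_range_reflect, tsum_eq_sum (s := Finset.range (m + 1))]
  · refine Finset.sum_congr rfl fun j hj => ?_
    have hj' : j ≤ m := by simpa [Nat.lt_succ_iff] using hj
    rw [show m + 1 - 1 - j = m - j by omega, show m - (m - j) = j by omega, coeff_onePow,
      ← gammaCoeff_add]
    congr 2
    omega
  · intro j hj
    rw [gammaCoeff_eq_zero_of_lt, zero_mul]
    have : m + 1 ≤ j := by simpa using hj
    omega

/-- The residue of γ(T)^(-1-m) (1+T)^(g(n+1)-1) dT, by expanding (1+T)^(gn) = (γ(T) + 1)^n and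
keeping the only term with a simple pole in γ(T). -/
theorem tsum_gammaCoeff_mul_bin (g : ℤ_[p]ˣ) (m n : ℕ) :
    ∑' j : ℕ, gammaCoeff L g (-1 - m) (-1 - j) * bin L ((g : ℤ_[p]) * ((n : ℤ_[p]) + 1) - 1) j =
      (intIncl p L g)⁻¹ * (n.choose m : ℕ) := by
  have e : (g : ℤ_[p]) * ((n : ℤ_[p]) + 1) - 1 = (g : ℤ_[p]) * (n : ℤ_[p]) + ((g : ℤ_[p]) - 1) := by
    ring
  have h1 : HahnSeries.ofPowerSeries ℤ L (onePow L (g : ℤ_[p])) = gammaT L g + 1 := by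
    rw [gammaT_eq_onePow]; ring
  rw [← coeff_gammaT_zpow_mul, e, onePow_add, onePow_mul_natCast, map_mul, map_pow, h1, add_pow,
    Finset.sum_mul, Finset.mul_sum, HahnSeries.coeff_sum]
  have h2 : ∀ l ∈ Finset.range (n + 1), (gammaT L g ^ (-1 - m : ℤ) *
      (gammaT L g ^ l * 1 ^ (n - l) * ((n.choose l : ℕ) : LaurentSeries L) *
        ofPS (onePow L ((g : ℤ_[p]) - 1)))).coeff (-1) =
      if l = m then (intIncl p L g)⁻¹ * ((n.choose l : ℕ) : L) else 0 := by
    intro l _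
    have e1 : gammaT L g ^ (-1 - m : ℤ) *
      (gammaT L g ^ l * 1 ^ (n - l) * ((n.choose l : ℕ) : LaurentSeries L) *
        ofPS (onePow L ((g : ℤ_[p]) - 1))) = HahnSeries.C ((n.choose l : ℕ) : L) *
        (gammaT L g ^ (-1 - m + l : ℤ) * ofPS (onePow L ((g : ℤ_[p]) - 1))) := by
      rw [one_pow, mul_one, zpow_add₀ (gammaT_ne_zero g), zpow_natCast, map_natCast]
      ring
    rw [e1, HahnSeries.C_mul_eq_smul, HahnSeries.coeff_smul, coeff_gammaT_zpow_mul_onePow,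
      smul_eq_mul]
    by_cases hl : l = m
    · subst hl
      simp [mul_comm]
    · rw [if_neg (by omega), if_neg hl, mul_zero]
  rw [Finset.sum_congr rfl h2, Finset.sum_ite_eq']
  split_ifs with h3
  · rfl
  · rw [Nat.choose_eq_zero_of_lt (by simpa using h3), Nat.cast_zero, mul_zero]

variable [FiniteDimensional ℚ_[p] L] [IsUltrametricDist L] [CompleteSpace L]

theorem amiceFun_gamma_mul (g : ℤ_[p]ˣ) (f : RobbaRing L) (y : ℤ_[p]) :
    amiceFun (gamma L g f) ((g : ℤ_[p]) * y) = (intIncl p L g)⁻¹ * amiceFun f y := by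
  have h := eq_of_eq_natCast
    (f := fun y : ℤ_[p] => amiceFun (gamma L g f) ((g : ℤ_[p]) * (y + 1)))
    (g := fun y : ℤ_[p] => (intIncl p L g)⁻¹ * amiceFun f (y + 1))
    ((LocAnalytic.amiceFun _).continuous.comp (by fun_prop))
    (((LocAnalytic.amiceFun _).continuous.comp (by fun_prop)).const_mul _) (fun n => ?_) (y - 1)
  · simpa using h
  · refine amiceFun_subst_of_forall (substitutable_gamma L g) f
      ((g : ℤ_[p]) * ((n : ℤ_[p]) + 1)) ((n : ℤ_[p]) + 1) (intIncl p L g)⁻¹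
      (fun n j => gammaCoeff_eq_zero_of_lt _ (by omega)) fun m => ?_
    rw [tsum_gammaCoeff_mul_bin, add_sub_cancel_right, bin_natCast]

theorem amiceFun_gamma (g : ℤ_[p]ˣ) (f : RobbaRing L) (x : ℤ_[p]) :
    amiceFun (gamma L g f) x =
      (intIncl p L g)⁻¹ * amiceFun f (((g⁻¹ : ℤ_[p]ˣ) : ℤ_[p]) * x) := by
  rw [← amiceFun_gamma_mul, ← mul_assoc, Units.mul_inv, one_mul]

end

section

variable {p : ℕ} [Fact p.Prime] {L : Type*} [NormedField L] [NormedAlgebra ℚ_[p] L]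

local notation "ofPS" => HahnSeries.ofPowerSeries ℤ _

/-! ## `γ` and the derivation `∂` -/

theorem coeff_add_coeff_eulerFun (f : LaurentSeries L) (n : ℤ) :
    ((1 + HahnSeries.single (-1 : ℤ) 1) * eulerFun f).coeff n =
      n * f.coeff n + (n + 1 : ℤ) * f.coeff (n + 1) := by
  rw [add_mul, one_mul, HahnSeries.coeff_add, HahnSeries.coeff_single_mul, one_mul, coeff_eulerFun,
    coeff_eulerFun, sub_neg_eq_add]

/-- Coefficientwise form of ∂(γ(T)^k) = χ(γ) k γ(T)^(k-1) (1 + γ(T)). -/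
theorem partialD_gammaCoeff (g : ℤ_[p]ˣ) (k n : ℤ) :
    n * gammaCoeff L g k n + (n + 1 : ℤ) * gammaCoeff L g k (n + 1) =
      intIncl p L g * (k * (gammaCoeff L g (k - 1) n + gammaCoeff L g k n)) := by
  have h1 : (1 + HahnSeries.single (-1 : ℤ) (1 : L) : LaurentSeries L) * HahnSeries.single 1 1 =
      ofPS (onePow L (1 : ℤ_[p])) := by
    rw [onePow_one, map_add, map_one (HahnSeries.ofPowerSeries ℤ L), HahnSeries.ofPowerSeries_X,
      add_mul, one_mul, HahnSeries.single_mul_single]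
    simp [add_comm]
  have h2 : (1 + HahnSeries.single (-1 : ℤ) (1 : L) : LaurentSeries L) * eulerFun (gammaT L g ^ k) =
      HahnSeries.C (intIncl p L g * k) * (gammaT L g ^ (k - 1) + gammaT L g ^ k) := by
    have h3 : HahnSeries.ofPowerSeries ℤ L (onePow L (g : ℤ_[p])) = gammaT L g + 1 := by
      rw [gammaT_eq_onePow]; ring
    have h4 : HahnSeries.ofPowerSeries ℤ L (onePow L (1 : ℤ_[p])) *
        ofPS (onePow L ((g : ℤ_[p]) - 1)) = gammaT L g + 1 := by
      rw [← h3, ← map_mul, ← onePow_add, add_sub_cancel]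
    have h5 : gammaT L g ^ k = gammaT L g ^ (k - 1) * gammaT L g := by
      rw [← zpow_add_one₀ (gammaT_ne_zero g), sub_add_cancel]
    rw [eulerFun_zpow (gammaT_ne_zero g), euler_gammaT, map_mul, map_intCast]
    calc _ = HahnSeries.C (intIncl p L g) * (k : LaurentSeries L) * gammaT L g ^ (k - 1) *
          (((1 + HahnSeries.single (-1 : ℤ) (1 : L) : LaurentSeries L) * HahnSeries.single 1 1) *
            ofPS (onePow L ((g : ℤ_[p]) - 1))) := by ring
      _ = _ := by rw [h1, h4, h5]; ring
  have h := congrArg (fun f => HahnSeries.coeff f n) h2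
  simp only [coeff_add_coeff_eulerFun, HahnSeries.C_mul_eq_smul, HahnSeries.coeff_smul,
    HahnSeries.coeff_add, smul_eq_mul] at h
  rw [gammaCoeff, gammaCoeff, gammaCoeff, h, mul_assoc]

/-- The composition law for the expansions of the powers of `(1 + T) ^ g - 1`. -/
theorem tsum_gammaCoeff_mul_gammaCoeff (a b : ℤ_[p]ˣ) (k n : ℤ) :
    ∑' m : ℤ, gammaCoeff L b k m * gammaCoeff L a m n = gammaCoeff L (a * b) k n := by
  rcases lt_or_ge n k with hkn | hkn
  · rw [gammaCoeff_eq_zero_of_lt _ hkn]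
    refine (tsum_congr fun m => ?_).trans tsum_zero
    rcases lt_or_ge m k with h | h
    · rw [gammaCoeff_eq_zero_of_lt _ h, zero_mul]
    · rw [gammaCoeff_eq_zero_of_lt a (lt_of_lt_of_le hkn h), mul_zero]
  obtain ⟨N, rfl⟩ : ∃ N : ℕ, n = k + N := ⟨(n - k).toNat, by omega⟩
  set A : PowerSeries L := onePow L (a : ℤ_[p]) - 1 with hA
  have hA0 : PowerSeries.constantCoeff A = 0 := by
    rw [hA, ← PowerSeries.coeff_zero_eq_constantCoeff_apply, map_sub, coeff_onePow]; simp
  have hsub : PowerSeries.HasSubst A := PowerSeries.HasSubst.of_constantCoeff_zero' hA0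
  -- Substitution of (1+T)^a - 1 for T is available as a ring homomorphism on power series only;
  -- negative powers are handled by splitting off T^k and using the unit γ(T)/T.
  set W : PowerSeries L →+* LaurentSeries L :=
    (HahnSeries.ofPowerSeries ℤ L).comp (PowerSeries.substAlgHom hsub).toRingHom with hW
  have hWa : ∀ P : PowerSeries L, W P = ofPS (PowerSeries.subst A P) := fun P => by
    rw [hW]
    simp [PowerSeries.coe_substAlgHom]
  have coeff_subst : ∀ (P : PowerSeries L) (i : ℕ), PowerSeries.coeff i (PowerSeries.subst A P) =
      ∑ d ∈ Finset.range (i + 1), PowerSeries.coeff d P * PowerSeries.coeff i (A ^ d) := by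
    intro P i
    rw [PowerSeries.coeff_subst' hsub]
    refine finsum_eq_sum_of_support_subset _ fun d hd => ?_
    by_contra hcon
    refine hd ?_
    beta_reduce
    simp only [Finset.coe_range, Set.mem_Iio, not_lt] at hcon
    rw [hA, onePow_sub_one, mul_pow, PowerSeries.coeff_X_pow_mul', if_neg (by omega), smul_zero]
  have hWb : W (onePow L (b : ℤ_[p])) = ofPS (onePow L ((a * b : ℤ_[p]ˣ) : ℤ_[p])) := by
    rw [hWa]
    congr 1
    ext i
    rw [coeff_subst, coeff_onePow]
    have h := bin_affine (L := L) (a : ℤ_[p]) 0 b i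
    rw [add_zero] at h
    rw [Units.val_mul, h]
    refine Finset.sum_congr rfl fun d _ => ?_
    rw [coeff_onePow, affCoeff, onePow_zero, one_mul]
  have hWX : W PowerSeries.X = gammaT L a := by
    rw [hWa, PowerSeries.subst_X hsub, gammaT_eq_onePow, hA, map_sub, map_one]
  have hWu : W (gammaUnit L b : PowerSeries L) = (gammaT L a)⁻¹ * gammaT L (a * b) := by
    rw [eq_inv_mul_iff_mul_eq₀ (gammaT_ne_zero a), ← hWX, ← map_mul, X_mul_gammaUnit, map_sub,
      hWb, map_one, ← gammaT_eq_onePow]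
  have hmain : gammaT L a ^ k * W ((gammaUnit L b ^ k : (PowerSeries L)ˣ) : PowerSeries L) =
      gammaT L (a * b) ^ k := by
    rw [map_unit_zpow, hWu, mul_zpow, inv_zpow', zpow_neg, mul_inv_cancel_left₀
      (zpow_ne_zero _ (gammaT_ne_zero a))]
  set V : PowerSeries L := ((gammaUnit L b ^ k : (PowerSeries L)ˣ) : PowerSeries L) with hV
  set Q : PowerSeries L := ((gammaUnit L a ^ k : (PowerSeries L)ˣ) : PowerSeries L) with hQ
  have hcoef : ∀ d : ℕ, gammaCoeff L a (k + d) (k + N) = PowerSeries.coeff N (Q * A ^ d) := by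
    intro d
    have e : gammaT L a ^ (k + d) = HahnSeries.single k 1 * ofPS (Q * A ^ d) := by
      rw [zpow_add₀ (gammaT_ne_zero a), zpow_natCast, gammaT_zpow, map_mul, map_pow, hA, map_sub,
        map_one (HahnSeries.ofPowerSeries ℤ L), ← gammaT_eq_onePow, mul_assoc]
    rw [gammaCoeff, e, coeff_single_mul_ofPowerSeries]
  have hA' : ∀ i d : ℕ, i < d → PowerSeries.coeff i (A ^ d) = 0 := by
    intro i d h
    rw [hA, onePow_sub_one, mul_pow, PowerSeries.coeff_X_pow_mul', if_neg (by omega)]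
  have hinj : Function.Injective fun d : ℕ => k + (d : ℤ) := fun x y h => by simpa using h
  rw [← hinj.tsum_eq]
  swap
  · intro m hm
    by_contra hcon
    refine hm ?_
    beta_reduce
    rw [gammaCoeff_eq_zero_of_lt, zero_mul]
    by_contra hlt
    exact hcon ⟨(m - k).toNat, by simp only; omega⟩
  rw [tsum_eq_sum (s := Finset.range (N + 1))]
  swap
  · intro d hd
    have : N + 1 ≤ d := by simpa using hd
    rw [gammaCoeff_eq_zero_of_lt a (by omega), mul_zero]
  rw [gammaCoeff, ← hmain, gammaT_zpow, hWa, mul_assoc, ← map_mul, coeff_single_mul_ofPowerSeries,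
    PowerSeries.coeff_mul]
  simp only [gammaCoeff_add, hcoef, PowerSeries.coeff_mul, Finset.mul_sum]
  rw [Finset.sum_comm]
  refine Finset.sum_congr rfl fun ij hij => ?_
  have hle : ij.2 ≤ N := by
    have := Finset.HasAntidiagonal.mem_antidiagonal.mp hij
    omega
  rw [coeff_subst, Finset.mul_sum]
  refine (Finset.sum_subset (Finset.range_mono (by omega)) fun d _ hd => ?_).symm.trans
    (Finset.sum_congr rfl fun d _ => by rw [← hV]; ring)
  rw [hA' _ _ (by simpa using hd), mul_zero, mul_zero]

variable [FiniteDimensional ℚ_[p] L]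

theorem coeff_gamma (g : ℤ_[p]ˣ) (f : RobbaRing L) (n : ℤ) :
    (gamma L g f).1 n = ∑' k : ℤ, f.1 k * gammaCoeff L g k n := rfl

variable [IsUltrametricDist L] [CompleteSpace L]

theorem gamma_mul_apply (a b : ℤ_[p]ˣ) (f : RobbaRing L) :
    gamma L (a * b) f = gamma L a (gamma L b f) := by
  refine Subtype.ext (funext fun n => ?_)
  have hsum : Summable (Function.uncurry fun (m k : ℤ) =>
      f.1 k * gammaCoeff L b k m * gammaCoeff L a m n) := by
    obtain ⟨r, h0, h1, hr⟩ := substitutable_gamma L b f.1 f.2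
    obtain ⟨z, hz, h⟩ := hr r le_rfl h1
    apply NonarchimedeanAddGroup.summable_of_tendsto_cofinite_zero
    rw [tendsto_zero_iff_norm_tendsto_zero]
    have hz' := (hz.comp (Equiv.prodComm ℤ ℤ).injective.tendsto_cofinite).const_mul (r ^ (-n))
    rw [mul_zero] at hz'
    refine squeeze_zero (fun q => norm_nonneg _) (fun q => ?_) hz'
    obtain ⟨m, k⟩ := q
    have hz0 : 0 ≤ z (k, m) := (by positivity : (0 : ℝ) ≤ _).trans (h k m)
    simp only [Function.uncurry, Function.comp, Equiv.prodComm_apply, Prod.swap_prod_mk]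
    rcases lt_or_ge n m with hm | hm
    · rw [gammaCoeff_eq_zero_of_lt a hm, mul_zero, norm_zero]
      positivity
    · rw [norm_mul]
      refine (mul_le_of_le_one_right (norm_nonneg _) (norm_gammaCoeff_le_one _ _ _)).trans ?_
      rw [zpow_neg, ← div_eq_inv_mul, le_div_iff₀ (by positivity)]
      refine le_trans (mul_le_mul_of_nonneg_left ?_ (norm_nonneg _)) (h k m)
      exact (zpow_le_zpow_iff_right_of_lt_one₀ h0 h1).mpr hm
  rw [coeff_gamma, coeff_gamma]
  symm
  calc ∑' m : ℤ, (gamma L b f).1 m * gammaCoeff L a m n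
      = ∑' (m : ℤ) (k : ℤ), f.1 k * gammaCoeff L b k m * gammaCoeff L a m n :=
        tsum_congr fun m => by rw [coeff_gamma, tsum_mul_right]
    _ = ∑' (k : ℤ) (m : ℤ), f.1 k * gammaCoeff L b k m * gammaCoeff L a m n := hsum.tsum_comm.symm
    _ = _ := tsum_congr fun k => by
        rw [← tsum_gammaCoeff_mul_gammaCoeff, ← tsum_mul_left]
        exact tsum_congr fun m => by ring

theorem partialD_gamma (g : ℤ_[p]ˣ) (f : RobbaRing L) :
    partialD p L (gamma L g f) = intIncl p L g • gamma L g (partialD p L f) := by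
  have hmem : (fun k : ℤ => (k : L) * f.1 k) ∈ RobbaRing L := by
    obtain ⟨r, h0, h1, hr⟩ := f.2
    refine ⟨r, h0, h1, fun ρ h2 h3 => ?_⟩
    have hρ : 0 < ρ := h0.trans_le h2
    refine squeeze_zero (fun k => by positivity) (fun k => ?_) (hr ρ h2 h3)
    rw [norm_mul]
    exact mul_le_mul_of_nonneg_right (mul_le_of_le_one_left (norm_nonneg _)
      (IsUltrametricDist.norm_intCast_le_one L k)) (by positivity)
  have hmem' : (fun k : ℤ => ((k + 1 : ℤ) : L) * f.1 (k + 1)) ∈ RobbaRing L := by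
    have h := (RobbaRing L).sub_mem (partialD p L f).2 hmem
    convert h using 1
    funext k
    simp [partialD]
  refine Subtype.ext (funext fun n => ?_)
  have s1 := (substitutable_gamma L g).summable f.2 n
  have s2 := (substitutable_gamma L g).summable f.2 (n + 1)
  have s3 := (substitutable_gamma L g).summable hmem n
  have s4 := (substitutable_gamma L g).summable hmem' n
  have e1 : (partialD p L (gamma L g f)).1 n =
      n * (gamma L g f).1 n + (n + 1 : ℤ) * (gamma L g f).1 (n + 1) := rfl
  have e2 : ∀ k, (partialD p L f).1 k = k * f.1 k + (k + 1 : ℤ) * f.1 (k + 1) := fun k => rfl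
  have s5 : Summable fun k : ℤ => (k : L) * f.1 k * gammaCoeff L g (k - 1) n := by
    have := s4.comp_injective (sub_left_injective (b := (1 : ℤ)))
    simpa [Function.comp_def] using this
  have e3 : ∑' k : ℤ, ((k + 1 : ℤ) : L) * f.1 (k + 1) * gammaCoeff L g k n =
      ∑' k : ℤ, (k : L) * f.1 k * gammaCoeff L g (k - 1) n := by
    rw [← (Equiv.addRight (1 : ℤ)).tsum_eq
      (fun k : ℤ => (k : L) * f.1 k * gammaCoeff L g (k - 1) n)]
    simp
  rw [e1, coeff_gamma, coeff_gamma, ← tsum_mul_left, ← tsum_mul_left,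
    ← (s1.mul_left _).tsum_add (s2.mul_left _), Submodule.coe_smul, Pi.smul_apply, coeff_gamma,
    smul_eq_mul]
  simp only [e2, add_mul]
  rw [s3.tsum_add s4, e3, ← s3.tsum_add s5, ← tsum_mul_left]
  refine tsum_congr fun k => ?_
  linear_combination f.1 k * partialD_gammaCoeff (L := L) g k n

theorem partialD_pow_gamma (g : ℤ_[p]ˣ) (m : ℕ) (f : RobbaRing L) :
    (partialD p L ^ m) (gamma L g f) = intIncl p L g ^ m • gamma L g ((partialD p L ^ m) f) := by
  induction m with
  | zero => simp
  | succ m ih =>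
    rw [pow_succ', Module.End.mul_apply, ih, map_smul, partialD_gamma, Module.End.mul_apply,
      smul_smul, pow_succ]

end

section

variable {p : ℕ} [Fact p.Prime] {L : Type*} [NormedField L] [NormedAlgebra ℚ_[p] L]

/-! ## The positive part of the Robba ring -/

theorem posPart_mono {M N : ℤ} (h : M ≤ N) : posPart L N ≤ posPart L M :=
  fun _ hf n hn => hf n (lt_of_lt_of_le hn h)

theorem mem_robbaRing_of_forall_bound {f : ℤ → L} (hneg : ∀ n < 0, f n = 0)
    (hb : ∀ ρ : ℝ, 0 < ρ → ρ < 1 → ∃ C, ∀ n : ℕ, ‖f n‖ * ρ ^ n ≤ C) : f ∈ RobbaRing L := by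
  refine ⟨1 / 2, by norm_num, by norm_num, fun ρ h1 h2 => ?_⟩
  have h0 : 0 < ρ := by linarith
  set σ := (1 + ρ) / 2 with hσ
  have hσ0 : 0 < σ := by linarith
  obtain ⟨C, hC⟩ := hb σ hσ0 (by linarith)
  have hg := (tendsto_geom (q := ρ / σ) (by positivity)
    ((div_lt_one hσ0).mpr (by linarith))).const_mul C
  rw [mul_zero] at hg
  refine squeeze_zero (fun k => by positivity) (fun k => ?_) hg
  split_ifs with hk
  · obtain ⟨n, rfl⟩ := Int.eq_ofNat_of_zero_le hk
    rw [Int.toNat_natCast, zpow_natCast]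
    calc ‖f n‖ * ρ ^ n = ‖f n‖ * σ ^ n * (ρ / σ) ^ n := by
          rw [mul_assoc, ← mul_pow, mul_div_cancel₀ _ hσ0.ne']
      _ ≤ C * (ρ / σ) ^ n := by gcongr; exact hC n
  · simp [hneg k (by omega)]

theorem RobbaRing.forall_bound {f : ℤ → L} (hf : f ∈ RobbaRing L) {ρ : ℝ} (h0 : 0 < ρ)
    (h1 : ρ < 1) : ∃ C, ∀ n : ℕ, ‖f n‖ * ρ ^ n ≤ C := by
  obtain ⟨r, hr0, hr1, hr⟩ := hf
  obtain ⟨C, hC⟩ := (hr (max r ρ) (le_max_left _ _) (max_lt hr1 h1)).bddAbove_range_of_cofinite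
  refine ⟨C, fun n => le_trans ?_ (hC ⟨n, rfl⟩)⟩
  simp only [zpow_natCast]
  gcongr
  exact le_max_right _ _

variable (L) in
/-- The element `T ^ m` of the Robba ring. -/
def monomialT (m : ℕ) : RobbaRing L :=
  ⟨Pi.single (m : ℤ) 1, mem_robbaRing_of_forall_bound
    (fun n hn => Pi.single_eq_of_ne (by omega) _) fun ρ h0 h1 => ⟨1, fun n => by
      rcases eq_or_ne n m with rfl | h
      · simp only [Pi.single_eq_same, norm_one, one_mul]
        exact pow_le_one₀ h0.le h1.le
      · rw [Pi.single_eq_of_ne (by exact_mod_cast h), norm_zero, zero_mul]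
        exact zero_le_one⟩⟩

theorem monomialT_mem (m : ℕ) : monomialT L m ∈ posPart L m :=
  fun n hn => Pi.single_eq_of_ne (by omega) _

theorem monomialT_self (m : ℕ) : (monomialT L m).1 m = 1 := Pi.single_eq_same _ _

theorem affCoeff_self (s : ℤ_[p]) (k : ℕ) : affCoeff L s 0 k k = intIncl p L s ^ k := by
  have h := PowerSeries.coeff_X_pow_mul ((PowerSeries.mk fun n => bin L s (n + 1)) ^ k) k 0
  rw [zero_add] at h
  rw [affCoeff, onePow_zero, one_mul, onePow_sub_one, mul_pow, h]
  rw [PowerSeries.coeff_zero_eq_constantCoeff_apply, map_pow,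
    ← PowerSeries.coeff_zero_eq_constantCoeff_apply, PowerSeries.coeff_mk, zero_add, bin_one_right]

section

variable [FiniteDimensional ℚ_[p] L]

theorem coeff_phi (f : RobbaRing L) (n : ℤ) :
    (phi p L f).1 n = ∑' k : ℤ, f.1 k * phiCoeff p L k n := rfl

theorem coeff_phi_of_mem {f : RobbaRing L} (hf : f ∈ posPart L 0) (n : ℕ) :
    (phi p L f).1 n = ∑ k ∈ Finset.range (n + 1), f.1 k * affCoeff L (p : ℤ_[p]) 0 n k := by
  have hinj : Function.Injective fun k : ℕ => (k : ℤ) := Nat.cast_injective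
  rw [coeff_phi, ← hinj.tsum_eq]
  · rw [tsum_eq_sum (s := Finset.range (n + 1))]
    · simp only [phiCoeff_natCast]
    · intro k hk
      rw [phiCoeff_natCast, affCoeff_eq_zero _ _ (by simpa using hk), mul_zero]
  · intro k hk
    by_contra hcon
    refine hk ?_
    beta_reduce
    rw [hf k, zero_mul]
    by_contra hlt
    exact hcon ⟨k.toNat, by simp only; omega⟩

theorem phi_mem_posPart {f : RobbaRing L} {m : ℕ} (hf : f ∈ posPart L m) :
    phi p L f ∈ posPart L m := by
  intro n hn
  rcases lt_or_ge n 0 with h | h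
  · rw [coeff_phi]
    refine (tsum_congr fun k => ?_).trans tsum_zero
    rcases lt_or_ge k 0 with hk | hk
    · rw [hf k (by omega), zero_mul]
    · obtain ⟨k, rfl⟩ := Int.eq_ofNat_of_zero_le hk
      rw [phiCoeff_natCast_of_neg _ h, mul_zero]
  · obtain ⟨n, rfl⟩ := Int.eq_ofNat_of_zero_le h
    rw [coeff_phi_of_mem (posPart_mono (by omega) hf)]
    refine Finset.sum_eq_zero fun k hk => ?_
    have := Finset.mem_range.mp hk
    rw [hf k (by omega), zero_mul]

theorem coeff_phi_self {f : RobbaRing L} {m : ℕ} (hf : f ∈ posPart L m) :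
    (phi p L f).1 m = (p : L) ^ m * f.1 m := by
  rw [coeff_phi_of_mem (posPart_mono (by omega) hf), Finset.sum_range_succ, Finset.sum_eq_zero,
    zero_add, affCoeff_self, map_natCast, mul_comm]
  intro k hk
  have := Finset.mem_range.mp hk
  rw [hf k (by omega), zero_mul]

theorem gamma_mem_posPart (g : ℤ_[p]ˣ) {f : RobbaRing L} {m : ℤ} (hf : f ∈ posPart L m) :
    gamma L g f ∈ posPart L m := by
  intro n hn
  rw [coeff_gamma]
  refine (tsum_congr fun k => ?_).trans tsum_zero
  rcases lt_or_ge k m with hk | hk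
  · rw [hf k hk, zero_mul]
  · rw [gammaCoeff_eq_zero_of_lt _ (by omega), mul_zero]

theorem coeff_gamma_self (g : ℤ_[p]ˣ) {f : RobbaRing L} {m : ℤ} (hf : f ∈ posPart L m) :
    (gamma L g f).1 m = intIncl p L g ^ m * f.1 m := by
  rw [coeff_gamma, tsum_eq_single m, gammaCoeff_self, mul_comm]
  intro k hk
  rcases lt_or_ge k m with h | h
  · rw [hf k h, zero_mul]
  · rw [gammaCoeff_eq_zero_of_lt _ (by omega), mul_zero]

end

/-! ### Inverting `1 - d φ` on series with a zero of high order -/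

/-- The solution of a triangular system of linear equations. -/
def triangularSol (f : ℕ → L) (c : ℕ → ℕ → L) (n : ℕ) : L :=
  f n + ∑ k : Fin n, triangularSol f c k * c n k
termination_by n
decreasing_by exact k.2

omit [Fact p.Prime] in
theorem triangularSol_eq (f : ℕ → L) (c : ℕ → ℕ → L) (n : ℕ) :
    triangularSol f c n = f n + ∑ k ∈ Finset.range n, triangularSol f c k * c n k := by
  rw [triangularSol, Finset.sum_range]

theorem max_pow_div_le {κ : ℝ} (hκ1 : κ ≤ 1) (hκ : (p : ℝ)⁻¹ ≤ κ) (n : ℕ) :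
    max ((κ ^ (n + 1)) ^ p) (κ ^ (n + 1) / p) ≤ κ ^ (n + 2) := by
  have hp := (Fact.out (p := p.Prime)).pos
  have hp0 : 0 < (p : ℝ)⁻¹ := by positivity
  have hκ0 : 0 < κ := hp0.trans_le hκ
  refine max_le ?_ ?_
  · calc (κ ^ (n + 1)) ^ p ≤ (κ ^ (n + 1)) ^ 2 :=
          pow_le_pow_of_le_one (by positivity) (pow_le_one₀ hκ0.le hκ1)
            (Fact.out (p := p.Prime)).two_le
      _ = κ ^ (n + 1 + (n + 1)) := by rw [sq, ← pow_add]
      _ ≤ κ ^ (n + 2) := pow_le_pow_of_le_one hκ0.le hκ1 (by omega)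
  · rw [pow_succ κ (n + 1), div_eq_mul_inv]
    gcongr

variable [IsUltrametricDist L]

/-- On radii ρ ≤ 1/p the Gauss norm of φ(T) is at most ρ/p, so dφ does not increase the norm of a
series with a zero of order N. -/
theorem exists_bound_of_small {d : L} {N : ℕ} (hN : ‖d‖ * (p : ℝ)⁻¹ ^ N ≤ 1) {f g : ℕ → L}
    (hg0 : ∀ n < N, g n = 0)
    (hg : ∀ n, ‖g n‖ ≤ ‖f n + d * ∑ k ∈ Finset.range n, g k * affCoeff L (p : ℤ_[p]) 0 n k‖)
    {ρ C : ℝ} (h0 : 0 < ρ) (h1 : ρ ≤ (p : ℝ)⁻¹) (hf : ∀ n, ‖f n‖ * ρ ^ n ≤ C) (n : ℕ) :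
    ‖g n‖ * ρ ^ n ≤ C := by
  have hp := Fact.out (p := p.Prime)
  have hp0 : (0 : ℝ) < p := by exact_mod_cast hp.pos
  have hpi : (p : ℝ)⁻¹ ≤ 1 := inv_le_one_of_one_le₀ (by exact_mod_cast hp.one_le)
  have hC : 0 ≤ C := (by positivity : (0 : ℝ) ≤ _).trans (hf 0)
  have hmax : max (ρ ^ p) (ρ / p) = ρ * (p : ℝ)⁻¹ := by
    rw [max_eq_right, div_eq_mul_inv]
    calc ρ ^ p ≤ ρ ^ 2 := pow_le_pow_of_le_one h0.le (h1.trans hpi) hp.two_le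
      _ = ρ * ρ := sq ρ
      _ ≤ ρ * (p : ℝ)⁻¹ := by gcongr
      _ = ρ / p := (div_eq_mul_inv _ _).symm
  induction n using Nat.strong_induction_on with
  | _ n ih =>
    rw [← le_div_iff₀ (by positivity)]
    refine (hg n).trans ((IsUltrametricDist.norm_add_le_max _ _).trans (max_le ?_ ?_))
    · rw [le_div_iff₀ (by positivity)]; exact hf n
    · rw [Finset.mul_sum]
      refine IsUltrametricDist.norm_sum_le_of_forall_le_of_nonneg (by positivity) fun k hk => ?_
      rw [le_div_iff₀ (by positivity)]
      rcases lt_or_ge k N with hkN | hkN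
      · rw [hg0 k hkN]; simpa using hC
      · have hc := norm_affCoeff_prime_le (p := p) (L := L) h0 (h1.trans hpi) n k
        rw [hmax, mul_pow] at hc
        have hpk : (p : ℝ)⁻¹ ^ k ≤ (p : ℝ)⁻¹ ^ N := pow_le_pow_of_le_one (by positivity) hpi hkN
        rw [norm_mul, norm_mul]
        calc ‖d‖ * (‖g k‖ * ‖affCoeff L (p : ℤ_[p]) 0 n k‖) * ρ ^ n
            = ‖d‖ * ‖g k‖ * (‖affCoeff L (p : ℤ_[p]) 0 n k‖ * ρ ^ n) := by ring
          _ ≤ ‖d‖ * ‖g k‖ * (ρ ^ k * (p : ℝ)⁻¹ ^ k) := by gcongr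
          _ = (‖d‖ * (p : ℝ)⁻¹ ^ k) * (‖g k‖ * ρ ^ k) := by ring
          _ ≤ 1 * C := by
            refine mul_le_mul (le_trans ?_ hN) (ih k (Finset.mem_range.mp hk)) (by positivity)
              zero_le_one
            gcongr
          _ = C := one_mul C

/-- The equation g = f + dφ(g) propagates bounds outwards: the norm of φ(g) at radius ρ is
controlled by that of g at the smaller radius max(ρ^p, ρ/p). -/
theorem exists_bound_of_bound {d : L} {f g : ℕ → L}
    (hg : ∀ n, ‖g n‖ ≤ ‖f n + d * ∑ k ∈ Finset.range n, g k * affCoeff L (p : ℤ_[p]) 0 n k‖)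
    {ρ σ C D : ℝ} (h0 : 0 < ρ) (h1 : ρ ≤ 1) (hσ : max (ρ ^ p) (ρ / p) ≤ σ)
    (hf : ∀ n, ‖f n‖ * ρ ^ n ≤ C) (hgσ : ∀ n, ‖g n‖ * σ ^ n ≤ D) (n : ℕ) :
    ‖g n‖ * ρ ^ n ≤ max C (‖d‖ * D) := by
  have hC : 0 ≤ C := (by positivity : (0 : ℝ) ≤ _).trans (hf 0)
  have hD : 0 ≤ D := by
    have := hgσ 0
    rw [pow_zero, mul_one] at this
    exact (norm_nonneg _).trans this
  rw [← le_div_iff₀ (by positivity)]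
  refine (hg n).trans ((IsUltrametricDist.norm_add_le_max _ _).trans (max_le ?_ ?_))
  · rw [le_div_iff₀ (by positivity)]; exact (hf n).trans (le_max_left _ _)
  · rw [Finset.mul_sum]
    refine IsUltrametricDist.norm_sum_le_of_forall_le_of_nonneg (by positivity) fun k hk => ?_
    rw [le_div_iff₀ (by positivity)]
    refine le_trans ?_ (le_max_right _ _)
    have hc := norm_affCoeff_prime_le (p := p) (L := L) h0 h1 n k
    have hm : 0 ≤ max (ρ ^ p) (ρ / p) := le_max_of_le_left (by positivity)
    rw [norm_mul, norm_mul]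
    calc ‖d‖ * (‖g k‖ * ‖affCoeff L (p : ℤ_[p]) 0 n k‖) * ρ ^ n
        = ‖d‖ * (‖g k‖ * (‖affCoeff L (p : ℤ_[p]) 0 n k‖ * ρ ^ n)) := by ring
      _ ≤ ‖d‖ * (‖g k‖ * σ ^ k) := by
        gcongr
        exact hc.trans (pow_le_pow_left₀ hm hσ k)
      _ ≤ ‖d‖ * D := by gcongr; exact hgσ k

variable [FiniteDimensional ℚ_[p] L]

/-- `1 - d φ` is surjective on the series with a zero of order `≥ N` at `0`, if `|d p ^ N| < 1`. -/
theorem exists_sub_smul_phi_eq {d : L} {N : ℕ} (hN : ‖d‖ * (p : ℝ)⁻¹ ^ N < 1) {f : RobbaRing L}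
    (hf : f ∈ posPart L N) : ∃ g : RobbaRing L, g - d • phi p L g = f := by
  have hp := Fact.out (p := p.Prime)
  have hp0 : (0 : ℝ) < p := by exact_mod_cast hp.pos
  have hpi : (p : ℝ)⁻¹ < 1 := inv_lt_one_of_one_lt₀ (by exact_mod_cast hp.one_lt)
  -- On coefficients, g - dφ(g) = f is triangular with diagonal entries 1 - d p^n. An entry may
  -- vanish for n < N, but there the numerator is 0 as well and g n = 0.
  set g : ℕ → L := triangularSol (fun n => f.1 n / (1 - d * p ^ n))
    (fun n k => d * affCoeff L (p : ℤ_[p]) 0 n k / (1 - d * p ^ n)) with hgdef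
  have hgeq : ∀ n, g n = (f.1 n + d * ∑ k ∈ Finset.range n, g k * affCoeff L (p : ℤ_[p]) 0 n k) /
      (1 - d * p ^ n) := by
    intro n
    rw [hgdef, triangularSol_eq, ← hgdef, add_div, Finset.mul_sum, Finset.sum_div]
    congr 1
    exact Finset.sum_congr rfl fun k _ => by ring
  have hg0 : ∀ n < N, g n = 0 := by
    intro n
    induction n using Nat.strong_induction_on with
    | _ n ih =>
      intro hn
      rw [hgeq, hf n (by omega), Finset.sum_eq_zero, mul_zero, add_zero, zero_div]
      intro k hk
      have := Finset.mem_range.mp hk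
      rw [ih k this (by omega), zero_mul]
  have hden : ∀ n, N ≤ n → ‖1 - d * (p : L) ^ n‖ = 1 := by
    intro n hn
    have h : ‖-(d * (p : L) ^ n)‖ < 1 := by
      rw [norm_neg, norm_mul, norm_pow, norm_prime p L]
      refine lt_of_le_of_lt ?_ hN
      gcongr ‖d‖ * ?_
      exact pow_le_pow_of_le_one (by positivity) hpi.le hn
    rw [sub_eq_add_neg, IsUltrametricDist.norm_add_eq_max_of_norm_ne_norm
      (by rw [norm_one]; exact h.ne'), norm_one, max_eq_left h.le]
  have hgle : ∀ n, ‖g n‖ ≤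
      ‖f.1 n + d * ∑ k ∈ Finset.range n, g k * affCoeff L (p : ℤ_[p]) 0 n k‖ := by
    intro n
    rcases lt_or_ge n N with h | h
    · rw [hg0 n h, norm_zero]; positivity
    · rw [hgeq n, norm_div, hden n h, div_one]
  have hbound : ∀ ρ : ℝ, 0 < ρ → ρ < 1 → ∃ C, ∀ n : ℕ, ‖g n‖ * ρ ^ n ≤ C := by
    intro ρ h0 h1
    set κ := max ρ (p : ℝ)⁻¹ with hκ
    have hκ0 : 0 < κ := lt_max_of_lt_left h0
    have hκ1 : κ < 1 := max_lt h1 hpi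
    obtain ⟨J, hJ⟩ := exists_pow_lt_of_lt_one (show 0 < (p : ℝ)⁻¹ by positivity) hκ1
    -- The bound starts at radius κ^(J+1) ≤ 1/p and moves out from κ^(i+2) to κ^(i+1), up to κ ≥ ρ.
    have key : ∀ j ≤ J, ∃ C, ∀ n : ℕ, ‖g n‖ * (κ ^ (J + 1 - j)) ^ n ≤ C := by
      intro j
      induction j with
      | zero =>
        intro _
        have hle : κ ^ (J + 1) ≤ (p : ℝ)⁻¹ :=
          (pow_le_pow_of_le_one hκ0.le hκ1.le (Nat.le_succ J)).trans hJ.le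
        obtain ⟨C, hC⟩ := RobbaRing.forall_bound f.2 (ρ := κ ^ (J + 1)) (by positivity)
          (lt_of_le_of_lt hle hpi)
        exact ⟨C, exists_bound_of_small hN.le hg0 hgle (by positivity) hle hC⟩
      | succ j ih =>
        intro hj
        obtain ⟨D, hD⟩ := ih (by omega)
        obtain ⟨i, hi⟩ : ∃ i, J + 1 - (j + 1) = i + 1 := ⟨J - j - 1, by omega⟩
        have hi' : J + 1 - j = i + 2 := by omega
        rw [hi'] at hD
        rw [hi]
        have hlt : κ ^ (i + 1) < 1 := pow_lt_one₀ hκ0.le hκ1 (by omega)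
        obtain ⟨C, hC⟩ := RobbaRing.forall_bound f.2 (ρ := κ ^ (i + 1)) (by positivity) hlt
        exact ⟨_, exists_bound_of_bound hgle (by positivity) hlt.le
          (max_pow_div_le hκ1.le (le_max_right _ _) i) hC hD⟩
    obtain ⟨C, hC⟩ := key J le_rfl
    refine ⟨C, fun n => le_trans ?_ (hC n)⟩
    rw [show J + 1 - J = 1 by omega, pow_one]
    gcongr
    exact le_max_left _ _
  have hmem : (fun n : ℤ => if 0 ≤ n then g n.toNat else 0) ∈ RobbaRing L := by
    refine mem_robbaRing_of_forall_bound (fun n hn => if_neg (by omega)) fun ρ h0 h1 => ?_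
    obtain ⟨C, hC⟩ := hbound ρ h0 h1
    exact ⟨C, fun n => by simpa using hC n⟩
  have hpos : (⟨_, hmem⟩ : RobbaRing L) ∈ posPart L 0 := fun n hn => if_neg (by omega)
  refine ⟨⟨_, hmem⟩, Subtype.ext (funext fun n => ?_)⟩
  have e : ∀ h : RobbaRing L, (h - d • phi p L h).1 n = h.1 n - d * (phi p L h).1 n := fun h => rfl
  rw [e]
  rcases lt_or_ge n 0 with h | h
  · rw [phi_mem_posPart (m := 0) hpos n h, hpos n h, hf n (by omega), mul_zero, sub_zero]
  · obtain ⟨n, rfl⟩ := Int.eq_ofNat_of_zero_le h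
    rw [coeff_phi_of_mem hpos]
    simp only [Nat.cast_nonneg, if_true, Int.toNat_natCast]
    rw [Finset.sum_range_succ, affCoeff_self, map_natCast]
    rcases lt_or_ge n N with hn | hn
    · rw [hg0 n hn, hf n (by omega), Finset.sum_eq_zero]
      · simp
      · intro k hk
        have := Finset.mem_range.mp hk
        rw [hg0 k (by omega), zero_mul]
    · have hne : 1 - d * (p : L) ^ n ≠ 0 := by
        rw [← norm_pos_iff, hden n hn]; exact one_pos
      have h := hgeq n
      rw [eq_div_iff hne] at h
      linear_combination h

end

section

variable {p : ℕ} [Fact p.Prime] {L : Type*} [NormedField L] [NormedAlgebra ℚ_[p] L]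

/-! ## Topological generators of `ℤ_pˣ` -/

theorem exists_eq_mul_of_not_isUnit {x : ℤ_[p]} (hx : ¬IsUnit x) : ∃ y, x = p * y := by
  have h := PadicInt.not_isUnit_iff.mp hx
  rw [PadicInt.norm_lt_one_iff_dvd] at h
  exact h

theorem not_isUnit_mul_prime (y : ℤ_[p]) : ¬IsUnit ((p : ℤ_[p]) * y) := fun h =>
  PadicInt.irreducible_p.not_isUnit (isUnit_of_mul_isUnit_left h)

theorem exists_pow_eq (u : ℤ_[p]ˣ) : ∃ y : ℤ_[p], (u : ℤ_[p]) ^ (p - 1) = 1 + p * y := by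
  have h : PadicInt.toZMod ((u : ℤ_[p]) ^ (p - 1) - 1) = 0 := by
    rw [map_sub, map_pow, map_one, ZMod.pow_card_sub_one_eq_one, sub_self]
    exact (u.isUnit.map PadicInt.toZMod).ne_zero
  rw [← RingHom.mem_ker, PadicInt.ker_toZMod, PadicInt.maximalIdeal_eq_span_p,
    Ideal.mem_span_singleton] at h
  obtain ⟨y, hy⟩ := h
  exact ⟨y, by rw [← hy]; ring⟩

theorem mem_of_isClosed {g : ℤ_[p]ˣ} (hg : (Subgroup.zpowers g).topologicalClosure = ⊤)
    (K : Subgroup ℤ_[p]ˣ) (hK : IsClosed (K : Set ℤ_[p]ˣ)) (h : g ∈ K) (u : ℤ_[p]ˣ) : u ∈ K := by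
  have h1 := Subgroup.topologicalClosure_minimal _ ((Subgroup.zpowers_le).mpr h) hK
  rw [hg] at h1
  exact h1 trivial

theorem isUnit_one_add_prime : IsUnit (1 + (p : ℤ_[p])) := by
  by_contra h
  obtain ⟨y, hy⟩ := exists_eq_mul_of_not_isUnit h
  refine not_isUnit_mul_prime (y - 1) ?_
  rw [mul_sub, ← hy]
  simp

/-- The n-torsion is a closed subgroup; if it contained g it would contain 1 + p, whose powers are
distinct natural numbers. -/
theorem pow_ne_one_of_generator {g : ℤ_[p]ˣ}
    (hg : (Subgroup.zpowers g).topologicalClosure = ⊤) {n : ℕ} (hn : n ≠ 0) : g ^ n ≠ 1 := by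
  intro h
  have h1 := mem_of_isClosed hg (powMonoidHom n).ker
    (isClosed_singleton.preimage (f := fun u : ℤ_[p]ˣ => u ^ n) (t := {1}) (continuous_pow n)) h
    isUnit_one_add_prime.unit
  rw [MonoidHom.mem_ker, powMonoidHom_apply, ← Units.val_inj, Units.val_pow_eq_pow_val,
    IsUnit.unit_spec, Units.val_one] at h1
  have h2 : ((1 + p : ℕ) : ℤ_[p]) ^ n = ((1 : ℕ) : ℤ_[p]) := by exact_mod_cast h1
  rw [← Nat.cast_pow, Nat.cast_inj] at h2
  have := (Fact.out (p := p.Prime)).pos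
  exact (Nat.one_lt_pow hn (by omega)).ne' h2

/-- Otherwise g, and by closedness every unit, would have (p-1)-st power 1 modulo p²; the unit 1 + p
does not. -/
theorem exists_isUnit_pow_eq {g : ℤ_[p]ˣ}
    (hg : (Subgroup.zpowers g).topologicalClosure = ⊤) :
    ∃ y : ℤ_[p], IsUnit y ∧ (g : ℤ_[p]) ^ (p - 1) = 1 + p * y := by
  obtain ⟨y, hy⟩ := exists_pow_eq g
  refine ⟨y, ?_, hy⟩
  by_contra hyu
  obtain ⟨z, rfl⟩ := exists_eq_mul_of_not_isUnit hyu
  have hmem : ∀ x : ℤ_[p], PadicInt.toZModPow 2 x = 1 ↔ ‖x - 1‖ ≤ (p : ℝ) ^ (-(2 : ℕ) : ℤ) := by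
    intro x
    rw [PadicInt.norm_le_pow_iff_mem_span_pow, ← PadicInt.ker_toZModPow, RingHom.mem_ker, map_sub,
      map_one, sub_eq_zero]
  let K : Subgroup ℤ_[p]ˣ := ((Units.map (PadicInt.toZModPow (p := p) 2).toMonoidHom).comp
    (powMonoidHom (p - 1))).ker
  have hK : ∀ u, u ∈ K ↔ PadicInt.toZModPow 2 ((u : ℤ_[p]) ^ (p - 1)) = 1 := by
    intro u
    rw [MonoidHom.mem_ker, ← Units.val_inj]
    rfl
  have hKc : IsClosed (K : Set ℤ_[p]ˣ) := by
    have : (K : Set ℤ_[p]ˣ) =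
        {u : ℤ_[p]ˣ | ‖(u : ℤ_[p]) ^ (p - 1) - 1‖ ≤ (p : ℝ) ^ (-(2 : ℕ) : ℤ)} := by
      ext u
      rw [SetLike.mem_coe, hK, hmem]
      rfl
    rw [this]
    exact isClosed_le (by fun_prop) continuous_const
  have hgK : g ∈ K := by
    rw [hK, hy, map_add, map_one, ← mul_assoc, ← sq, map_mul, map_pow,
      map_natCast]
    have : ((p : ZMod (p ^ 2)) ^ 2) = 0 := by exact_mod_cast ZMod.natCast_self (p ^ 2)
    rw [this, zero_mul, add_zero]
  have h1 := mem_of_isClosed hg K hKc hgK isUnit_one_add_prime.unit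
  rw [hK, IsUnit.unit_spec, hmem, PadicInt.norm_le_pow_iff_mem_span_pow,
    Ideal.mem_span_singleton] at h1
  obtain ⟨w, hw⟩ := h1
  have hp := (Fact.out (p := p.Prime))
  -- Modulo p², (1+p)^(p-1) is 1 + (p-1)p. Were it 1, division by p would make p a divisor of 1.
  obtain ⟨v, hv⟩ := Polynomial.powAddExpansion (1 : ℤ_[p]) (p : ℤ_[p]) (p - 1)
  refine not_isUnit_mul_prime (w - v - 1) (isUnit_of_dvd_one (Dvd.intro_left (-1) ?_))
  have hp0 : (p : ℤ_[p]) ≠ 0 := by exact_mod_cast hp.ne_zero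
  apply mul_left_cancel₀ hp0
  rw [one_pow, one_pow, Nat.cast_sub hp.one_le, Nat.cast_one] at hv
  linear_combination hw - hv

end

section

variable {p : ℕ} [Fact p.Prime] {L : Type*} [NormedField L] [NormedAlgebra ℚ_[p] L]

/-! ## Locally analytic functions supported on `ℤ_pˣ` -/

section

variable [CompleteSpace L] [IsUltrametricDist L] [FiniteDimensional ℚ_[p] L]

/-- The part of F on pℤ_p is φ applied to a lift of F(p·), because φ is extension by zero;
subtracting it leaves the part on units. -/
theorem LocAnalytic.indicator_isUnit {F : ℤ_[p] → L} (hF : LocAnalytic F) :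
    LocAnalytic ({x | IsUnit x}.indicator F) := by
  obtain ⟨f, hf, -⟩ := exists_amiceFun_eq (hF.comp_mul (p : ℤ_[p]))
  have h := hF.sub (LocAnalytic.amiceFun (p := p) (phi p L f))
  convert h using 1
  funext x
  by_cases hx : IsUnit x
  · rw [Set.indicator_of_mem (by exact hx), amiceFun_phi_of_isUnit f hx, sub_zero]
  · rw [Set.indicator_of_notMem (by exact hx)]
    obtain ⟨y, rfl⟩ := exists_eq_mul_of_not_isUnit hx
    rw [amiceFun_phi_mul, hf, sub_self]

-- The function x^(-i) on units, extended by zero: it vanishes at 0, hence can be divided by x and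
-- restricted to units again.
variable (p L) in
theorem exists_locAnalytic_inv_pow (i : ℕ) : ∃ G : ℤ_[p] → L, LocAnalytic G ∧
    (∀ x, IsUnit x → intIncl p L x ^ i * G x = 1) ∧ ∀ x, ¬IsUnit x → G x = 0 := by
  induction i with
  | zero =>
    refine ⟨_, (locAnalytic_const (1 : L)).indicator_isUnit, fun x hx => ?_, fun x hx => ?_⟩
    · rw [Set.indicator_of_mem (by exact hx), pow_zero, one_mul]
    · rw [Set.indicator_of_notMem (by exact hx)]
  | succ i ih =>
    obtain ⟨G, hG, h1, h2⟩ := ih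
    obtain ⟨G', hG', h⟩ := hG.exists_eq_mul (h2 0 not_isUnit_zero)
    refine ⟨_, hG'.indicator_isUnit, fun x hx => ?_, fun x hx => ?_⟩
    · rw [Set.indicator_of_mem (by exact hx), pow_succ, mul_assoc, ← h, h1 x hx]
    · rw [Set.indicator_of_notMem (by exact hx)]

end

/-! ## The elements `∂ ^ i (1 / T)` -/

theorem coeff_partialD (f : RobbaRing L) (n : ℤ) :
    (partialD p L f).1 n = n * f.1 n + (n + 1 : ℤ) * f.1 (n + 1) := rfl

theorem partialD_pow_succ_apply (i : ℕ) (f : RobbaRing L) :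
    (partialD p L ^ (i + 1)) f = partialD p L ((partialD p L ^ i) f) := by
  rw [pow_succ', Module.End.mul_apply]

theorem amiceFun_partialD_pow [CompleteSpace L] (i : ℕ) (f : RobbaRing L) (x : ℤ_[p]) :
    amiceFun ((partialD p L ^ i) f) x = (-intIncl p L x) ^ i * amiceFun f x := by
  induction i with
  | zero => simp
  | succ i ih => rw [partialD_pow_succ_apply, amiceFun_partialD, ih]; ring

theorem partialD_pow_mem_posPart {f : RobbaRing L} {m : ℕ} (i : ℕ) (hf : f ∈ posPart L (m + i)) :
    (partialD p L ^ i) f ∈ posPart L m ∧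
      ((partialD p L ^ i) f).1 m = ((m + i).descFactorial i : ℕ) * f.1 (m + i) := by
  induction i generalizing m with
  | zero => simpa using hf
  | succ i ih =>
    have e : ((m + (i + 1 : ℕ) : ℤ)) = ((m + 1 : ℕ) : ℤ) + i := by push_cast; ring
    rw [e] at hf
    obtain ⟨h1, h2⟩ := ih hf
    refine ⟨fun n hn => ?_, ?_⟩
    · rw [partialD_pow_succ_apply, coeff_partialD, h1 n (by push_cast; omega), mul_zero, zero_add]
      rcases eq_or_ne n (-1) with rfl | hne
      · simp
      · rw [h1 (n + 1) (by push_cast; omega), mul_zero]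
    · rw [partialD_pow_succ_apply, coeff_partialD, h1 m (by push_cast; omega), mul_zero, zero_add, e,
        show (m : ℤ) + 1 = ((m + 1 : ℕ) : ℤ) by push_cast; rfl, h2, ← mul_assoc,
        show m + (i + 1) = m + 1 + i by ring]
      congr 1
      have h3 := Nat.descFactorial_succ (m + 1 + i) i
      rw [show m + 1 + i - i = m + 1 by omega] at h3
      rw [h3]
      push_cast
      ring

theorem coeff_zero_partialD_pow {f : RobbaRing L} {m : ℕ} (hf : f ∈ posPart L m) :
    ((partialD p L ^ m) f).1 0 = (m.factorial : ℕ) * f.1 m := by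
  have h := (partialD_pow_mem_posPart (p := p) (m := 0) m (by simpa using hf)).2
  simpa [Nat.descFactorial_self] using h

theorem coeff_partialD_pow_invT (i : ℕ) :
    (∀ n : ℤ, 0 ≤ n ∨ n < -1 - i → ((partialD p L ^ i) (invT L)).1 n = 0) ∧
      ((partialD p L ^ i) (invT L)).1 (-1 - i) = (-1) ^ i * (i.factorial : ℕ) := by
  induction i with
  | zero =>
    refine ⟨fun n hn => ?_, ?_⟩
    · exact Pi.single_eq_of_ne (by push_cast at hn; omega) _
    · simp [invT]
  | succ i ih =>
    obtain ⟨h1, h2⟩ := ih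
    refine ⟨fun n hn => ?_, ?_⟩
    · rw [partialD_pow_succ_apply, coeff_partialD, h1 n (by push_cast at hn; omega), mul_zero,
        zero_add]
      rcases eq_or_ne n (-1) with rfl | hne
      · simp
      · rw [h1 (n + 1) (by push_cast at hn; omega), mul_zero]
    · rw [partialD_pow_succ_apply, coeff_partialD, h1 _ (by push_cast; omega), mul_zero, zero_add,
        show (-1 - ((i + 1 : ℕ) : ℤ) + 1) = -1 - i by push_cast; ring, h2, Nat.factorial_succ]
      push_cast
      ring

theorem norm_coeff_partialD_pow_invT_le [IsUltrametricDist L] (i : ℕ) (n : ℤ) :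
    ‖((partialD p L ^ i) (invT L)).1 n‖ ≤ 1 := by
  induction i generalizing n with
  | zero =>
    rcases eq_or_ne n (-1) with rfl | h
    · simp [invT]
    · simp [invT, Pi.single_eq_of_ne h]
  | succ i ih =>
    rw [partialD_pow_succ_apply, coeff_partialD]
    refine (IsUltrametricDist.norm_add_le_max _ _).trans (max_le ?_ ?_)
    · rw [norm_mul]
      exact mul_le_one₀ (IsUltrametricDist.norm_intCast_le_one L _) (norm_nonneg _) (ih _)
    · rw [norm_mul]
      exact mul_le_one₀ (IsUltrametricDist.norm_intCast_le_one L _) (norm_nonneg _) (ih _)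

/-! ## Coboundaries -/

section

variable [FiniteDimensional ℚ_[p] L]

variable (p) in
/-- The sum of the images of `d φ - 1` and `c γ - 1`. -/
def coboundaries (d c : L) (g : ℤ_[p]ˣ) : Submodule L (RobbaRing L) :=
  LinearMap.range (d • phi p L - LinearMap.id) ⊔ LinearMap.range (c • gamma L g - LinearMap.id)

theorem range_d₂ (δ : ℚ_[p]ˣ →* Lˣ) (g : ℤ_[p]ˣ) : LinearMap.range (d₂ δ g) =
    coboundaries p (δ (pUnit p) : L) (δ (unitIncl g) : L) g := by
  rw [d₂, LinearMap.range_coprod, LinearMap.range_neg]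
  rfl

variable {d c : L} {g : ℤ_[p]ˣ}

theorem smul_phi_sub_mem (f : RobbaRing L) : d • phi p L f - f ∈ coboundaries p d c g :=
  Submodule.mem_sup_left ⟨f, rfl⟩

theorem smul_gamma_sub_mem (f : RobbaRing L) : c • gamma L g f - f ∈ coboundaries p d c g :=
  Submodule.mem_sup_right ⟨f, rfl⟩

/-- Permits replacing γ by γ^(p-1), which is 1 modulo p. -/
theorem pow_smul_gamma_pow_sub_mem [IsUltrametricDist L] [CompleteSpace L] (n : ℕ) (f : RobbaRing L) :
    c ^ (n + 1) • gamma L (g ^ (n + 1)) f - f ∈ coboundaries p d c g := by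
  induction n with
  | zero => simpa using smul_gamma_sub_mem f
  | succ n ih =>
    have h := add_mem (smul_gamma_sub_mem (d := d) (c := c) (g := g)
      (c ^ (n + 1) • gamma L (g ^ (n + 1)) f)) ih
    rw [map_smul, sub_add_sub_cancel, smul_smul, ← gamma_mul_apply, ← pow_succ', ← pow_succ'] at h
    exact h

end

end

section

variable {p : ℕ} [Fact p.Prime] {L : Type*} [NormedField L] [NormedAlgebra ℚ_[p] L]

/-! ## The constant coefficient of `(γ - 1) f` -/

theorem norm_natCast_eq_one (p : ℕ) [Fact p.Prime] (L : Type*) [NormedField L]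
    [NormedAlgebra ℚ_[p] L] {n : ℕ} (h : ¬p ∣ n) : ‖(n : L)‖ = 1 := by
  rw [← map_natCast (intIncl p L), norm_intIncl]
  refine le_antisymm (PadicInt.norm_le_one _) (not_lt.mp fun hlt => h ?_)
  have := PadicInt.norm_int_lt_one_iff_dvd (p := p) (n : ℤ)
  rw [Int.cast_natCast] at this
  exact_mod_cast this.mp hlt

theorem norm_bin_prime_mul_le (u : ℤ_[p]) {j : ℕ} (h1 : j ≠ 0) (h2 : j < p) :
    ‖bin L ((p : ℤ_[p]) * u) j‖ ≤ (p : ℝ)⁻¹ := by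
  obtain ⟨i, rfl⟩ := Nat.exists_eq_succ_of_ne_zero h1
  have h := congrArg norm (bin_succ_eq (L := L) ((p : ℤ_[p]) * u) i)
  have hn : ‖((i : L) + 1)‖ = 1 := by
    rw [← Nat.cast_succ]
    exact norm_natCast_eq_one p L fun hd => absurd (Nat.le_of_dvd (Nat.succ_pos i) hd) (by omega)
  rw [norm_mul, hn, one_mul, norm_mul, map_mul, norm_mul, map_natCast, norm_prime p L] at h
  rw [h, mul_assoc]
  exact mul_le_of_le_one_right (by positivity)
    (mul_le_one₀ (norm_intIncl_le_one _) (norm_nonneg _) (norm_bin_le_one _ _))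

variable [IsUltrametricDist L]

theorem norm_add_eq_one {a b : L} (ha : ‖a‖ = 1) (hb : ‖b‖ < 1) : ‖a + b‖ = 1 := by
  rw [IsUltrametricDist.norm_add_eq_max_of_norm_ne_norm (by rw [ha]; exact hb.ne'), ha,
    max_eq_left hb.le]

theorem inv_prime_lt_one (p : ℕ) [Fact p.Prime] : (p : ℝ)⁻¹ < 1 :=
  inv_lt_one_of_one_lt₀ (by exact_mod_cast (Fact.out (p := p.Prime)).one_lt)

/-- Pascal's rule and `norm_bin_prime_mul_le` give the congruence (pu - 1 choose j) ≡ (-1)^j modulo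
p. -/
theorem norm_bin_prime_mul_sub_one (u : ℤ_[p]) {j : ℕ} (h : j < p) :
    ‖bin L ((p : ℤ_[p]) * u - 1) j‖ = 1 := by
  induction j with
  | zero => simp
  | succ j ih =>
    have h1 := bin_succ_succ (L := L) ((p : ℤ_[p]) * u - 1) j
    rw [sub_add_cancel] at h1
    have h2 : bin L ((p : ℤ_[p]) * u - 1) (j + 1) =
        -bin L ((p : ℤ_[p]) * u - 1) j + bin L ((p : ℤ_[p]) * u) (j + 1) := by rw [h1]; ring
    rw [h2]
    exact norm_add_eq_one (by rw [norm_neg, ih (by omega)])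
      ((norm_bin_prime_mul_le u (by omega) h).trans_lt (inv_prime_lt_one p))

/-- (1 + pu choose p) is (pu choose p) + (pu choose p-1). The second term is divisible by p; the
first is u (pu - 1 choose p-1), a unit. -/
theorem norm_bin_prime {u : ℤ_[p]} (hu : IsUnit u) : ‖bin L (1 + (p : ℤ_[p]) * u) p‖ = 1 := by
  have hp := Fact.out (p := p.Prime)
  obtain ⟨q, hq⟩ : ∃ q, p = q + 1 := ⟨p - 1, by have := hp.pos; omega⟩
  have h1 : bin L (1 + (p : ℤ_[p]) * u) p = bin L ((p : ℤ_[p]) * u) p + bin L ((p : ℤ_[p]) * u) q := by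
    have h := bin_succ_succ (L := L) ((p : ℤ_[p]) * u) q
    rw [← hq] at h
    rw [add_comm, h, add_comm]
  have h2 := bin_succ_eq (L := L) ((p : ℤ_[p]) * u) q
  rw [← hq, ← Nat.cast_succ, Nat.succ_eq_add_one, ← hq, map_mul, map_natCast, mul_assoc] at h2
  have hp0 : (p : L) ≠ 0 := by
    rw [← norm_ne_zero_iff, norm_prime p L]
    have := hp.pos
    positivity
  have h3 := mul_left_cancel₀ hp0 h2
  rw [h1]
  refine norm_add_eq_one ?_ ((norm_bin_prime_mul_le u ?_ (by omega)).trans_lt (inv_prime_lt_one p))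
  · rw [h3, norm_mul, norm_intIncl, PadicInt.isUnit_iff.mp hu, one_mul,
      norm_bin_prime_mul_sub_one u (by omega)]
  · have := hp.two_le
    omega

/-- `A ≡ a T ^ q` modulo `T ^ (q + 1)` and elements of absolute value `≤ ε`. -/
structure NearMonomial (q : ℕ) (ε : ℝ) (A : PowerSeries L) (a : L) : Prop where
  le_one : ∀ n, ‖PowerSeries.coeff n A‖ ≤ 1
  le_of_lt : ∀ n < q, ‖PowerSeries.coeff n A‖ ≤ ε
  sub_le : ‖PowerSeries.coeff q A - a‖ ≤ ε

section

variable {q : ℕ} {ε : ℝ} {A B : PowerSeries L} {a b : L}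

omit [Fact p.Prime] [NormedAlgebra ℚ_[p] L] in
theorem norm_coeff_mul_le_of_forall {C : ℝ} (hC : 0 ≤ C) {n : ℕ}
    (h : ∀ i j, i + j = n → ‖PowerSeries.coeff i A‖ * ‖PowerSeries.coeff j B‖ ≤ C) :
    ‖PowerSeries.coeff n (A * B)‖ ≤ C := by
  rw [PowerSeries.coeff_mul]
  refine IsUltrametricDist.norm_sum_le_of_forall_le_of_nonneg hC fun x hx => ?_
  rw [norm_mul]
  exact h _ _ (Finset.HasAntidiagonal.mem_antidiagonal.mp hx)

omit [Fact p.Prime] [NormedAlgebra ℚ_[p] L] in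
theorem norm_coeff_mul_le_of_lt (hA : ∀ n, ‖PowerSeries.coeff n A‖ ≤ 1)
    (hB : ∀ n, ‖PowerSeries.coeff n B‖ ≤ 1) (hA' : ∀ n < q, ‖PowerSeries.coeff n A‖ ≤ ε)
    (hB' : ∀ n < q, ‖PowerSeries.coeff n B‖ ≤ ε) (hq : 0 < q) {n : ℕ} (hn : n ≤ q) :
    ‖PowerSeries.coeff n (A * B)‖ ≤ ε := by
  have hε : 0 ≤ ε := (norm_nonneg _).trans (hA' 0 hq)
  refine norm_coeff_mul_le_of_forall hε fun i j hij => ?_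
  rcases lt_or_ge i q with hi | hi
  · exact (mul_le_of_le_one_right (norm_nonneg _) (hB j)).trans (hA' i hi)
  · exact (mul_le_of_le_one_left (norm_nonneg _) (hA i)).trans (hB' j (by omega))

-- The cross term A * B is negligible up to degree q, so products of series 1 + aT^q + ... add the
-- coefficients a.
omit [Fact p.Prime] [NormedAlgebra ℚ_[p] L] in
theorem NearMonomial.mul (hq : 0 < q) (hA : NearMonomial q ε A a) (hB : NearMonomial q ε B b) :
    NearMonomial q ε ((1 + A) * (1 + B) - 1) (a + b) := by
  have e : (1 + A) * (1 + B) - 1 = A + B + A * B := by ring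
  have h : ∀ n ≤ q, ‖PowerSeries.coeff n (A * B)‖ ≤ ε := fun n hn =>
    norm_coeff_mul_le_of_lt hA.1 hB.1 hA.2 hB.2 hq hn
  rw [e]
  refine ⟨fun n => ?_, fun n hn => ?_, ?_⟩
  · rw [map_add, map_add]
    refine (IsUltrametricDist.norm_add_le_max _ _).trans (max_le
      ((IsUltrametricDist.norm_add_le_max _ _).trans (max_le (hA.1 n) (hB.1 n))) ?_)
    exact norm_coeff_mul_le_of_forall zero_le_one fun i j _ =>
      mul_le_one₀ (hA.1 i) (norm_nonneg _) (hB.1 j)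
  · rw [map_add, map_add]
    exact (IsUltrametricDist.norm_add_le_max _ _).trans (max_le
      ((IsUltrametricDist.norm_add_le_max _ _).trans (max_le (hA.2 n hn) (hB.2 n hn))) (h n hn.le))
  · rw [map_add, map_add]
    rw [show PowerSeries.coeff q A + PowerSeries.coeff q B + PowerSeries.coeff q (A * B) - (a + b) =
      (PowerSeries.coeff q A - a) + (PowerSeries.coeff q B - b) + PowerSeries.coeff q (A * B) by ring]
    exact (IsUltrametricDist.norm_add_le_max _ _).trans (max_le
      ((IsUltrametricDist.norm_add_le_max _ _).trans (max_le hA.3 hB.3)) (h q le_rfl))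

omit [Fact p.Prime] [NormedAlgebra ℚ_[p] L] in
theorem NearMonomial.pow (hq : 0 < q) (hε : 0 ≤ ε) (hA : NearMonomial q ε A a) (k : ℕ) :
    NearMonomial q ε ((1 + A) ^ k - 1) (k * a) := by
  induction k with
  | zero => simpa using ⟨fun n => by simp, fun n _ => by simpa using hε, by simpa using hε⟩
  | succ k ih =>
    have h := ih.mul hq hA
    rw [add_sub_cancel, ← pow_succ] at h
    rwa [Nat.cast_succ, add_mul, one_mul]

omit [Fact p.Prime] [NormedAlgebra ℚ_[p] L] in
theorem NearMonomial.inv (hq : 0 < q) (hA : NearMonomial q ε A a)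
    (hB : ∀ n, ‖PowerSeries.coeff n B‖ ≤ 1) (hBA : B * (1 + A) = 1) :
    (∀ n, 0 < n → n < q → ‖PowerSeries.coeff n B‖ ≤ ε) ∧ ‖PowerSeries.coeff q B + a‖ ≤ ε := by
  have hε0 : 0 ≤ ε := (norm_nonneg _).trans (hA.2 0 hq)
  have e1 : B - 1 = -(B * A) := by linear_combination hBA
  have h1 : ∀ n, ‖PowerSeries.coeff n (B - 1)‖ ≤ 1 := by
    intro n
    rw [e1, map_neg, norm_neg]
    exact norm_coeff_mul_le_of_forall zero_le_one fun i j _ =>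
      mul_le_one₀ (hB i) (norm_nonneg _) (hA.1 j)
  have h2 : ∀ n < q, ‖PowerSeries.coeff n (B - 1)‖ ≤ ε := by
    intro n hn
    rw [e1, map_neg, norm_neg]
    exact norm_coeff_mul_le_of_forall hε0 fun i j hij =>
      (mul_le_of_le_one_left (norm_nonneg _) (hB i)).trans (hA.2 j (by omega))
  have h3 : ∀ n, 0 < n → PowerSeries.coeff n (B - 1) = PowerSeries.coeff n B := by
    intro n hn
    rw [map_sub, PowerSeries.coeff_one, if_neg hn.ne', sub_zero]
  refine ⟨fun n hn0 hn => h3 n hn0 ▸ h2 n hn, ?_⟩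
  have e2 : B - 1 = -A + -((B - 1) * A) := by linear_combination hBA
  rw [← h3 q hq, e2, map_add, map_neg, map_neg,
    show -PowerSeries.coeff q A + -PowerSeries.coeff q ((B - 1) * A) + a =
      -((PowerSeries.coeff q A - a) + PowerSeries.coeff q ((B - 1) * A)) by ring, norm_neg]
  exact (IsUltrametricDist.norm_add_le_max _ _).trans (max_le hA.3
    (norm_coeff_mul_le_of_lt h1 hA.1 h2 hA.2 hq le_rfl))

end

section

variable {g : ℤ_[p]ˣ} {u : ℤ_[p]}

/-- γ(T)/T ≡ 1 + aT^(p-1) modulo p and T^p, because (1 + pu choose j) is divisible by p for 2 ≤ j <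
p. -/
theorem nearMonomial_gammaUnit (hg : (g : ℤ_[p]) = 1 + p * u) :
    NearMonomial (p - 1) (p : ℝ)⁻¹ ((gammaUnit L g : PowerSeries L) - 1)
      (bin L (1 + (p : ℤ_[p]) * u) p) := by
  have hp := (Fact.out (p := p.Prime)).two_le
  have hpi := (inv_prime_lt_one p).le
  have hp0 : (0 : ℝ) ≤ (p : ℝ)⁻¹ := by positivity
  have key : ∀ n, PowerSeries.coeff (n + 1) ((gammaUnit L g : PowerSeries L) - 1) =
      bin L (1 + (p : ℤ_[p]) * u) (n + 2) := by
    intro n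
    rw [map_sub, coeff_gammaUnit, PowerSeries.coeff_one, if_neg (by omega), sub_zero, hg]
  have key0 : PowerSeries.coeff 0 ((gammaUnit L g : PowerSeries L) - 1) = p * intIncl p L u := by
    rw [map_sub, coeff_gammaUnit, hg]
    simp
  have h0 : ‖PowerSeries.coeff 0 ((gammaUnit L g : PowerSeries L) - 1)‖ ≤ (p : ℝ)⁻¹ := by
    rw [key0, norm_mul, norm_prime p L]
    exact mul_le_of_le_one_right hp0 (norm_intIncl_le_one _)
  refine ⟨fun n => ?_, fun n hn => ?_, ?_⟩
  · cases n with
    | zero => exact h0.trans hpi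
    | succ n => rw [key]; exact norm_bin_le_one _ _
  · cases n with
    | zero => exact h0
    | succ n =>
      rw [key, add_comm, bin_succ_succ]
      exact (IsUltrametricDist.norm_add_le_max _ _).trans (max_le
        (norm_bin_prime_mul_le u (by omega) (by omega))
        (norm_bin_prime_mul_le u (by omega) (by omega)))
  · obtain ⟨n, hn⟩ : ∃ n, p - 1 = n + 1 := ⟨p - 2, by omega⟩
    have hn' : n + 2 = p := by omega
    rw [hn, key, hn', sub_self, norm_zero]
    exact hp0

/-- The constant coefficient of γ(T)^(-k) is the T^k-coefficient of (γ(T)/T)^(-k) ≡ 1 - kaT^(p-1),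
where a is a unit. -/
theorem norm_gammaCoeff_neg (hg : (g : ℤ_[p]) = 1 + p * u) (hu : IsUnit u) :
    (∀ k : ℕ, 0 < k → k < p - 1 → ‖gammaCoeff L g (-k) 0‖ ≤ (p : ℝ)⁻¹) ∧
      ‖gammaCoeff L g (-(p - 1 : ℕ)) 0‖ = 1 := by
  have hp := (Fact.out (p := p.Prime)).two_le
  have hpi := inv_prime_lt_one p
  have hp0 : (0 : ℝ) ≤ (p : ℝ)⁻¹ := by positivity
  have hB : ∀ (k : ℕ) (n : ℕ), ‖PowerSeries.coeff n
      ((gammaUnit L g ^ (-k : ℤ) : (PowerSeries L)ˣ) : PowerSeries L)‖ ≤ 1 := fun k n => by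
    rw [← gammaCoeff_add]; exact norm_gammaCoeff_le_one _ _ _
  have hcoeff : ∀ k : ℕ, gammaCoeff L g (-k) 0 = PowerSeries.coeff k
      ((gammaUnit L g ^ (-k : ℤ) : (PowerSeries L)ˣ) : PowerSeries L) := fun k => by
    rw [← gammaCoeff_add, neg_add_cancel]
  have key := fun k : ℕ => ((nearMonomial_gammaUnit (L := L) hg).pow (by omega) hp0 k).inv
    (B := ((gammaUnit L g ^ (-k : ℤ) : (PowerSeries L)ˣ) : PowerSeries L)) (by omega) (hB k)
    (by rw [add_sub_cancel, add_sub_cancel, ← Units.val_pow_eq_pow_val, ← Units.val_mul,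
          zpow_neg, zpow_natCast, inv_mul_cancel, Units.val_one])
  refine ⟨fun k h0 h1 => ?_, ?_⟩
  · rw [hcoeff]
    exact (key k).1 k h0 h1
  · rw [hcoeff]
    set a := bin L (1 + (p : ℤ_[p]) * u) p with ha
    have h1 := (key (p - 1)).2
    set b := PowerSeries.coeff (p - 1)
      ((gammaUnit L g ^ (-(p - 1 : ℕ) : ℤ) : (PowerSeries L)ˣ) : PowerSeries L)
    have h2 : ‖-(((p - 1 : ℕ) : L) * a)‖ = 1 := by
      rw [norm_neg, norm_mul, ha, norm_bin_prime hu, mul_one]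
      exact norm_natCast_eq_one p L fun hd => absurd (Nat.le_of_dvd (by omega) hd) (by omega)
    have h3 := norm_add_eq_one h2 (h1.trans_lt hpi)
    rwa [show -(((p - 1 : ℕ) : L) * a) + (b + ((p - 1 : ℕ) : L) * a) = b by ring] at h3

variable [CompleteSpace L] [FiniteDimensional ℚ_[p] L]

omit [IsUltrametricDist L] [CompleteSpace L] in
theorem coeff_gamma_sub_of_mem {f : RobbaRing L} (hf : f ∈ posPart L 0) :
    (gamma L g f - f).1 0 = 0 := by
  have h := coeff_gamma_self g hf
  rw [zpow_zero, one_mul] at h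
  exact sub_eq_zero.mpr h

omit [CompleteSpace L] in
theorem norm_coeff_gamma_sub_le {f : RobbaRing L} (hf : ∀ n : ℕ, f.1 n = 0) {ε : ℝ}
    (h : ∀ n, ‖f.1 n‖ ≤ ε) : ‖(gamma L g f - f).1 0‖ ≤ ε := by
  have h0 : f.1 0 = 0 := hf 0
  have e : (gamma L g f - f).1 0 = (gamma L g f).1 0 - f.1 0 := rfl
  rw [e, h0, sub_zero, coeff_gamma]
  refine IsUltrametricDist.norm_tsum_le_of_forall_le_of_nonneg ((norm_nonneg _).trans (h 0))
    fun k => ?_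
  rw [norm_mul]
  exact (mul_le_of_le_one_right (norm_nonneg _) (norm_gammaCoeff_le_one _ _ _)).trans (h k)

/-- ∂^(p-2)(1/T) has a pole of order p - 1 with leading coefficient ±(p-2)!, a p-adic unit. By
`norm_gammaCoeff_neg` only this leading term contributes to the constant coefficient modulo p. -/
theorem norm_coeff_gamma_sub_partialD_pow_invT (hp2 : p ≠ 2) (hg : (g : ℤ_[p]) = 1 + p * u)
    (hu : IsUnit u) : ‖(gamma L g ((partialD p L ^ (p - 2)) (invT L)) -
      (partialD p L ^ (p - 2)) (invT L)).1 0‖ = 1 := by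
  have hp := (Fact.out (p := p.Prime))
  have hp3 : 3 ≤ p := lt_of_le_of_ne hp.two_le (Ne.symm hp2)
  set e := (partialD p L ^ (p - 2)) (invT L) with he
  obtain ⟨h1, h2⟩ := coeff_partialD_pow_invT (p := p) (L := L) (p - 2)
  rw [← he] at h1 h2
  have e0 : (gamma L g e - e).1 0 = (gamma L g e).1 0 - e.1 0 := rfl
  have e1 : (-1 - ((p - 2 : ℕ) : ℤ)) = -((p - 1 : ℕ) : ℤ) := by omega
  rw [e1] at h1 h2
  obtain ⟨k1, k2⟩ := norm_gammaCoeff_neg (L := L) hg hu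
  rw [e0, h1 0 (Or.inl le_rfl), sub_zero, coeff_gamma,
    ((substitutable_gamma L g).summable e.2 0).tsum_eq_add_tsum_ite (-((p - 1 : ℕ) : ℤ))]
  refine norm_add_eq_one ?_ (lt_of_le_of_lt (IsUltrametricDist.norm_tsum_le_of_forall_le_of_nonneg
    (C := (p : ℝ)⁻¹) (by positivity) fun k => ?_) (inv_prime_lt_one p))
  · rw [norm_mul, k2, h2, mul_one, norm_mul, norm_pow, norm_neg, norm_one, one_pow, one_mul]
    refine norm_natCast_eq_one p L fun hd => ?_
    have := (hp.dvd_factorial).mp hd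
    omega
  · split_ifs with hk
    · rw [norm_zero]; positivity
    · by_cases hk' : 0 ≤ k ∨ k < -((p - 1 : ℕ) : ℤ)
      · rw [h1 k hk', zero_mul, norm_zero]; positivity
      · obtain ⟨j, rfl⟩ : ∃ j : ℕ, k = -j := ⟨(-k).toNat, by omega⟩
        rw [norm_mul]
        exact (mul_le_of_le_one_left (norm_nonneg _) (norm_coeff_partialD_pow_invT_le _ _)).trans
          (k1 j (by omega) (by omega))

/-- f is a lift of 1/x on ℤ_pˣ. Since x^(p-2) ≡ 1/x modulo p on units and p - 2 is odd, f is
-∂^(p-2)(1/T) up to R⁺, which does not affect the constant coefficient of (γ - 1)f, and up to a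
series divisible by p. -/
theorem coeff_gamma_sub_ne_zero (hp2 : p ≠ 2) (hg : (g : ℤ_[p]) = 1 + p * u) (hu : IsUnit u)
    {f : RobbaRing L} (hf1 : ∀ x : ℤ_[p], IsUnit x → intIncl p L x * amiceFun f x = 1)
    (hf0 : ∀ x : ℤ_[p], ¬IsUnit x → amiceFun f x = 0) : (gamma L g f - f).1 0 ≠ 0 := by
  have hp := (Fact.out (p := p.Prime))
  have hp3 : 3 ≤ p := lt_of_le_of_ne hp.two_le (Ne.symm hp2)
  have hpi := inv_prime_lt_one p
  set e := (partialD p L ^ (p - 2)) (invT L) with he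
  -- D is the polar lift of the function of f + e. Its coefficients are bounded by 1/p because its
  -- function is, and f + e - D lies in R⁺.
  obtain ⟨D, hD, hD0⟩ := exists_amiceFun_eq (LocAnalytic.amiceFun (p := p) (f + e))
  have hbound : ∀ x : ℤ_[p], ‖amiceFun D x‖ ≤ (p : ℝ)⁻¹ := by
    intro x
    rw [hD, amiceFun_add, he, amiceFun_partialD_pow_invT]
    by_cases hx : IsUnit x
    · obtain ⟨y, hy⟩ := exists_pow_eq hx.unit
      rw [IsUnit.unit_spec] at hy
      have hnx : ‖intIncl p L x‖ = 1 := by rw [norm_intIncl, PadicInt.isUnit_iff.mp hx]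
      have hodd : Odd (p - 2) := by
        rcases hp.eq_two_or_odd' with h | h
        · exact absurd h hp2
        · exact Nat.Odd.sub_even (by omega) h even_two
      have hy' := congrArg (intIncl p L) hy
      rw [map_pow, map_add, map_one, map_mul, map_natCast] at hy'
      have e2 : intIncl p L x * (amiceFun f x + (-intIncl p L x) ^ (p - 2)) =
          -((p : L) * intIncl p L y) := by
        rw [hodd.neg_pow, mul_add, hf1 x hx, mul_neg, ← pow_succ',
          show p - 2 + 1 = p - 1 by omega, hy']
        ring
      have e3 := congrArg norm e2
      rw [norm_mul, hnx, one_mul, norm_neg, norm_mul, norm_prime p L] at e3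
      rw [e3]
      exact mul_le_of_le_one_right (by positivity) (norm_intIncl_le_one _)
    · rw [hf0 x hx, zero_add, norm_pow, norm_neg]
      obtain ⟨y, rfl⟩ := exists_eq_mul_of_not_isUnit hx
      have h1 : ‖intIncl p L ((p : ℤ_[p]) * y)‖ ≤ (p : ℝ)⁻¹ := by
        rw [map_mul, norm_mul, map_natCast, norm_prime p L]
        exact mul_le_of_le_one_right (by positivity) (norm_intIncl_le_one _)
      refine (pow_le_of_le_one (norm_nonneg _) (h1.trans hpi.le) (by omega)).trans h1
  have hDn : ∀ n, ‖D.1 n‖ ≤ (p : ℝ)⁻¹ := by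
    intro n
    rcases lt_or_ge n 0 with hn | hn
    · obtain ⟨j, rfl⟩ : ∃ j : ℕ, n = -1 - j := ⟨(-1 - n).toNat, by omega⟩
      exact norm_coeff_le_of_amiceFun hbound j
    · obtain ⟨j, rfl⟩ := Int.eq_ofNat_of_zero_le hn
      rw [hD0, norm_zero]
      positivity
  have hR : f + e - D ∈ posPart L 0 := mem_posPart_of_amiceFun_eq_zero (p := p) fun x => by
    rw [amiceFun_sub, hD, sub_self]
  have h1 := norm_coeff_gamma_sub_le (g := g) hD0 hDn
  have h2 := norm_coeff_gamma_sub_partialD_pow_invT (L := L) hp2 hg hu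
  rw [← he] at h2
  have h3 := coeff_gamma_sub_of_mem (g := g) hR
  have h4 : (gamma L g f - f).1 0 = (gamma L g (f + e - D) - (f + e - D)).1 0 -
      (gamma L g e - e).1 0 + (gamma L g D - D).1 0 := by
    have h5 : gamma L g f - f = (gamma L g (f + e - D) - (f + e - D)) -
      (gamma L g e - e) + (gamma L g D - D) := by
      rw [map_sub, map_add]; abel
    rw [h5]; rfl
  rw [h4, h3, zero_sub, ← norm_ne_zero_iff,
    norm_add_eq_one (by rw [norm_neg, h2]) (h1.trans_lt hpi)]
  exact one_ne_zero

end

end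

section

variable {p : ℕ} [Fact p.Prime] {L : Type*} [NormedField L] [NormedAlgebra ℚ_[p] L]

/-! ## The positive part consists of coboundaries -/

theorem posPart_le_of_exists {H : Submodule L (RobbaRing L)} {m : ℕ}
    (h1 : posPart L ((m + 1 : ℕ) : ℤ) ≤ H) {h : RobbaRing L} (hH : h ∈ H) (hm : h ∈ posPart L m)
    (h0 : h.1 m ≠ 0) : posPart L m ≤ H := by
  intro f hf
  have h2 : f - (f.1 m / h.1 m) • h ∈ posPart L ((m + 1 : ℕ) : ℤ) := by
    intro n hn
    have e : (f - (f.1 m / h.1 m) • h).1 n = f.1 n - f.1 m / h.1 m * h.1 n := rfl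
    rw [e]
    rcases eq_or_ne n m with rfl | hne
    · rw [div_mul_cancel₀ _ h0, sub_self]
    · have hn' : n < m := by push_cast at hn; omega
      rw [hf n hn', hm n hn', mul_zero, sub_zero]
  have h3 := add_mem (h1 h2) (H.smul_mem (f.1 m / h.1 m) hH)
  rwa [sub_add_cancel] at h3

variable [FiniteDimensional ℚ_[p] L]

/-- A cochain can be changed by an element of the positive part so that its image under `c γ - 1`
has a zero of order at least `m`. -/
theorem exists_add_mem_posPart {c : L} {g : ℤ_[p]ˣ} {m : ℕ}
    (hc : ∀ n < m, c * intIncl p L g ^ n ≠ 1) {f : RobbaRing L}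
    (hf : c • gamma L g f - f ∈ posPart L 0) :
    ∃ w ∈ posPart L 0, c • gamma L g (f + w) - (f + w) ∈ posPart L m := by
  induction m with
  | zero => exact ⟨0, zero_mem _, by simpa using hf⟩
  | succ m ih =>
    obtain ⟨w, hw, h⟩ := ih fun n hn => hc n (hn.trans (Nat.lt_succ_self m))
    set h0 := c • gamma L g (f + w) - (f + w) with hh0
    have hne : c * intIncl p L g ^ m - 1 ≠ 0 := sub_ne_zero.mpr (hc m (Nat.lt_succ_self m))
    -- cγ - 1 multiplies the leading coefficient of T^m by c χ(γ)^m - 1, so this multiple of T^m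
    -- cancels the coefficient of h0.
    set a : L := -(h0.1 m / (c * intIncl p L g ^ m - 1)) with ha
    refine ⟨w + a • monomialT L m, add_mem hw (Submodule.smul_mem _ _
      (posPart_mono (by omega) (monomialT_mem m))), fun n hn => ?_⟩
    have e1 : c • gamma L g (f + (w + a • monomialT L m)) - (f + (w + a • monomialT L m)) =
        h0 + a • (c • gamma L g (monomialT L m) - monomialT L m) := by
      rw [hh0, ← add_assoc, map_add, map_smul, smul_add, smul_sub, smul_comm c a]
      abel
    have e2 : (h0 + a • (c • gamma L g (monomialT L m) - monomialT L m)).1 n =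
        h0.1 n + a * (c * (gamma L g (monomialT L m)).1 n - (monomialT L m).1 n) := rfl
    rw [e1, e2]
    rcases eq_or_ne n m with rfl | hnm
    · rw [coeff_gamma_self g (monomialT_mem m), monomialT_self, mul_one, zpow_natCast, ha, neg_mul,
        div_mul_cancel₀ _ hne, add_neg_cancel]
    · have hn' : n < m := by push_cast at hn; omega
      rw [h n hn', gamma_mem_posPart g (monomialT_mem m) n hn', monomialT_mem m n hn']
      ring

variable [IsUltrametricDist L] [CompleteSpace L]

omit [FiniteDimensional ℚ_[p] L] [IsUltrametricDist L] [CompleteSpace L] in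
theorem intIncl_pow_ne_one {g : ℤ_[p]ˣ} (h : ∀ n : ℕ, n ≠ 0 → g ^ n ≠ 1) {n : ℕ} (hn : n ≠ 0) :
    intIncl p L g ^ n ≠ 1 := by
  intro h1
  rw [← map_pow, ← map_one (intIncl p L), (intIncl_injective).eq_iff, ← Units.val_pow_eq_pow_val,
    Units.val_eq_one] at h1
  exact h n hn h1

/-- The case in which the monomial `T ^ m` is of no use. -/
theorem exists_coboundary_of_eq (hp2 : p ≠ 2) {g : ℤ_[p]ˣ}
    (hg : (Subgroup.zpowers g).topologicalClosure = ⊤) (d : L) {c : L} {m : ℕ}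
    (hc : c * intIncl p L g ^ m = 1) :
    ∃ h ∈ coboundaries p d c g, h ∈ posPart L m ∧ h.1 m ≠ 0 := by
  have hp := Fact.out (p := p.Prime)
  obtain ⟨u, hu, hgu⟩ := exists_isUnit_pow_eq hg
  obtain ⟨q, hq⟩ : ∃ q, p - 1 = q + 1 := ⟨p - 2, by have := hp.two_le; omega⟩
  rw [hq] at hgu
  set g₁ := g ^ (q + 1) with hg₁
  set c₁ := c ^ (q + 1) with hc₁
  have hg₁u : (g₁ : ℤ_[p]) = 1 + p * u := by rw [hg₁, Units.val_pow_eq_pow_val, hgu]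
  have hx0 := intIncl_unit_ne_zero L g₁
  have hc₁' : c₁ * intIncl p L g₁ ^ m = 1 := by
    rw [hc₁, hg₁, Units.val_pow_eq_pow_val, map_pow, ← pow_mul, mul_comm (q + 1) m, pow_mul,
      ← mul_pow, hc, one_pow]
  have hinf : ∀ n : ℕ, n ≠ 0 → g₁ ^ n ≠ 1 := fun n hn => by
    rw [hg₁, ← pow_mul]
    exact pow_ne_one_of_generator hg (Nat.mul_ne_zero (Nat.succ_ne_zero q) hn)
  -- With c₁ χ(g₁)^m = 1, the function x^(-m-1) on units is fixed by the operator induced by c₁ γ₁,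
  -- so a lift f is sent by c₁ γ₁ - 1 into R⁺.
  obtain ⟨G, hG, hG1, hG0⟩ := exists_locAnalytic_inv_pow p L (m + 1)
  obtain ⟨f, hf, -⟩ := exists_amiceFun_eq hG
  have hpos : c₁ • gamma L g₁ f - f ∈ posPart L 0 :=
      mem_posPart_of_amiceFun_eq_zero (p := p) fun x => by
    rw [amiceFun_sub, amiceFun_smul, amiceFun_gamma, hf, hf]
    by_cases hx : IsUnit x
    · have h1 := hG1 x hx
      have h2 := hG1 _ ((g₁⁻¹).isUnit.mul hx)
      have e : intIncl p L x = intIncl p L g₁ * intIncl p L (↑g₁⁻¹ * x) := by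
        rw [← map_mul, Units.mul_inv_cancel_left]
      have hx0' : intIncl p L x ≠ 0 := by
        intro h; rw [h] at h1; simp at h1
      have hy0 : intIncl p L (↑g₁⁻¹ * x) ≠ 0 := right_ne_zero_of_mul (e ▸ hx0')
      rw [eq_inv_of_mul_eq_one_right h1, eq_inv_of_mul_eq_one_right h2, e,
        eq_inv_of_mul_eq_one_left hc₁', mul_pow]
      field_simp
      ring
    · rw [hG0 x hx, hG0 _ fun h => hx ?_]
      · simp
      · have := g₁.isUnit.mul h
        rwa [Units.mul_inv_cancel_left] at this
  have hne : ∀ n < m, c₁ * intIncl p L g₁ ^ n ≠ 1 := by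
    intro n hn h1
    have h2 : intIncl p L g₁ ^ (m - n) = 1 := by
      have h3 : c₁ * intIncl p L g₁ ^ n ≠ 0 := by rw [h1]; exact one_ne_zero
      apply mul_left_cancel₀ h3
      rw [mul_assoc, ← pow_add, show n + (m - n) = m by omega, hc₁', h1, one_mul]
    exact intIncl_pow_ne_one hinf (by omega) h2
  obtain ⟨w, hw, hm⟩ := exists_add_mem_posPart hne hpos
  · set E := f + w with hE
    refine ⟨_, pow_smul_gamma_pow_sub_mem (d := d) (c := c) (g := g) q E, hm, fun h0 => ?_⟩
    have h1 := coeff_zero_partialD_pow (p := p) hm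
    rw [h0, mul_zero] at h1
    -- ∂^m turns x^(-m-1) into (-1)^m x⁻¹ and intertwines c₁ γ₁ with γ₁, because ∂γ = χ(γ)γ∂. The
    -- T^m-coefficient becomes, up to sign and m!, the constant coefficient of (γ₁ - 1)E', which is
    -- nonzero.
    set E' := ((-1 : L) ^ m) • (partialD p L ^ m) E with hE'
    have e1 : gamma L g₁ E' - E' = ((-1 : L) ^ m) •
        (partialD p L ^ m) (c₁ • gamma L g₁ E - E) := by
      rw [hE', map_sub, map_smul, map_smul, partialD_pow_gamma, smul_smul, hc₁', one_smul, smul_sub]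
    refine coeff_gamma_sub_ne_zero hp2 hg₁u hu (f := E') (fun x hx => ?_) (fun x hx => ?_) ?_
    · rw [hE', amiceFun_smul, amiceFun_partialD_pow, hE, amiceFun_add,
        amiceFun_eq_zero_of_mem_posPart hw, add_zero, hf, neg_pow]
      refine Eq.trans ?_ (hG1 x hx)
      rw [pow_succ]
      have : (-1 : L) ^ m * (-1) ^ m = 1 := by rw [← mul_pow]; simp
      linear_combination (intIncl p L x ^ m * intIncl p L x * G x) * this
    · rw [hE', amiceFun_smul, amiceFun_partialD_pow, hE, amiceFun_add,
        amiceFun_eq_zero_of_mem_posPart hw, add_zero, hf, hG0 x hx]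
      simp
    · rw [e1]
      have e2 : (((-1 : L) ^ m) • (partialD p L ^ m) (c₁ • gamma L g₁ E - E)).1 0 =
        (-1 : L) ^ m * ((partialD p L ^ m) (c₁ • gamma L g₁ E - E)).1 0 := rfl
      rw [e2, h1, mul_zero]

theorem exists_coboundary (hp2 : p ≠ 2) {g : ℤ_[p]ˣ}
    (hg : (Subgroup.zpowers g).topologicalClosure = ⊤) (d c : L) (m : ℕ) :
    ∃ h ∈ coboundaries p d c g, h ∈ posPart L m ∧ h.1 m ≠ 0 := by
  by_cases hd : d * (p : L) ^ m = 1
  · by_cases hc : c * intIncl p L g ^ m = 1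
    · exact exists_coboundary_of_eq hp2 hg d hc
    · refine ⟨_, smul_gamma_sub_mem (monomialT L m), sub_mem (Submodule.smul_mem _ _
        (gamma_mem_posPart g (monomialT_mem m))) (monomialT_mem m), ?_⟩
      have e : (c • gamma L g (monomialT L m) - monomialT L m).1 m =
        c * (gamma L g (monomialT L m)).1 m - (monomialT L m).1 m := rfl
      rw [e, coeff_gamma_self g (monomialT_mem m), monomialT_self, mul_one, zpow_natCast]
      exact sub_ne_zero.mpr hc
  · refine ⟨_, smul_phi_sub_mem (monomialT L m), sub_mem (Submodule.smul_mem _ _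
      (phi_mem_posPart (monomialT_mem m))) (monomialT_mem m), ?_⟩
    have e : (d • phi p L (monomialT L m) - monomialT L m).1 m =
      d * (phi p L (monomialT L m)).1 m - (monomialT L m).1 m := rfl
    rw [e, coeff_phi_self (monomialT_mem m), monomialT_self, mul_one]
    exact sub_ne_zero.mpr hd

/-- Descending induction on the order of vanishing: high orders through the inverse of 1 - dφ, then
one power of T at a time through `exists_coboundary`. -/
theorem posPart_le_coboundaries (hp2 : p ≠ 2) {g : ℤ_[p]ˣ}
    (hg : (Subgroup.zpowers g).topologicalClosure = ⊤) (d c : L) :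
    posPart L 0 ≤ coboundaries p d c g := by
  obtain ⟨N, hN⟩ : ∃ N : ℕ, ‖d‖ * (p : ℝ)⁻¹ ^ N < 1 := by
    have h := (tendsto_pow_atTop_nhds_zero_of_lt_one (by positivity)
      (inv_prime_lt_one p)).const_mul ‖d‖
    rw [mul_zero] at h
    exact (h.eventually (gt_mem_nhds one_pos)).exists
  have hstart : posPart L N ≤ coboundaries p d c g := by
    intro f hf
    obtain ⟨h, hh⟩ := exists_sub_smul_phi_eq hN hf
    have := neg_mem (smul_phi_sub_mem (d := d) (c := c) (g := g) h)
    rwa [neg_sub, hh] at this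
  have hdown : ∀ j ≤ N, posPart L ((N - j : ℕ) : ℤ) ≤ coboundaries p d c g := by
    intro j
    induction j with
    | zero => exact fun _ => hstart
    | succ j ih =>
      intro hj
      obtain ⟨h, hH, hm, h0⟩ := exists_coboundary hp2 hg d c (N - (j + 1))
      refine posPart_le_of_exists ?_ hH hm h0
      rw [show N - (j + 1) + 1 = N - j by omega]
      exact ih (by omega)
  have := hdown N le_rfl
  rwa [Nat.sub_self] at this

end

section

variable {p : ℕ} [Fact p.Prime] {L : Type*} [NormedField L] [NormedAlgebra ℚ_[p] L]

/-! ## Infinite systems of linear equations -/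

section

variable [IsUltrametricDist L] [CompleteSpace L]

omit [NormedAlgebra ℚ_[p] L] [Fact p.Prime] in
theorem summable_mul_of_bounded {k a : ℕ → L} (hk : Tendsto k atTop (𝓝 0)) {D : ℝ}
    (ha : ∀ m, ‖a m‖ ≤ D) : Summable fun m => k m * a m := by
  apply NonarchimedeanAddGroup.summable_of_tendsto_cofinite_zero
  rw [Nat.cofinite_eq_atTop, tendsto_zero_iff_norm_tendsto_zero]
  have h := (tendsto_zero_iff_norm_tendsto_zero.mp hk).mul_const D
  rw [zero_mul] at h
  refine squeeze_zero (fun m => norm_nonneg _) (fun m => ?_) h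
  rw [norm_mul]
  exact mul_le_mul_of_nonneg_left (ha m) (norm_nonneg _)

omit [NormedAlgebra ℚ_[p] L] [Fact p.Prime] in
/-- A contracting infinite system of linear equations has a bounded solution. -/
theorem exists_eq_sub_tsum {K : ℕ → ℕ → L} {θ C : ℝ} (hθ0 : 0 ≤ θ) (hθ : θ < 1)
    (hK : ∀ k m, ‖K k m‖ ≤ θ) (hs : ∀ k, Tendsto (K k) atTop (𝓝 0)) {b : ℕ → L}
    (hb : ∀ k, ‖b k‖ ≤ C) :
    ∃ (a : ℕ → L) (D : ℝ), (∀ k, ‖a k‖ ≤ D) ∧ ∀ k, a k = b k - ∑' m, K k m * a m := by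
  have hsum : ∀ (a : BoundedContinuousFunction ℕ L) (k : ℕ), Summable fun m => K k m * a m :=
    fun a k => summable_mul_of_bounded (hs k) a.norm_coe_le_norm
  have hKa : ∀ (a : BoundedContinuousFunction ℕ L) (k : ℕ), ‖∑' m, K k m * a m‖ ≤ θ * ‖a‖ := by
    intro a k
    refine IsUltrametricDist.norm_tsum_le_of_forall_le_of_nonneg (by positivity) fun m => ?_
    rw [norm_mul]
    exact mul_le_mul (hK k m) (a.norm_coe_le_norm m) (norm_nonneg _) hθ0
  let T : BoundedContinuousFunction ℕ L → BoundedContinuousFunction ℕ L := fun a =>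
    BoundedContinuousFunction.ofNormedAddCommGroupDiscrete (fun k => b k - ∑' m, K k m * a m)
      (C + θ * ‖a‖) fun k => (norm_sub_le _ _).trans (add_le_add (hb k) (hKa a k))
  have hT : ∀ a k, T a k = b k - ∑' m, K k m * a m := fun a k => rfl
  have hc : ContractingWith ⟨θ, hθ0⟩ T := by
    refine ⟨hθ, LipschitzWith.of_dist_le_mul fun a a' => ?_⟩
    rw [BoundedContinuousFunction.dist_le (by positivity)]
    intro k
    rw [hT, hT, dist_eq_norm, sub_sub_sub_cancel_left, ← (hsum a' k).tsum_sub (hsum a k),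
      dist_comm, dist_eq_norm]
    simp only [← mul_sub]
    exact hKa (a' - a) k
  refine ⟨_, _, (hc.fixedPoint T).norm_coe_le_norm, fun k => ?_⟩
  rw [← hT, hc.fixedPoint_isFixedPt]

/-- Rescaling the k-th unknown by p^k, of norm p^(-k), reduces to the unweighted system. -/
theorem exists_eq_sub_tsum_of_weight {K : ℕ → ℕ → L} {θ B C : ℝ} (hθ0 : 0 ≤ θ) (hθ : θ < 1)
    (hB : ∀ k m, ‖K k m‖ ≤ B) (hK : ∀ k m, ‖K k m‖ * (p : ℝ)⁻¹ ^ m ≤ θ * (p : ℝ)⁻¹ ^ k)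
    {b : ℕ → L} (hb : ∀ k, ‖b k‖ ≤ C * (p : ℝ)⁻¹ ^ k) :
    ∃ (a : ℕ → L) (D : ℝ), (∀ k, ‖a k‖ ≤ D * (p : ℝ)⁻¹ ^ k) ∧
      ∀ k, a k = b k - ∑' m, K k m * a m := by
  have hp := norm_prime p L
  have hpos : 0 < (p : ℝ)⁻¹ := by
    have := (Fact.out (p := p.Prime)).pos
    positivity
  have hp0 : (p : L) ≠ 0 := by rw [← norm_pos_iff, hp]; exact hpos
  have h1 : ∀ k m, ‖K k m * p ^ m / p ^ k‖ ≤ θ := fun k m => by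
    rw [norm_div, norm_mul, norm_pow, norm_pow, hp, div_le_iff₀ (by positivity)]
    exact hK k m
  have h2 : ∀ k, Tendsto (fun m => K k m * (p : L) ^ m / p ^ k) atTop (𝓝 0) := fun k => by
    rw [tendsto_zero_iff_norm_tendsto_zero]
    have ht := (tendsto_pow_atTop_nhds_zero_of_lt_one hpos.le (inv_prime_lt_one p)).const_mul
      (B / (p : ℝ)⁻¹ ^ k)
    rw [mul_zero] at ht
    refine squeeze_zero (fun m => norm_nonneg _) (fun m => ?_) ht
    rw [norm_div, norm_mul, norm_pow, norm_pow, hp, mul_div_right_comm]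
    have := hB k m
    gcongr
  have h3 : ∀ k, ‖b k / (p : L) ^ k‖ ≤ C := fun k => by
    rw [norm_div, norm_pow, hp, div_le_iff₀ (by positivity)]
    exact hb k
  obtain ⟨a, D, ha, h⟩ := exists_eq_sub_tsum hθ0 hθ h1 h2 h3
  refine ⟨fun k => p ^ k * a k, D, fun k => ?_, fun k => ?_⟩
  · rw [norm_mul, norm_pow, hp, mul_comm]
    exact mul_le_mul_of_nonneg_right (ha k) (by positivity)
  · simp only
    rw [h k, mul_sub, mul_div_cancel₀ _ (pow_ne_zero _ hp0), ← tsum_mul_left]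
    congr 1
    refine tsum_congr fun m => ?_
    field_simp

/-! ## Solving `G - e G(p x) = F` up to polynomials -/

/-- In the norm weighted by p^(-k), composition with x ↦ px scales the k-th Mahler coefficient by
p^(-k). On coefficients k ≥ N the map G ↦ eG(px) is thus a contraction; the finitely many lower ones
remain as the polynomial. -/
theorem MahlerDecay.exists_sub_comp_prime_mul (e : L) {F : ℤ_[p] → L}
    (hF : MahlerDecay (p : ℝ)⁻¹ F) : ∃ G : ℤ_[p] → L, MahlerDecay (p : ℝ)⁻¹ G ∧
      ∃ (N : ℕ) (r : ℕ → L), ∀ x, F x = (G x - e * G (p * x)) +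
        ∑ k ∈ Finset.range N, r k * bin L x k := by
  have hp2 := (Fact.out (p := p.Prime)).two_le
  have hpos : 0 < (p : ℝ)⁻¹ := by
    have := (Fact.out (p := p.Prime)).pos
    positivity
  have hp1 := inv_prime_lt_one p
  obtain ⟨C, b, hb, hFb⟩ := hF
  obtain ⟨N, hN⟩ : ∃ N : ℕ, ‖e‖ * (p : ℝ)⁻¹ ^ N < 1 := by
    have h := (tendsto_pow_atTop_nhds_zero_of_lt_one hpos.le hp1).const_mul ‖e‖
    rw [mul_zero] at h
    exact (h.eventually (gt_mem_nhds one_pos)).exists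
  set w := (p : ℝ)⁻¹ with hw
  have hC := nonneg_of_norm_le_geom hb
  have haff : ∀ m k, ‖affCoeff L (p : ℤ_[p]) 0 m k‖ * w ^ m ≤ (w * w) ^ k := by
    intro m k
    have h := norm_affCoeff_prime_le (p := p) (L := L) hpos hp1.le m k
    rwa [max_eq_right, div_eq_mul_inv] at h
    rw [div_eq_mul_inv, ← sq]
    exact pow_le_pow_of_le_one hpos.le hp1.le hp2
  -- The rows k < N of the system are set to zero, which makes G start in degree N.
  have hK1 : ∀ k m, ‖(if k < N then 0 else -(e * affCoeff L (p : ℤ_[p]) 0 m k))‖ ≤ ‖e‖ := fun k m => by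
    split_ifs with hk
    · rw [norm_zero]; positivity
    · rw [norm_neg, norm_mul]
      exact mul_le_of_le_one_right (norm_nonneg _) (norm_affCoeff_le_one _ _ _ _)
  have hK2 : ∀ k m, ‖(if k < N then 0 else -(e * affCoeff L (p : ℤ_[p]) 0 m k))‖ * w ^ m ≤
      ‖e‖ * w ^ N * w ^ k := fun k m => by
    split_ifs with hk
    · rw [norm_zero, zero_mul]; positivity
    · rw [norm_neg, norm_mul, mul_assoc]
      calc ‖e‖ * (‖affCoeff L (p : ℤ_[p]) 0 m k‖ * w ^ m) ≤ ‖e‖ * (w * w) ^ k := by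
            gcongr; exact haff m k
        _ = ‖e‖ * w ^ k * w ^ k := by rw [mul_pow]; ring
        _ ≤ ‖e‖ * w ^ N * w ^ k := by
            gcongr ‖e‖ * ?_ * _
            exact pow_le_pow_of_le_one hpos.le hp1.le (not_lt.mp hk)
  have hK3 : ∀ k, ‖(if k < N then 0 else b k)‖ ≤ C * w ^ k := fun k => by
    split_ifs with hk
    · rw [norm_zero]; positivity
    · exact hb k
  obtain ⟨a, D, ha, h⟩ := exists_eq_sub_tsum_of_weight (p := p) (by positivity) hN hK1 hK2 hK3
  refine ⟨fun x => ∑' k, a k * bin L x k, ⟨D, a, ha, fun x => rfl⟩, N,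
    fun k => b k - a k + e * ∑' m, a m * affCoeff L (p : ℤ_[p]) 0 m k, fun x => ?_⟩
  have h1 := tsum_bin_affine hpos.le hp1 ha (p : ℤ_[p]) 0 x
  rw [add_zero] at h1
  have h2 := norm_tsum_mul_affCoeff_le hpos.le (ρ := w) (σ := w)
    (norm_affCoeff_mul_pow_le hpos.le hp1.le (p : ℤ_[p]) 0) ha
  have s1 := summable_mul_bin hpos.le hp1 hb x
  have s2 := summable_mul_bin hpos.le hp1 ha x
  have s3 := (summable_mul_bin hpos.le hp1 h2 x).mul_left e
  have h3 : ∀ k, (b k - a k + e * ∑' m, a m * affCoeff L (p : ℤ_[p]) 0 m k) * bin L x k =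
      b k * bin L x k - a k * bin L x k +
        e * ((∑' m, a m * affCoeff L (p : ℤ_[p]) 0 m k) * bin L x k) := fun k => by ring
  rw [← tsum_eq_sum (L := SummationFilter.unconditional ℕ) (f := fun k => (b k - a k + e * ∑' m, a m * affCoeff L (p : ℤ_[p]) 0 m k) *
    bin L x k) (s := Finset.range N), tsum_congr h3, (s1.sub s2).tsum_add s3, s1.tsum_sub s2,
    hFb, tsum_mul_left, ← h1]
  · ring
  · intro k hk
    have hk' : ¬k < N := by simpa using hk
    have h4 := h k
    simp only [hk', if_false, neg_mul, mul_assoc, tsum_neg, tsum_mul_left] at h4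
    have h5 : ∑' m, a m * affCoeff L (p : ℤ_[p]) 0 m k =
        ∑' m, affCoeff L (p : ℤ_[p]) 0 m k * a m := tsum_congr fun m => mul_comm _ _
    rw [h5]
    linear_combination (-bin L x k) * h4

/-! ## Solving `c A((1 + q) z + 1) - A(z) = G(z)` -/

-- For q = 0 the series (1+T)((1+T)^(1+q) - 1)^k is T^k + T^(k+1), whence the two indicators. In
-- general (1+T)^(1+q) - 1 = T(1 + e) with e of Gauss norm at most |q| at radius 1/p.
omit [CompleteSpace L] in
theorem norm_affCoeff_one_add_sub_le (q : ℤ_[p]) (m k : ℕ) :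
    ‖affCoeff L (1 + q) 1 (m + 1) k - (if m = k then 1 else 0) - (if m + 1 = k then 1 else 0)‖ *
      (p : ℝ)⁻¹ ^ (m + 1) ≤ (p : ℝ)⁻¹ ^ k * ‖q‖ := by
  have hpos : 0 < (p : ℝ)⁻¹ := by
    have := (Fact.out (p := p.Prime)).pos
    positivity
  have hp1 := inv_prime_lt_one p
  set v : PowerSeries L := PowerSeries.mk fun n => bin L q (n + 1) with hv
  have hv1 : GaussLE (p : ℝ)⁻¹ ‖q‖ v := by
    intro n
    rw [hv, PowerSeries.coeff_mk]
    have h1 := congrArg norm (bin_succ_eq (L := L) q n)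
    rw [norm_mul, norm_mul, ← Nat.cast_succ, norm_intIncl] at h1
    have h2 := one_le_mul_norm_natCast p L (Nat.succ_ne_zero n)
    have h3 : ((n + 1 : ℕ) : ℝ) * (p : ℝ)⁻¹ ^ n ≤ 1 := by
      have hp0 := (Fact.out (p := p.Prime)).pos
      rw [inv_pow, ← div_eq_mul_inv, div_le_one (by positivity)]
      exact_mod_cast Nat.lt_pow_self (Fact.out (p := p.Prime)).one_lt
    have h4 : ‖bin L q (n + 1)‖ ≤ ((n + 1 : ℕ) : ℝ) * ‖q‖ := by
      calc ‖bin L q (n + 1)‖ ≤ (((n + 1 : ℕ) : ℝ) * ‖((n + 1 : ℕ) : L)‖) * ‖bin L q (n + 1)‖ :=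
            le_mul_of_one_le_left (norm_nonneg _) h2
        _ = ((n + 1 : ℕ) : ℝ) * (‖q‖ * ‖bin L (q - 1) n‖) := by
            rw [mul_assoc, ← h1]
        _ ≤ ((n + 1 : ℕ) : ℝ) * ‖q‖ := by
            gcongr
            exact mul_le_of_le_one_right (norm_nonneg _) (norm_bin_le_one _ _)
    calc ‖bin L q (n + 1)‖ * (p : ℝ)⁻¹ ^ n ≤ ((n + 1 : ℕ) : ℝ) * ‖q‖ * (p : ℝ)⁻¹ ^ n := by gcongr
      _ = (((n + 1 : ℕ) : ℝ) * (p : ℝ)⁻¹ ^ n) * ‖q‖ := by ring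
      _ ≤ 1 * ‖q‖ := by gcongr
      _ = ‖q‖ := one_mul _
  have hone := gaussLE_onePow (L := L) hpos.le hp1.le (1 : ℤ_[p])
  have he := hone.mul hpos hv1
  rw [one_mul] at he
  have hS : onePow L (1 + q) - 1 = PowerSeries.X * (1 + onePow L (1 : ℤ_[p]) * v) := by
    have h1 := onePow_sub_one (L := L) q
    rw [← hv] at h1
    rw [onePow_add, mul_add, mul_one, mul_left_comm, ← h1, onePow_one]
    ring
  have h := hone.mul hpos (he.pow_sub_X_pow hpos (PadicInt.norm_le_one q) k) (m + 1)
  rw [one_mul, ← hS, mul_sub, map_sub] at h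
  have h2 : PowerSeries.coeff (m + 1) (onePow L (1 : ℤ_[p]) * PowerSeries.X ^ k) =
      (if m = k then 1 else 0) + (if m + 1 = k then 1 else 0) := by
    rw [onePow_one, add_mul, one_mul, ← pow_succ', map_add, PowerSeries.coeff_X_pow,
      PowerSeries.coeff_X_pow, add_comm]
    simp only [Nat.add_right_cancel_iff]
  rw [h2, ← sub_sub] at h
  exact h

/-- A perturbation of A(z+1) - A(z) = G, which is solved by shifting Mahler coefficients by one. The
shift costs a factor p in the weighted norm, which explains the bounds 1/p on c - 1 and q. -/
theorem MahlerDecay.exists_mul_comp_sub {c : L} {q : ℤ_[p]} (hc : ‖c - 1‖ < (p : ℝ)⁻¹)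
    (hq : ‖q‖ < (p : ℝ)⁻¹) {G : ℤ_[p] → L} (hG : MahlerDecay (p : ℝ)⁻¹ G) :
    ∃ A : ℤ_[p] → L, MahlerDecay (p : ℝ)⁻¹ A ∧ ∀ z, c * A ((1 + q) * z + 1) - A z = G z := by
  have hp0 : (0 : ℝ) < p := by exact_mod_cast (Fact.out (p := p.Prime)).pos
  have hpos : 0 < (p : ℝ)⁻¹ := by positivity
  have hp1 := inv_prime_lt_one p
  obtain ⟨C, b, hb, hGb⟩ := hG
  have hC := nonneg_of_norm_le_geom hb
  have hcn : ‖c‖ = 1 := by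
    have := norm_add_eq_one (L := L) norm_one (hc.trans hp1)
    rwa [add_sub_cancel] at this
  have hc0 : c ≠ 0 := by rw [← norm_ne_zero_iff, hcn]; exact one_ne_zero
  have hcinv : ‖1 - c⁻¹‖ = ‖c - 1‖ := by
    have : 1 - c⁻¹ = (c - 1) * c⁻¹ := by field_simp
    rw [this, norm_mul, norm_inv, hcn, inv_one, mul_one]
  -- After division by c the system for x m, the coefficient of (z choose m+1) in A, is x + Kx = c⁻¹
  -- b.
  set K : ℕ → ℕ → L := fun k m => affCoeff L (1 + q) 1 (m + 1) k - (if m = k then 1 else 0) -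
    c⁻¹ * (if m + 1 = k then 1 else 0) with hKdef
  have hite : ∀ a b : ℕ, ‖(if a = b then 1 else 0 : L)‖ ≤ 1 := fun a b => by
    split_ifs <;> simp
  have hθ : max ‖c - 1‖ ‖q‖ * p < 1 := by
    rw [← lt_div_iff₀ hp0, one_div]
    exact max_lt hc hq
  have hK1 : ∀ k m, ‖K k m‖ ≤ 1 := fun k m => by
    rw [hKdef]
    simp only [sub_eq_add_neg]
    refine (IsUltrametricDist.norm_add_le_max _ _).trans (max_le
      ((IsUltrametricDist.norm_add_le_max _ _).trans
        (max_le (norm_affCoeff_le_one _ _ _ _) ((norm_neg _).trans_le (hite _ _)))) ?_)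
    rw [norm_neg, norm_mul, norm_inv, hcn, inv_one, one_mul]
    exact hite _ _
  have hK2 : ∀ k m, ‖K k m‖ * (p : ℝ)⁻¹ ^ m ≤ max ‖c - 1‖ ‖q‖ * p * (p : ℝ)⁻¹ ^ k := fun k m => by
    have e : K k m = (affCoeff L (1 + q) 1 (m + 1) k - (if m = k then 1 else 0) -
        (if m + 1 = k then 1 else 0)) + (1 - c⁻¹) * (if m + 1 = k then 1 else 0) := by
      rw [hKdef]; ring
    have h1 := norm_affCoeff_one_add_sub_le (L := L) q m k
    rw [← le_div_iff₀ (by positivity)]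
    rw [e]
    refine (IsUltrametricDist.norm_add_le_max _ _).trans (max_le ?_ ?_)
    · rw [le_div_iff₀ (by positivity)]
      have h2 : ‖affCoeff L (1 + q) 1 (m + 1) k - (if m = k then 1 else 0) -
        (if m + 1 = k then 1 else 0)‖ * (p : ℝ)⁻¹ ^ m ≤ (p : ℝ)⁻¹ ^ k * ‖q‖ * p := by
        rw [pow_succ, ← mul_assoc, ← div_eq_mul_inv, div_le_iff₀ hp0] at h1
        exact h1
      refine h2.trans ?_
      have := le_max_right ‖c - 1‖ ‖q‖
      calc (p : ℝ)⁻¹ ^ k * ‖q‖ * p ≤ (p : ℝ)⁻¹ ^ k * max ‖c - 1‖ ‖q‖ * p := by gcongr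
        _ = _ := by ring
    · rw [le_div_iff₀ (by positivity), norm_mul, hcinv]
      split_ifs with hmk
      · subst hmk
        have := le_max_left ‖c - 1‖ ‖q‖
        rw [norm_one, mul_one, pow_succ]
        calc ‖c - 1‖ * (p : ℝ)⁻¹ ^ m ≤ max ‖c - 1‖ ‖q‖ * (p : ℝ)⁻¹ ^ m := by gcongr
          _ = _ := by field_simp
      · rw [norm_zero, mul_zero, zero_mul]; positivity
  have hK3 : ∀ k, ‖c⁻¹ * b k‖ ≤ C * (p : ℝ)⁻¹ ^ k := fun k => by
    rw [norm_mul, norm_inv, hcn, inv_one, one_mul]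
    exact hb k
  obtain ⟨x, D, hx, h⟩ := exists_eq_sub_tsum_of_weight (p := p) (by positivity) hθ hK1 hK2 hK3
  have hD := nonneg_of_norm_le_geom hx
  set a : ℕ → L := fun k => if k = 0 then 0 else x (k - 1) with ha
  have ha0 : a 0 = 0 := if_pos rfl
  have ha1 : ∀ k, a (k + 1) = x k := fun k => by rw [ha]; simp
  have hab : ∀ k, ‖a k‖ ≤ (D * p) * (p : ℝ)⁻¹ ^ k := by
    intro k
    cases k with
    | zero => rw [ha0, norm_zero]; positivity
    | succ k =>
      rw [ha1]
      refine (hx k).trans (le_of_eq ?_)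
      rw [pow_succ]
      field_simp
  have hxs : Summable x := Summable.of_norm_bounded
    ((summable_geometric_of_lt_one hpos.le hp1).mul_left D) hx
  have has : ∀ k, Summable fun m => affCoeff L (1 + q) 1 (m + 1) k * x m := fun k =>
    Summable.of_norm_bounded ((summable_geometric_of_lt_one hpos.le hp1).mul_left D) fun m => by
      rw [norm_mul]
      exact (mul_le_of_le_one_left (norm_nonneg _) (norm_affCoeff_le_one _ _ _ _)).trans (hx m)
  have hs1 : ∀ k, HasSum (fun m => (if m = k then (1 : L) else 0) * x m) (x k) := fun k => by
    have h := hasSum_single (f := fun m => (if m = k then (1 : L) else 0) * x m) k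
      fun m hm => by rw [if_neg hm, zero_mul]
    rwa [if_pos rfl, one_mul] at h
  have hs2 : ∀ k, HasSum (fun m => (if m + 1 = k then (1 : L) else 0) * x m) (a k) := fun k => by
    cases k with
    | zero => rw [ha0]; simp
    | succ k => rw [ha1]; simpa using hs1 k
  have heq : ∀ k, c * (∑' m, a m * affCoeff L (1 + q) 1 m k) - a k = b k := by
    intro k
    have e1 : ∑' m, a m * affCoeff L (1 + q) 1 m k = ∑' m, affCoeff L (1 + q) 1 (m + 1) k * x m := by
      have hsum : Summable fun m => a m * affCoeff L (1 + q) 1 m k := by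
        refine (summable_nat_add_iff 1).mp ((has k).congr fun m => ?_)
        rw [ha1, mul_comm]
      rw [hsum.tsum_eq_zero_add, ha0, zero_mul, zero_add]
      exact tsum_congr fun m => by rw [ha1, mul_comm]
    have e2 := (((has k).hasSum.sub (hs1 k)).sub ((hs2 k).mul_left c⁻¹)).tsum_eq
    have e3 : ∑' m, K k m * x m = ∑' m, affCoeff L (1 + q) 1 (m + 1) k * x m - x k - c⁻¹ * a k := by
      rw [← e2]
      refine tsum_congr fun m => ?_
      rw [hKdef]
      ring
    have h1 := h k
    rw [e3] at h1
    rw [e1]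
    have h2 : ∑' m, affCoeff L (1 + q) 1 (m + 1) k * x m = c⁻¹ * (b k + a k) := by
      linear_combination h1
    rw [h2, mul_inv_cancel_left₀ hc0]
    ring
  refine ⟨fun z => ∑' k, a k * bin L z k, ⟨_, a, hab, fun z => rfl⟩, fun z => ?_⟩
  have h2 := norm_tsum_mul_affCoeff_le hpos.le (ρ := (p : ℝ)⁻¹) (σ := (p : ℝ)⁻¹)
    (norm_affCoeff_mul_pow_le hpos.le hp1.le (1 + q) 1) hab
  have s1 := (summable_mul_bin hpos.le hp1 h2 z).mul_left c
  have s2 := summable_mul_bin hpos.le hp1 hab z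
  simp only
  rw [tsum_bin_affine hpos.le hp1 hab, ← tsum_mul_left, ← s1.tsum_sub s2, hGb]
  refine tsum_congr fun k => ?_
  rw [← heq k]
  ring

end

end

section

variable {p : ℕ} [Fact p.Prime] {L : Type*} [NormedField L] [NormedAlgebra ℚ_[p] L]

/-! ## The operator `B ↦ κ B(α x) - B(x)` on locally analytic functions on `ℤ_pˣ` -/

section

variable [IsUltrametricDist L] [CompleteSpace L] [FiniteDimensional ℚ_[p] L]

/-- φ is extension by zero along multiplication by p; it is applied n times. -/
theorem LocAnalytic.exists_extend_prime_pow {A : ℤ_[p] → L} (hA : LocAnalytic A) (n : ℕ) :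
    ∃ B : ℤ_[p] → L, LocAnalytic B ∧ (∀ z, B ((p : ℤ_[p]) ^ n * z) = A z) ∧
      ∀ x, ¬(p : ℤ_[p]) ^ n ∣ x → B x = 0 := by
  induction n with
  | zero => exact ⟨A, hA, fun z => by simp, fun x hx => by simp at hx⟩
  | succ n ih =>
    obtain ⟨B, hB, h1, h2⟩ := ih
    obtain ⟨f, hf, -⟩ := exists_amiceFun_eq hB
    refine ⟨_, LocAnalytic.amiceFun (phi p L f), fun z => ?_, fun x hx => ?_⟩
    · rw [pow_succ', mul_assoc, amiceFun_phi_mul, hf, h1]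
    · by_cases hu : IsUnit x
      · exact amiceFun_phi_of_isUnit f hu
      · obtain ⟨y, rfl⟩ := exists_eq_mul_of_not_isUnit hu
        rw [amiceFun_phi_mul, hf]
        refine h2 y fun hd => hx ?_
        rw [pow_succ']
        exact mul_dvd_mul_left _ hd

/-- Extension by zero of a function on the ball `a + s ℤ_p`. -/
theorem LocAnalytic.exists_extend {A : ℤ_[p] → L} (hA : LocAnalytic A) (a : ℤ_[p]) {s : ℤ_[p]}
    (hs : s ≠ 0) : ∃ B : ℤ_[p] → L, LocAnalytic B ∧ (∀ z, B (a + s * z) = A z) ∧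
      ∀ x, ¬s ∣ x - a → B x = 0 := by
  have hw := PadicInt.unitCoeff_spec hs
  set w := PadicInt.unitCoeff hs
  set n := s.valuation
  obtain ⟨B, hB, h1, h2⟩ := (hA.comp_mul (↑w⁻¹ : ℤ_[p])).exists_extend_prime_pow n
  refine ⟨_, hB.comp_affine 1 (-a), fun z => ?_, fun x hx => h2 _ fun hd => hx ?_⟩
  · have e : 1 * (a + s * z) + -a = (p : ℤ_[p]) ^ n * (w * z) := by rw [hw]; ring
    rw [e, h1, Units.inv_mul_cancel_left]
  · rw [one_mul, ← sub_eq_add_neg] at hd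
    rw [hw]
    exact (Units.mul_left_dvd).mpr hd

/-- For a unit a, the coordinate x = a + aqz turns multiplication by 1 + q into z ↦ (1+q)z + 1, so
the ball is preserved and the equation is that of `MahlerDecay.exists_mul_comp_sub`. For a nonunit
a, F vanishes on the ball. -/
theorem LocAnalytic.exists_mul_comp_sub_of_ball {F : ℤ_[p] → L} {c : L} {q : ℤ_[p]}
    (hc : ‖c - 1‖ < (p : ℝ)⁻¹) (hq : ‖q‖ < (p : ℝ)⁻¹) (hq0 : q ≠ 0)
    (hF0 : ∀ x, ¬IsUnit x → F x = 0)
    (hF : ∀ a : ℤ_[p], MahlerDecay (p : ℝ)⁻¹ fun z => F (a + a * q * z)) (a : ℤ_[p]) :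
    ∃ B : ℤ_[p] → L, LocAnalytic B ∧ (∀ x, q ∣ x - a → c * B ((1 + q) * x) - B x = F x) ∧
      ∀ x, ¬q ∣ x - a → c * B ((1 + q) * x) - B x = 0 := by
  have hpos : 0 < (p : ℝ)⁻¹ := by
    have := (Fact.out (p := p.Prime)).pos
    positivity
  have hp1 := inv_prime_lt_one p
  have hqu : ¬IsUnit q := fun h => (hq.trans hp1).ne (PadicInt.isUnit_iff.mp h)
  by_cases ha : IsUnit a
  · obtain ⟨A, hA, h⟩ := (hF a).exists_mul_comp_sub hc hq
    have hA' : LocAnalytic A := ⟨_, hpos, hp1, hA⟩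
    have hdvd : ∀ x, a * q ∣ x ↔ q ∣ x := fun x => ha.mul_left_dvd
    obtain ⟨B, hB, h1, h2⟩ := hA'.exists_extend a (mul_ne_zero ha.ne_zero hq0)
    refine ⟨B, hB, fun x hx => ?_, fun x hx => ?_⟩
    · obtain ⟨z, hz⟩ := (hdvd _).mpr hx
      have hx' : x = a + a * q * z := by rw [← hz]; ring
      have e : (1 + q) * (a + a * q * z) = a + a * q * ((1 + q) * z + 1) := by ring
      rw [hx', e, h1, h1, h]
    · have h3 : ¬q ∣ (1 + q) * x - a := by
        intro hd
        refine hx ?_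
        have := dvd_sub hd (dvd_mul_right q x)
        rwa [show (1 + q) * x - a - q * x = x - a by ring] at this
      rw [h2 x (by rwa [hdvd]), h2 _ (by rwa [hdvd]), mul_zero, sub_zero]
  · refine ⟨fun _ => 0, locAnalytic_zero, fun x hx => ?_, fun x _ => by simp⟩
    rw [mul_zero, sub_zero, hF0 x]
    intro hxu
    have h1 : a ∈ IsLocalRing.maximalIdeal ℤ_[p] := ha
    have h2 : q ∈ IsLocalRing.maximalIdeal ℤ_[p] := hqu
    have h3 : x ∈ IsLocalRing.maximalIdeal ℤ_[p] := by
      have := add_mem (Ideal.mem_of_dvd _ hx h2) h1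
      rwa [sub_add_cancel] at this
    exact h3 hxu

theorem existsUnique_dvd_sub {q : ℤ_[p]} (hq0 : q ≠ 0) (x : ℤ_[p]) :
    ∃ a ∈ Finset.range (p ^ q.valuation), q ∣ x - (a : ℤ_[p]) ∧
      ∀ b ∈ Finset.range (p ^ q.valuation), q ∣ x - (b : ℤ_[p]) → b = a := by
  have hw := PadicInt.unitCoeff_spec hq0
  set w := PadicInt.unitCoeff hq0
  set n := q.valuation
  have hdvd : ∀ y, q ∣ y ↔ (p : ℤ_[p]) ^ n ∣ y := fun y => by
    rw [hw]; exact Units.mul_left_dvd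
  have h1 := PadicInt.appr_spec n x
  rw [Ideal.mem_span_singleton] at h1
  refine ⟨x.appr n, Finset.mem_range.mpr (PadicInt.appr_lt x n), (hdvd _).mpr h1, fun b hb h => ?_⟩
  rw [hdvd] at h
  have h2 := dvd_sub h1 h
  rw [sub_sub_sub_cancel_left] at h2
  have h3 : (p : ℤ_[p]) ^ n ∣ (((b : ℤ) - (x.appr n : ℤ) : ℤ) : ℤ_[p]) := by push_cast; exact h2
  rw [PadicInt.pow_p_dvd_int_iff] at h3
  have h4 := PadicInt.appr_lt x n
  have h5 := Finset.mem_range.mp hb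
  have h6 : ((b : ℤ) - (x.appr n : ℤ)) = 0 := by
    refine Int.eq_zero_of_abs_lt_dvd h3 ?_
    rw [abs_lt]
    have h7 : ((p ^ n : ℕ) : ℤ) = (p : ℤ) ^ n := by push_cast; rfl
    rw [← h7]
    omega
  omega

theorem LocAnalytic.exists_mul_comp_sub_of_near {F : ℤ_[p] → L} {c : L} {q : ℤ_[p]}
    (hc : ‖c - 1‖ < (p : ℝ)⁻¹) (hq : ‖q‖ < (p : ℝ)⁻¹) (hq0 : q ≠ 0)
    (hF0 : ∀ x, ¬IsUnit x → F x = 0)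
    (hF : ∀ a : ℤ_[p], MahlerDecay (p : ℝ)⁻¹ fun z => F (a + a * q * z)) :
    ∃ B : ℤ_[p] → L, LocAnalytic B ∧ ∀ x, c * B ((1 + q) * x) - B x = F x := by
  choose B hB h1 h2 using LocAnalytic.exists_mul_comp_sub_of_ball hc hq hq0 hF0 hF
  refine ⟨_, LocAnalytic.sum (Finset.range (p ^ q.valuation)) (F := fun a => B (a : ℤ_[p]))
    fun a _ => hB _, fun x => ?_⟩
  rw [Finset.mul_sum, ← Finset.sum_sub_distrib]
  obtain ⟨a, ha, hxa, huniq⟩ := existsUnique_dvd_sub hq0 x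
  rw [Finset.sum_eq_single_of_mem a ha, h1 _ x hxa]
  intro b hb hba
  exact h2 _ x fun h => hba (huniq b hb h)

theorem LocAnalytic.exists_mul_comp_sub {F : ℤ_[p] → L} (hF : LocAnalytic F)
    (hF0 : ∀ x, ¬IsUnit x → F x = 0) {κ : L} {α : ℤ_[p]}
    (h : ∀ n : ℕ, ∃ M : ℕ, α ^ M ≠ 1 ∧ (p : ℤ_[p]) ^ n ∣ α ^ M - 1 ∧ ‖κ ^ M - 1‖ < (p : ℝ)⁻¹) :
    ∃ B : ℤ_[p] → L, LocAnalytic B ∧ ∀ x, κ * B (α * x) - B x = F x := by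
  obtain ⟨ρ, h0, h1, hF⟩ := hF
  obtain ⟨n, hn⟩ := eventually_atTop.mp
    (eventually_mahlerDecay_comp_prime_pow_mul (p := p) (L := L) h0 h1)
  -- The exponent n makes the expansions of F on the balls converge rapidly, and 2 makes |q| < 1/p.
  obtain ⟨M, hM1, hM2, hM3⟩ := h (max n 2)
  set q := α ^ M - 1 with hq
  have hα : α ^ M = 1 + q := by rw [hq]; ring
  have hq0 : q ≠ 0 := sub_ne_zero.mpr hM1
  have hqn : ‖q‖ < (p : ℝ)⁻¹ := by
    have hd : q ∈ (Ideal.span {(p : ℤ_[p]) ^ (max n 2)}) := Ideal.mem_span_singleton.mpr hM2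
    have h2 := (PadicInt.norm_le_pow_iff_mem_span_pow _ _).mpr hd
    refine h2.trans_lt ?_
    have hp1 : (1 : ℝ) < p := by exact_mod_cast (Fact.out (p := p.Prime)).one_lt
    rw [← zpow_neg_one]
    refine zpow_lt_zpow_right₀ hp1 ?_
    have := le_max_right n 2
    omega
  obtain ⟨q', hq'⟩ := hM2
  obtain ⟨B₀, hB₀, hB⟩ := LocAnalytic.exists_mul_comp_sub_of_near (F := F) hM3 hqn hq0 hF0
    fun a => by
      have h2 := hn _ (le_max_left n 2) _ (hF.comp_affine h0.le h1 (a * q') a)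
      convert h2 using 2 with z
      rw [hq']
      congr 1
      ring
  -- Geometric sum: applying κ B(αx) - B(x) to Σ κ^j B₀(α^j x) telescopes to κ^M B₀(α^M x) - B₀(x).
  refine ⟨_, LocAnalytic.sum (Finset.range M) (F := fun j x => κ ^ j * B₀ (α ^ j * x))
    fun j _ => (hB₀.comp_mul _).smul _, fun x => ?_⟩
  have h3 := Finset.sum_range_sub (fun j => κ ^ j * B₀ (α ^ j * x)) M
  rw [pow_zero, pow_zero, one_mul, one_mul, hα, hB] at h3
  rw [← h3, Finset.sum_sub_distrib, Finset.mul_sum]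
  congr 1
  refine Finset.sum_congr rfl fun j _ => ?_
  rw [pow_succ, pow_succ, mul_assoc (α ^ j)]
  ring

end

/-! ### Powers of elements of `ℤ_pˣ` that are close to `1` -/

theorem pow_dvd_pow_sub_one (u : ℤ_[p]ˣ) (n : ℕ) :
    (p : ℤ_[p]) ^ (n + 1) ∣ (u : ℤ_[p]) ^ ((p - 1) * p ^ n) - 1 := by
  obtain ⟨y, hy⟩ := exists_pow_eq u
  have h := dvd_sub_pow_of_dvd_sub (R := ℤ_[p]) (p := p) (a := (u : ℤ_[p]) ^ (p - 1)) (b := 1)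
    ⟨y, by rw [hy]; ring⟩ n
  rwa [one_pow, ← pow_mul] at h

theorem tendsto_val_pow (u : ℤ_[p]ˣ) :
    Tendsto (fun n : ℕ => (u : ℤ_[p]) ^ ((p - 1) * p ^ n)) atTop (𝓝 1) := by
  rw [tendsto_iff_norm_sub_tendsto_zero]
  have hp1 := inv_prime_lt_one p
  refine squeeze_zero (fun n => norm_nonneg _) (fun n => ?_)
    ((tendsto_pow_atTop_nhds_zero_of_lt_one (by positivity) hp1).comp (tendsto_add_atTop_nat 1))
  have h := (PadicInt.norm_le_pow_iff_mem_span_pow _ (n + 1)).mpr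
    (Ideal.mem_span_singleton.mpr (pow_dvd_pow_sub_one u n))
  rw [zpow_neg, zpow_natCast, ← inv_pow] at h
  exact h

theorem tendsto_units_pow (u : ℤ_[p]ˣ) :
    Tendsto (fun n : ℕ => u ^ ((p - 1) * p ^ n)) atTop (𝓝 1) := by
  rw [Units.isInducing_embedProduct.tendsto_nhds_iff, map_one]
  refine Tendsto.prodMk_nhds ?_ ?_
  · simpa using tendsto_val_pow u
  · refine (MulOpposite.continuous_op.tendsto 1).comp ?_
    have := tendsto_val_pow u⁻¹
    simpa [Function.comp_def] using this

/-- For M = (p-1)p^m the M-th power of any unit tends to 1; continuity of χ then controls the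
scalar. -/
theorem exists_pow_near_one {g : ℤ_[p]ˣ} (hg : ∀ n : ℕ, n ≠ 0 → g ^ n ≠ 1) {χ : ℤ_[p]ˣ →* Lˣ}
    (hχ : Continuous χ) (n : ℕ) : ∃ M : ℕ, (↑g⁻¹ : ℤ_[p]) ^ M ≠ 1 ∧
      (p : ℤ_[p]) ^ n ∣ (↑g⁻¹ : ℤ_[p]) ^ M - 1 ∧
      ‖((χ g : L) * (intIncl p L g)⁻¹) ^ M - 1‖ < (p : ℝ)⁻¹ := by
  have h1 : Tendsto (fun n : ℕ => ((χ (g ^ ((p - 1) * p ^ n)) : Lˣ) : L)) atTop (𝓝 1) := by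
    have := (Units.continuous_val.comp hχ).tendsto 1
    rw [Function.comp, map_one, Units.val_one] at this
    exact this.comp (tendsto_units_pow g)
  have h2 : Tendsto (fun n : ℕ => intIncl p L ((g⁻¹ : ℤ_[p]ˣ) ^ ((p - 1) * p ^ n) : ℤ_[p]))
      atTop (𝓝 1) := by
    have := (continuous_intIncl (p := p) (L := L)).tendsto 1
    rw [map_one] at this
    exact this.comp (tendsto_val_pow g⁻¹)
  have hpos : 0 < (p : ℝ)⁻¹ := by
    have := (Fact.out (p := p.Prime)).pos
    positivity
  have h3 := (h1.mul h2)
  rw [mul_one] at h3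
  obtain ⟨m, hm1, hm2⟩ := ((h3.eventually (Metric.ball_mem_nhds 1 hpos)).and
    (eventually_ge_atTop n)).exists
  refine ⟨(p - 1) * p ^ m, fun h => ?_, ?_, ?_⟩
  · have hp := (Fact.out (p := p.Prime))
    refine hg ((p - 1) * p ^ m) ?_ ?_
    · have := hp.two_le
      have := hp.pos
      exact Nat.mul_ne_zero (by omega) (pow_ne_zero _ (by omega))
    · rw [← Units.val_pow_eq_pow_val, Units.val_eq_one, inv_pow, inv_eq_one] at h
      exact h
  · exact (pow_dvd_pow _ (by omega)).trans (pow_dvd_pow_sub_one g⁻¹ m)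
  · rw [dist_eq_norm] at hm1
    have e : intIncl p L (↑g⁻¹ : ℤ_[p]) = (intIncl p L g)⁻¹ := by
      refine eq_inv_of_mul_eq_one_left ?_
      rw [← map_mul, Units.inv_mul, map_one]
    rw [map_pow, Units.val_pow_eq_pow_val, map_pow, ← mul_pow, e] at hm1
    exact hm1

end

section

variable {p : ℕ} [Fact p.Prime] {L : Type*} [NormedField L] [NormedAlgebra ℚ_[p] L]

/-! ## Reduction to the elements `∂ ^ i (1 / T)` -/

theorem exists_polynomial_eq_bin (p : ℕ) [Fact p.Prime] (L : Type*) [NormedField L]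
    [NormedAlgebra ℚ_[p] L] (k : ℕ) :
    ∃ P : Polynomial L, ∀ x : ℤ_[p], bin L x k = P.eval (intIncl p L x) := by
  have := charZero p L
  induction k with
  | zero => exact ⟨1, fun x => by simp⟩
  | succ k ih =>
    obtain ⟨P, hP⟩ := ih
    refine ⟨Polynomial.C ((k : L) + 1)⁻¹ * ((Polynomial.X - Polynomial.C (k : L)) * P), fun x => ?_⟩
    rw [Polynomial.eval_mul, Polynomial.eval_mul, Polynomial.eval_C, Polynomial.eval_sub,
      Polynomial.eval_X, Polynomial.eval_C, ← hP, ← succ_mul_bin_succ,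
      inv_mul_cancel_left₀ (Nat.cast_add_one_ne_zero k)]

theorem eq_at_zero_of_eq {X : Type*} [TopologicalSpace X] [T2Space X] {F G : ℤ_[p] → X} (hF : Continuous F) (hG : Continuous G)
    (h : ∀ x, x ≠ 0 → F x = G x) : F 0 = G 0 := by
  have hp := Fact.out (p := p.Prime)
  have ht : Tendsto (fun n : ℕ => (p : ℤ_[p]) ^ n) atTop (𝓝 0) := by
    apply tendsto_pow_atTop_nhds_zero_of_norm_lt_one
    rw [PadicInt.norm_p]
    exact inv_prime_lt_one p
  refine tendsto_nhds_unique ((hF.tendsto 0).comp ht) (((hG.tendsto 0).comp ht).congr fun n => ?_)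
  exact (h _ (pow_ne_zero _ (by exact_mod_cast hp.ne_zero))).symm

variable [IsUltrametricDist L] [CompleteSpace L] [FiniteDimensional ℚ_[p] L]

section

variable {d c : L} {g : ℤ_[p]ˣ}

omit [FiniteDimensional ℚ_[p] L] in
theorem mem_of_amiceFun_eq {H : Submodule L (RobbaRing L)} (hR : posPart L 0 ≤ H)
    {f f' : RobbaRing L} (h : ∀ x : ℤ_[p], amiceFun f x = amiceFun f' x) (hf : f' ∈ H) : f ∈ H := by
  have h1 : f - f' ∈ H := hR (mem_posPart_of_amiceFun_eq_zero (p := p) fun x => by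
    rw [amiceFun_sub, h, sub_self])
  simpa using add_mem h1 hf

/-- The part of the function of f on ℤ_pˣ is an image of cγ - 1 by `hU`. The part on pℤ_p is φ(f')
up to R⁺, hence agrees with d⁻¹ f' modulo the image of dφ - 1. -/
theorem sub_smul_mem (hR : posPart L 0 ≤ coboundaries p d c g)
    (hU : ∀ F : ℤ_[p] → L, LocAnalytic F → (∀ x, ¬IsUnit x → F x = 0) →
      ∃ B : ℤ_[p] → L, LocAnalytic B ∧
        ∀ x, c * (intIncl p L g)⁻¹ * B (↑g⁻¹ * x) - B x = F x)
    (hd : d ≠ 0) {f f' : RobbaRing L} (h : ∀ y : ℤ_[p], amiceFun f' y = amiceFun f ((p : ℤ_[p]) * y)) :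
    f - d⁻¹ • f' ∈ coboundaries p d c g := by
  obtain ⟨B, hB, hB1⟩ := hU _ (LocAnalytic.amiceFun (p := p) f).indicator_isUnit
    fun x hx => Set.indicator_of_notMem (by exact hx) _
  obtain ⟨b, hb, -⟩ := exists_amiceFun_eq hB
  refine mem_of_amiceFun_eq (p := p) hR (fun x => ?_)
    (add_mem (smul_gamma_sub_mem b) (smul_phi_sub_mem (d⁻¹ • f')))
  rw [amiceFun_add, amiceFun_sub, amiceFun_sub, amiceFun_sub, amiceFun_smul, amiceFun_smul,
    amiceFun_smul, map_smul, amiceFun_smul, amiceFun_gamma, hb, hb, ← mul_assoc, hB1,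
    mul_inv_cancel_left₀ hd]
  by_cases hx : IsUnit x
  · rw [Set.indicator_of_mem (by exact hx), amiceFun_phi_of_isUnit _ hx]
    ring
  · rw [Set.indicator_of_notMem (by exact hx)]
    obtain ⟨y, rfl⟩ := exists_eq_mul_of_not_isUnit hx
    rw [amiceFun_phi_mul, ← h y]
    ring

theorem sub_pow_smul_mem (hR : posPart L 0 ≤ coboundaries p d c g)
    (hU : ∀ F : ℤ_[p] → L, LocAnalytic F → (∀ x, ¬IsUnit x → F x = 0) →
      ∃ B : ℤ_[p] → L, LocAnalytic B ∧
        ∀ x, c * (intIncl p L g)⁻¹ * B (↑g⁻¹ * x) - B x = F x)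
    (hd : d ≠ 0) (n : ℕ) {f f' : RobbaRing L}
    (h : ∀ y : ℤ_[p], amiceFun f' y = amiceFun f ((p : ℤ_[p]) ^ n * y)) :
    f - d⁻¹ ^ n • f' ∈ coboundaries p d c g := by
  induction n generalizing f' with
  | zero =>
    rw [pow_zero, one_smul]
    exact hR (mem_posPart_of_amiceFun_eq_zero (p := p) fun x => by rw [amiceFun_sub, h]; simp)
  | succ n ih =>
    obtain ⟨f₁, hf₁, -⟩ := exists_amiceFun_eq
      ((LocAnalytic.amiceFun (p := p) f).comp_mul ((p : ℤ_[p]) ^ n))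
    have h1 := ih hf₁
    have h2 := sub_smul_mem hR hU hd (f := f₁) (f' := f') fun y => by
      rw [h, hf₁, pow_succ, mul_assoc]
    have h3 := add_mem h1 (Submodule.smul_mem _ (d⁻¹ ^ n) h2)
    rw [smul_sub, smul_smul, ← pow_succ, sub_add_sub_cancel] at h3
    exact h3

/-- Replacing x by px multiplies (-x)^i by p^i, so `sub_smul_mem` makes 1 - d⁻¹ p^i times the
element a coboundary. -/
theorem partialD_pow_invT_mem_of_phi (hR : posPart L 0 ≤ coboundaries p d c g)
    (hU : ∀ F : ℤ_[p] → L, LocAnalytic F → (∀ x, ¬IsUnit x → F x = 0) →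
      ∃ B : ℤ_[p] → L, LocAnalytic B ∧
        ∀ x, c * (intIncl p L g)⁻¹ * B (↑g⁻¹ * x) - B x = F x)
    (hd : d ≠ 0) {i : ℕ} (hi : d ≠ (p : L) ^ i) :
    (partialD p L ^ i) (invT L) ∈ coboundaries p d c g := by
  have h := sub_smul_mem hR hU hd (f := (partialD p L ^ i) (invT L))
    (f' := (p : L) ^ i • (partialD p L ^ i) (invT L)) fun y => by
      rw [amiceFun_smul, amiceFun_partialD_pow_invT, amiceFun_partialD_pow_invT, map_mul,
        map_natCast, ← mul_pow, mul_neg]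
  have h0 : 1 - d⁻¹ * (p : L) ^ i ≠ 0 := by
    intro h0
    apply hi
    have := eq_inv_of_mul_eq_one_right (sub_eq_zero.mp h0).symm
    rw [this, inv_inv]
  rw [smul_smul, ← one_smul L ((partialD p L ^ i) (invT L)), smul_smul, mul_one, ← sub_smul] at h
  exact (Submodule.smul_mem_iff _ h0).mp h

/-- (-x)^i is an eigenvector of the operator induced by cγ, with eigenvalue c χ(γ)^(-i-1) ≠ 1. -/
theorem partialD_pow_invT_mem_of_gamma (hR : posPart L 0 ≤ coboundaries p d c g) {i : ℕ}
    (hi : c ≠ intIncl p L g ^ (i + 1)) :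
    (partialD p L ^ i) (invT L) ∈ coboundaries p d c g := by
  have hg0 := intIncl_unit_ne_zero L g
  have hinv : intIncl p L (↑g⁻¹ : ℤ_[p]) = (intIncl p L g)⁻¹ := by
    refine eq_inv_of_mul_eq_one_left ?_
    rw [← map_mul, Units.inv_mul, map_one]
  have h0 : c * (intIncl p L g ^ (i + 1))⁻¹ - 1 ≠ 0 := by
    intro h0
    exact hi ((mul_inv_eq_one₀ (pow_ne_zero _ hg0)).mp (sub_eq_zero.mp h0))
  refine (Submodule.smul_mem_iff _ h0).mp (mem_of_amiceFun_eq (p := p) hR (fun x => ?_)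
    (smul_gamma_sub_mem (p := p) ((partialD p L ^ i) (invT L))))
  rw [amiceFun_smul, amiceFun_sub, amiceFun_smul, amiceFun_gamma, amiceFun_partialD_pow_invT,
    amiceFun_partialD_pow_invT, map_mul, hinv, ← mul_neg, mul_pow, pow_succ, mul_inv, inv_pow]
  ring

/-- Modulo coboundaries f is d⁻ⁿ times a lift of its function at pⁿx. For large n that function is G
- d⁻¹ G(px) plus a polynomial; the first part is a coboundary by `sub_smul_mem`, the second a
combination of the (-x)^i. -/
theorem mem_of_forall_partialD_pow_invT_mem (hR : posPart L 0 ≤ coboundaries p d c g)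
    (hU : ∀ F : ℤ_[p] → L, LocAnalytic F → (∀ x, ¬IsUnit x → F x = 0) →
      ∃ B : ℤ_[p] → L, LocAnalytic B ∧
        ∀ x, c * (intIncl p L g)⁻¹ * B (↑g⁻¹ * x) - B x = F x)
    (hd : d ≠ 0) {H : Submodule L (RobbaRing L)} (hH : coboundaries p d c g ≤ H)
    (he : ∀ i, (partialD p L ^ i) (invT L) ∈ H) (f : RobbaRing L) : f ∈ H := by
  have hpos : 0 < (p : ℝ)⁻¹ := by
    have := (Fact.out (p := p.Prime)).pos
    positivity
  have hp1 := inv_prime_lt_one p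
  obtain ⟨ρ, h0, h1, hF⟩ := LocAnalytic.amiceFun (p := p) f
  obtain ⟨n, hn⟩ := (eventually_mahlerDecay_comp_prime_pow_mul (p := p) (L := L) h0 h1).exists
  obtain ⟨G, hG, N, r, h⟩ := (hn _ hF).exists_sub_comp_prime_mul d⁻¹
  have hG' : LocAnalytic G := ⟨_, hpos, hp1, hG⟩
  obtain ⟨g₀, hg₀, -⟩ := exists_amiceFun_eq hG'
  obtain ⟨g₁, hg₁, -⟩ := exists_amiceFun_eq (hG'.comp_mul (p : ℤ_[p]))
  choose P hP using exists_polynomial_eq_bin p L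
  set Q : Polynomial L := ∑ k ∈ Finset.range N, Polynomial.C (r k) * P k with hQ
  have hQe : ∀ x : ℤ_[p], ∑ k ∈ Finset.range N, r k * bin L x k = Q.eval (intIncl p L x) := by
    intro x
    rw [hQ, Polynomial.eval_finsetSum]
    exact Finset.sum_congr rfl fun k _ => by rw [Polynomial.eval_mul, Polynomial.eval_C, hP]
  set E : RobbaRing L := ∑ i ∈ Finset.range (Q.natDegree + 1),
    (Q.coeff i * (-1) ^ i) • (partialD p L ^ i) (invT L) with hE
  have hsum : ∀ (s : Finset ℕ) (u : ℕ → RobbaRing L) (x : ℤ_[p]),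
      amiceFun (∑ i ∈ s, u i) x = ∑ i ∈ s, amiceFun (u i) x := by
    intro s u x
    induction s using Finset.induction_on with
    | empty => simpa using amiceFun_smul (p := p) (0 : L) (0 : RobbaRing L) x
    | insert i s hi ih => rw [Finset.sum_insert hi, Finset.sum_insert hi, amiceFun_add, ih]
  have hEe : ∀ x : ℤ_[p], amiceFun E x = Q.eval (intIncl p L x) := by
    intro x
    rw [hE, hsum, Polynomial.eval_eq_sum_range]
    refine Finset.sum_congr rfl fun i _ => ?_
    rw [amiceFun_smul, amiceFun_partialD_pow_invT, mul_assoc, ← mul_pow, neg_one_mul, neg_neg]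
  have hEH : E ∈ H := Submodule.sum_mem _ fun i _ => H.smul_mem _ (he i)
  have hg : g₀ - d⁻¹ • g₁ ∈ coboundaries p d c g := sub_smul_mem hR hU hd fun y => by
    rw [hg₀, hg₁]
  have hfn := sub_pow_smul_mem hR hU hd n (f := f) (f' := g₀ - d⁻¹ • g₁ + E) fun y => by
    rw [amiceFun_add, amiceFun_sub, amiceFun_smul, hg₀, hg₁, hEe, h, hQe]
  have := add_mem (hH hfn) (H.smul_mem (d⁻¹ ^ n) (add_mem (hH hg) hEH))
  rwa [sub_add_cancel] at this

end

/-! ## Nonvanishing of the class of `∂ ^ k (1 / T)` -/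

omit [FiniteDimensional ℚ_[p] L] in
theorem false_of_eq_coboundary (g : ℤ_[p]ˣ) (k : ℕ) {A B : ℤ_[p] → L} (hA : LocAnalytic A)
    (hB : LocAnalytic B)
    (h : ∀ y : ℤ_[p], (-intIncl p L (p * y)) ^ k = (p : L) ^ k * A y - A (p * y) +
      (intIncl p L g ^ k * B (↑g⁻¹ * (p * y)) - B (p * y))) : False := by
  induction k generalizing A B with
  | zero =>
    have := h 0
    simp at this
  | succ k ih =>
    -- The constants A(0) and B(0) drop out by subtracting the equation at y = 0. Division by -px
    -- then lowers k by one; the sign accounts for the factors -1 below.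
    obtain ⟨A₁, hA₁, hA1⟩ := (hA.sub (locAnalytic_const (A 0))).exists_eq_mul (sub_self _)
    obtain ⟨B₁, hB₁, hB1⟩ := (hB.sub (locAnalytic_const (B 0))).exists_eq_mul (sub_self _)
    have hg0 := intIncl_unit_ne_zero L g
    have hinv : intIncl p L (↑g⁻¹ : ℤ_[p]) = (intIncl p L g)⁻¹ := by
      refine eq_inv_of_mul_eq_one_left ?_
      rw [← map_mul, Units.inv_mul, map_one]
    have hp0 : (p : ℤ_[p]) ≠ 0 := by exact_mod_cast (Fact.out (p := p.Prime)).ne_zero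
    have h0 := h 0
    rw [mul_zero, mul_zero, map_zero, neg_zero, zero_pow (Nat.succ_ne_zero k)] at h0
    have hA₁' := hA₁.smul (-1)
    have hB₁' := hB₁.smul (-1)
    have key : ∀ y : ℤ_[p], y ≠ 0 → (-intIncl p L (p * y)) ^ k =
        (p : L) ^ k * (-1 * A₁ y) - (-1 * A₁ (p * y)) +
          (intIncl p L g ^ k * (-1 * B₁ (↑g⁻¹ * (p * y))) - (-1 * B₁ (p * y))) := by
      intro y hy
      have hy0 : intIncl p L (p * y) ≠ 0 := by
        rw [Ne, map_eq_zero_iff _ intIncl_injective]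
        exact mul_ne_zero hp0 hy
      apply mul_left_cancel₀ (neg_ne_zero.mpr hy0)
      have e1 := hA1 y
      have e2 := hA1 (p * y)
      have e3 := hB1 (↑g⁻¹ * (p * y))
      have e4 := hB1 (p * y)
      rw [map_mul _ _ (_ * _), hinv] at e3
      have h1 := h y
      have e5 : intIncl p L (p * y) = p * intIncl p L y := by rw [map_mul, map_natCast]
      rw [pow_succ'] at h1
      have e6 : intIncl p L g ^ (k + 1) * ((intIncl p L g)⁻¹ * intIncl p L (p * y)) =
          intIncl p L g ^ k * intIncl p L (p * y) := by
        rw [pow_succ]; field_simp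
      rw [h1]
      linear_combination (p : L) ^ (k + 1) * e1 - e2 + intIncl p L g ^ (k + 1) * e3 - e4 - h0 +
        B₁ (↑g⁻¹ * (p * y)) * e6 - (p : L) ^ k * A₁ y * e5
    refine ih hA₁' hB₁' fun y => ?_
    -- Division by x loses the point 0, which is recovered by continuity.
    rcases eq_or_ne y 0 with rfl | hy
    · have cA := hA₁.continuous
      have cB := hB₁.continuous
      have ci := continuous_intIncl (p := p) (L := L)
      exact eq_at_zero_of_eq (F := fun y : ℤ_[p] => (-intIncl p L (p * y)) ^ k)
        (G := fun y => (p : L) ^ k * (-1 * A₁ y) - (-1 * A₁ (p * y)) +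
          (intIncl p L g ^ k * (-1 * B₁ (↑g⁻¹ * (p * y))) - (-1 * B₁ (p * y)))) (by fun_prop)
        (by fun_prop) key
    · exact key y hy

theorem partialD_pow_invT_notMem (g : ℤ_[p]ˣ) (k : ℕ) :
    (partialD p L ^ k) (invT L) ∉ coboundaries p ((p : L) ^ k) (intIncl p L g ^ (k + 1)) g := by
  intro h
  obtain ⟨_, ⟨a, rfl⟩, _, ⟨b, rfl⟩, hab⟩ := Submodule.mem_sup.mp h
  refine false_of_eq_coboundary g k (LocAnalytic.amiceFun (p := p) a)
    (LocAnalytic.amiceFun (p := p) b) fun y => ?_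
  have hg0 := intIncl_unit_ne_zero L g
  have h1 := congrArg (fun f => amiceFun f ((p : ℤ_[p]) * y)) hab
  simp only [LinearMap.sub_apply, LinearMap.smul_apply, LinearMap.id_apply] at h1
  rw [amiceFun_add, amiceFun_sub, amiceFun_sub, amiceFun_smul, amiceFun_smul, amiceFun_phi_mul,
    amiceFun_gamma, amiceFun_partialD_pow_invT, pow_succ (intIncl p L g) k, mul_assoc,
    mul_inv_cancel_left₀ hg0] at h1
  exact h1.symm

end

section

variable {p : ℕ} [Fact p.Prime] {L : Type*} [NormedField L] [NormedAlgebra ℚ_[p] L]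

/-! ## The characters `ω x ^ k` -/

theorem coe_charX (y : ℚ_[p]ˣ) : (charX p L y : L) = algebraMap ℚ_[p] L y := rfl

theorem coe_charX_pUnit : (charX p L (pUnit p) : L) = p := by
  rw [coe_charX, pUnit, Units.val_mk0, map_natCast]

theorem omega_pUnit : omega p L (pUnit p) = 1 := by
  have h : charAbs p L (pUnit p) = charX p L (pUnit p) ^ (-((pUnit p : ℚ_[p]ˣ) : ℚ_[p]).valuation) :=
    rfl
  rw [omega, MonoidHom.mul_apply, h, pUnit, Units.val_mk0, Padic.valuation_p, zpow_neg_one,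
    mul_inv_cancel]

theorem coe_unitIncl (u : ℤ_[p]ˣ) : ((unitIncl u : ℚ_[p]ˣ) : ℚ_[p]) = ((u : ℤ_[p]) : ℚ_[p]) := rfl

theorem coe_charX_unitIncl (u : ℤ_[p]ˣ) : (charX p L (unitIncl u) : L) = intIncl p L u := rfl

theorem omega_unitIncl (u : ℤ_[p]ˣ) : omega p L (unitIncl u) = charX p L (unitIncl u) := by
  have h : charAbs p L (unitIncl u) =
      charX p L (pUnit p) ^ (-((unitIncl u : ℚ_[p]ˣ) : ℚ_[p]).valuation) := rfl
  have hv : ((u : ℤ_[p]) : ℚ_[p]).valuation = 0 := by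
    have h1 : ‖((u : ℤ_[p]) : ℚ_[p])‖ = 1 := by
      rw [← PadicInt.norm_def]
      exact PadicInt.norm_units u
    have h2 : ((u : ℤ_[p]) : ℚ_[p]) ≠ 0 := by
      rw [← norm_ne_zero_iff, h1]
      exact one_ne_zero
    have hp : (1 : ℝ) < p := by exact_mod_cast (Fact.out (p := p.Prime)).one_lt
    rw [Padic.norm_eq_zpow_neg_valuation h2, zpow_eq_one_iff_right₀ (by positivity) hp.ne'] at h1
    omega
  rw [omega, MonoidHom.mul_apply, h, coe_unitIncl, hv, neg_zero, zpow_zero, mul_one]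

theorem coe_omega_mul_charX_pow_pUnit (k : ℕ) :
    ((omega p L * charX p L ^ k) (pUnit p) : L) = (p : L) ^ k := by
  rw [MonoidHom.mul_apply, omega_pUnit, one_mul, MonoidHom.pow_apply, Units.val_pow_eq_pow_val,
    coe_charX_pUnit]

theorem coe_omega_mul_charX_pow_unitIncl (k : ℕ) (u : ℤ_[p]ˣ) :
    ((omega p L * charX p L ^ k) (unitIncl u) : L) = intIncl p L u ^ (k + 1) := by
  rw [MonoidHom.mul_apply, omega_unitIncl, MonoidHom.pow_apply, ← pow_succ',
    Units.val_pow_eq_pow_val, coe_charX_unitIncl]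

theorem exists_eq_pUnit_zpow_mul (y : ℚ_[p]ˣ) :
    ∃ (n : ℤ) (u : ℤ_[p]ˣ), y = pUnit p ^ n * unitIncl u := by
  have hp0 : (p : ℚ_[p]) ≠ 0 := by exact_mod_cast (Fact.out (p := p.Prime)).ne_zero
  have hpr : (p : ℝ) ≠ 0 := by exact_mod_cast (Fact.out (p := p.Prime)).ne_zero
  set n := (y : ℚ_[p]).valuation
  have h : ‖(p : ℚ_[p]) ^ (-n) * y‖ = 1 := by
    rw [norm_mul, norm_zpow, Padic.norm_p, Padic.norm_eq_zpow_neg_valuation y.ne_zero, inv_zpow,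
      ← zpow_neg, ← zpow_add₀ hpr]
    simp [n]
  refine ⟨n, PadicInt.mkUnits h, Units.ext ?_⟩
  rw [Units.val_mul, coe_unitIncl, PadicInt.mkUnits_eq, Units.val_zpow_eq_zpow_val, pUnit,
    Units.val_mk0, ← mul_assoc, ← zpow_add₀ hp0, add_neg_cancel, zpow_zero, one_mul]

theorem continuous_unitIncl : Continuous (unitIncl : ℤ_[p]ˣ →* ℚ_[p]ˣ) :=
  Continuous.units_map _ continuous_subtype_val

/-- A continuous character with the same values as `ω x ^ k` at `p` and at a topological generator
of `ℤ_pˣ` is `ω x ^ k`. -/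
theorem eq_omega_mul_charX_pow {δ : ℚ_[p]ˣ →* Lˣ} (hδ : Continuous δ) {g : ℤ_[p]ˣ}
    (hg : (Subgroup.zpowers g).topologicalClosure = ⊤) {k : ℕ} (h1 : (δ (pUnit p) : L) = (p : L) ^ k)
    (h2 : (δ (unitIncl g) : L) = intIncl p L g ^ (k + 1)) :
    δ = omega p L * charX p L ^ k := by
  let K : Subgroup ℤ_[p]ˣ := (δ.comp unitIncl).eqLocus ((omega p L * charX p L ^ k).comp unitIncl)
  have hK : ∀ u, u ∈ K ↔ (δ (unitIncl u) : L) = intIncl p L u ^ (k + 1) := by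
    intro u
    rw [← coe_omega_mul_charX_pow_unitIncl, Units.val_inj]
    rfl
  have hKc : IsClosed (K : Set ℤ_[p]ˣ) := by
    have : (K : Set ℤ_[p]ˣ) = {u : ℤ_[p]ˣ | (δ (unitIncl u) : L) = intIncl p L u ^ (k + 1)} :=
      Set.ext hK
    rw [this]
    exact isClosed_eq (Units.continuous_val.comp (hδ.comp continuous_unitIncl))
      ((continuous_intIncl.comp Units.continuous_val).pow _)
  have hall := mem_of_isClosed hg K hKc ((hK g).mpr h2)
  ext y
  obtain ⟨n, u, rfl⟩ := exists_eq_pUnit_zpow_mul y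
  have e1 : δ (pUnit p) = (omega p L * charX p L ^ k) (pUnit p) := Units.ext (by
    rw [h1, coe_omega_mul_charX_pow_pUnit])
  have e2 : δ (unitIncl u) = (omega p L * charX p L ^ k) (unitIncl u) := hall u
  rw [map_mul, map_zpow, map_mul, map_zpow, e1, e2]

/-! ## The second cohomology -/

section

variable [FiniteDimensional ℚ_[p] L] [IsUltrametricDist L] [CompleteSpace L]

/-- Stated for a submodule H so that it serves both cases: H is the preimage of the span of a class
when δ = ω x^k, and the range of `d₂` itself otherwise. -/
theorem partialD_pow_invT_mem_range (hp2 : p ≠ 2) {δ : ℚ_[p]ˣ →* Lˣ} (hδ : Continuous δ)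
    {g : ℤ_[p]ˣ} (hg : (Subgroup.zpowers g).topologicalClosure = ⊤)
    {H : Submodule L (RobbaRing L)} (hH : LinearMap.range (d₂ δ g) ≤ H)
    (he : ∀ i : ℕ, (δ (pUnit p) : L) = (p : L) ^ i →
      (δ (unitIncl g) : L) = intIncl p L g ^ (i + 1) → (partialD p L ^ i) (invT L) ∈ H)
    (f : RobbaRing L) : f ∈ H := by
  rw [range_d₂] at hH
  have hR := posPart_le_coboundaries (L := L) hp2 hg (δ (pUnit p)) (δ (unitIncl g))
  have hd : (δ (pUnit p) : L) ≠ 0 := Units.ne_zero _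
  have hU := fun (F : ℤ_[p] → L) (hF : LocAnalytic F) (hF0 : ∀ x, ¬IsUnit x → F x = 0) =>
    hF.exists_mul_comp_sub hF0 (exists_pow_near_one (χ := δ.comp unitIncl)
      (fun n hn => pow_ne_one_of_generator hg hn) (hδ.comp continuous_unitIncl))
  refine mem_of_forall_partialD_pow_invT_mem hR hU hd hH (fun i => ?_) f
  by_cases h1 : (δ (pUnit p) : L) = (p : L) ^ i
  · by_cases h2 : (δ (unitIncl g) : L) = intIncl p L g ^ (i + 1)
    · exact he i h1 h2
    · exact hH (partialD_pow_invT_mem_of_gamma hR h2)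
  · exact hH (partialD_pow_invT_mem_of_phi hR hU hd h1)

end

end

end PhiGamma

end

/-! ### The dimension and the generator of H²(δ) -/

theorem corollary2p13 (p : ℕ) [Fact p.Prime] (hp : p ≠ 2)
    (L : Type*) [NormedField L] [NormedAlgebra ℚ_[p] L] [FiniteDimensional ℚ_[p] L]
    (δ : ℚ_[p]ˣ →ₜ* Lˣ)
    (γ : ℤ_[p]ˣ) (hγ : (Subgroup.zpowers γ).topologicalClosure = ⊤) :
    (∀ k : ℕ, (δ : ℚ_[p]ˣ →* Lˣ) = PhiGamma.omega p L * PhiGamma.charX p L ^ k →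
      Module.finrank L (PhiGamma.H2 (δ : ℚ_[p]ˣ →* Lˣ) γ) = 1 ∧
      Submodule.span L {PhiGamma.H2.cls (δ : ℚ_[p]ˣ →* Lˣ) γ
        ((PhiGamma.partialD p L ^ k) (PhiGamma.invT L))} = ⊤) ∧
    ((∀ k : ℕ, (δ : ℚ_[p]ˣ →* Lˣ) ≠ PhiGamma.omega p L * PhiGamma.charX p L ^ k) →
      Subsingleton (PhiGamma.H2 (δ : ℚ_[p]ˣ →* Lˣ) γ)) := by
  have := PhiGamma.ultrametric p L
  have := FiniteDimensional.complete ℚ_[p] L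
  have hδ : Continuous (δ : ℚ_[p]ˣ →* Lˣ) := δ.continuous_toFun
  refine ⟨fun k hk => ?_, fun h => ?_⟩
  · set e := (PhiGamma.partialD p L ^ k) (PhiGamma.invT L) with he
    have hspan : Submodule.span L {PhiGamma.H2.cls (δ : ℚ_[p]ˣ →* Lˣ) γ e} = ⊤ := by
      rw [eq_top_iff]
      rintro x -
      obtain ⟨f, rfl⟩ := Submodule.mkQ_surjective _ x
      refine PhiGamma.partialD_pow_invT_mem_range hp hδ hγ
        (H := (Submodule.span L {PhiGamma.H2.cls (δ : ℚ_[p]ˣ →* Lˣ) γ e}).comap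
          (PhiGamma.H2.cls (δ : ℚ_[p]ˣ →* Lˣ) γ)) (fun y hy => ?_) (fun i h1 _ => ?_) f
      · have hy0 : PhiGamma.H2.cls (δ : ℚ_[p]ˣ →* Lˣ) γ y = 0 :=
          (Submodule.Quotient.mk_eq_zero _).mpr hy
        rw [Submodule.mem_comap, hy0]
        exact zero_mem _
      · rw [hk, PhiGamma.coe_omega_mul_charX_pow_pUnit] at h1
        have := PhiGamma.charZero p L
        have hik : k = i := Nat.pow_right_injective (Fact.out (p := p.Prime)).two_le
          (by exact_mod_cast h1)
        subst hik
        exact Submodule.mem_span_singleton_self _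
    refine ⟨finrank_eq_one (PhiGamma.H2.cls (δ : ℚ_[p]ˣ →* Lˣ) γ e) (fun h0 => ?_) (fun w => ?_),
      hspan⟩
    · have h1 : e ∈ LinearMap.range (PhiGamma.d₂ (δ : ℚ_[p]ˣ →* Lˣ) γ) :=
        (Submodule.Quotient.mk_eq_zero _).mp h0
      rw [PhiGamma.range_d₂, hk, PhiGamma.coe_omega_mul_charX_pow_pUnit,
        PhiGamma.coe_omega_mul_charX_pow_unitIncl] at h1
      exact PhiGamma.partialD_pow_invT_notMem γ k h1
    · have hw : w ∈ Submodule.span L {PhiGamma.H2.cls (δ : ℚ_[p]ˣ →* Lˣ) γ e} := by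
        rw [hspan]; trivial
      exact Submodule.mem_span_singleton.mp hw
  · rw [Submodule.Quotient.subsingleton_iff, eq_top_iff]
    rintro f -
    exact PhiGamma.partialD_pow_invT_mem_range hp hδ hγ le_rfl
      (fun i h1 h2 => absurd (PhiGamma.eq_omega_mul_charX_pow hδ hγ h1 h2) (h i)) f
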